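/- Let $\mathbb{F}_4$ be the field with four elements, $\mathbb{W}=W(\mathbb{F}_4)$ its ring of $2$-typical Witt vectors, $\sigma$ the Frobenius automorphism of $\mathbb{W}$, and $\zeta\in\mathbb{F}_4$ a primitive third root of unity with Teichmüller lift $\omega\in\mathbb{W}$. Let $F_{\mathcal{C}}$ be the formal group law over $\mathbb{F}_4$ of the supersingular elliptic curve $\mathcal{C}: y^2-y=x^3$ in the parameter $z=-x/y$ at the origin, and let $F_2$ be the Honda formal group law of height $2$ over $\mathbb{F}_4$, that is, the reduction modulo $2$ of the formal group law over $\mathbb{Z}$ with logarithm $\sum_{k\ge 0}x^{4^k}/2^k$. Both are commutative formal group laws. Let $\mathrm{End}(F)$ be the ring of endomorphisms of $F$ over $\mathbb{F}_4$, with product $f\circ g$ and sum $F(f(x),g(x))$, and let $\mathbb{S}_{\mathcal{C}}=\mathrm{End}(F_{\mathcal{C}})^\times=\mathrm{Aut}(F_{\mathcal{C}})$ and $\mathbb{S}_2=\mathrm{End}(F_2)^\times=\mathrm{Aut}(F_2)$. There are ring isomorphisms $$\mathbb{W}\langle T\rangle/(T^2=-2,\ aT=Ta^{\sigma})\;\cong\;\mathrm{End}(F_{\mathcal{C}}),\qquad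 \mathbb{W}\langle S\rangle/(S^2=2,\ aS=Sa^{\sigma})\;\cong\;\mathrm{End}(F_2)$$ (with the relations for all $a\in\mathbb{W}$), which send $T$, respectively $S$, to $x^2$ and the Teichmüller lift of each $c\in\mathbb{F}_4$ to $cx$; in particular they identify $\mathbb{S}_{\mathcal{C}}$ and $\mathbb{S}_2$ with the unit groups of the rings on the left. Moreover, $-7$ has a square root $\sqrt{-7}\in\mathbb{W}$ with $\sqrt{-7}\equiv 1$ modulo $4$, the element $\alpha=(1-2\omega)/\sqrt{-7}$ lies in $\mathbb{W}$ and satisfies $\alpha\alpha^{\sigma}=-1$, and under these identifications the map $$a+bT\longmapsto a+b(\alpha S)\qquad(a,b\in\mathbb{W})$$ is an isomorphism of groups $\mathbb{S}_{\mathcal{C}}\to\mathbb{S}_2$. -/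

import Mathlib

noncomputable section

/-! ### Endomorphisms of a one-dimensional formal group law -/

namespace FormalGroup

variable {R : Type*} [CommRing R]

/-- An endomorphism of a formal group law `F` over `R`: a power series `f` with `f(0) = 0` and
`f(F(x, y)) = F(f(x), f(y))`. -/
@[ext]
structure Endo (F : FormalGroup R) where
  /-- The underlying power series. -/
  toSeries : PowerSeries R
  constantCoeff_eq_zero : PowerSeries.constantCoeff toSeries = 0
  map_law : toSeries.subst F.toPowerSeries =
    F.toPowerSeries.subst
      ![toSeries.subst (MvPowerSeries.X 0 : MvPowerSeries (Fin 2) R),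
        toSeries.subst (MvPowerSeries.X 1 : MvPowerSeries (Fin 2) R)]

variable (F : FormalGroup R)

theorem hasSubst_pair {τ : Type*} {u v : MvPowerSeries τ R}
    (hu : PowerSeries.HasSubst u) (hv : PowerSeries.HasSubst v) :
    MvPowerSeries.HasSubst ![u, v] :=
  MvPowerSeries.hasSubst_of_constantCoeff_nilpotent fun s => by fin_cases s <;> simpa

theorem subst_law_subst {σ τ : Type*} {u v : MvPowerSeries σ R} {h : σ → MvPowerSeries τ R}
    (hu : PowerSeries.HasSubst u) (hv : PowerSeries.HasSubst v) (hh : MvPowerSeries.HasSubst h) :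
    (F.toPowerSeries.subst ![u, v]).subst h = F.toPowerSeries.subst ![u.subst h, v.subst h] := by
  rw [MvPowerSeries.subst_comp_subst_apply (hasSubst_pair hu hv) hh]
  congr 1
  funext s
  fin_cases s <;> rfl

namespace Endo

variable {F}

theorem hasSubst (f : F.Endo) : PowerSeries.HasSubst f.toSeries :=
  PowerSeries.HasSubst.of_constantCoeff_zero' f.constantCoeff_eq_zero

theorem hasSubst_subst (f : F.Endo) {τ : Type*} {u : MvPowerSeries τ R}
    (hu : PowerSeries.HasSubst u) : PowerSeries.HasSubst (f.toSeries.subst u) :=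
  PowerSeries.coe_substAlgHom (R := R) hu ▸ PowerSeries.HasSubst.comp f.hasSubst hu

theorem map_law' (f : F.Endo) {τ : Type*} {u v : MvPowerSeries τ R}
    (hu : PowerSeries.HasSubst u) (hv : PowerSeries.HasSubst v) :
    f.toSeries.subst (F.toPowerSeries.subst ![u, v]) =
      F.toPowerSeries.subst ![f.toSeries.subst u, f.toSeries.subst v] := by
  have hF : PowerSeries.HasSubst F.toPowerSeries :=
    PowerSeries.HasSubst.of_constantCoeff_zero F.zero_constantCoeff
  have huv := hasSubst_pair hu hv
  have h := congrArg (MvPowerSeries.subst ![u, v]) f.map_law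
  rw [subst_law_subst F (f.hasSubst_subst (PowerSeries.HasSubst.X 0))
    (f.hasSubst_subst (PowerSeries.HasSubst.X 1)) huv] at h
  simp only [PowerSeries.subst] at h ⊢
  rw [MvPowerSeries.subst_comp_subst_apply hF.const huv,
    MvPowerSeries.subst_comp_subst_apply (PowerSeries.HasSubst.X 0).const huv,
    MvPowerSeries.subst_comp_subst_apply (PowerSeries.HasSubst.X 1).const huv] at h
  simpa [MvPowerSeries.subst_X huv] using h

/-- The identity endomorphism `x`. -/
instance : One F.Endo where
  one :=
    { toSeries := PowerSeries.X
      constantCoeff_eq_zero := by simp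
      map_law := by
        rw [PowerSeries.subst_X (PowerSeries.HasSubst.of_constantCoeff_zero F.zero_constantCoeff),
          PowerSeries.subst_X (PowerSeries.HasSubst.X 0),
          PowerSeries.subst_X (PowerSeries.HasSubst.X 1)]
        have : (![MvPowerSeries.X 0, MvPowerSeries.X 1] : Fin 2 → MvPowerSeries (Fin 2) R) =
            MvPowerSeries.X := by
          funext s; fin_cases s <;> rfl
        rw [this, MvPowerSeries.subst_self, id] }

/-- Multiplication is composition: `(f * g)(x) = f(g(x))`. -/
instance : Mul F.Endo where
  mul f g :=
    { toSeries := f.toSeries.subst g.toSeries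
      constantCoeff_eq_zero :=
        PowerSeries.constantCoeff_subst_eq_zero g.constantCoeff_eq_zero _ f.constantCoeff_eq_zero
      map_law := by
        have hF : PowerSeries.HasSubst F.toPowerSeries :=
          PowerSeries.HasSubst.of_constantCoeff_zero F.zero_constantCoeff
        rw [PowerSeries.subst_comp_subst_apply g.hasSubst hF,
          PowerSeries.subst_comp_subst_apply g.hasSubst (PowerSeries.HasSubst.X 0),
          PowerSeries.subst_comp_subst_apply g.hasSubst (PowerSeries.HasSubst.X 1),
          g.map_law, f.map_law' (g.hasSubst_subst (PowerSeries.HasSubst.X 0))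
            (g.hasSubst_subst (PowerSeries.HasSubst.X 1))] }

theorem one_toSeries : (1 : F.Endo).toSeries = PowerSeries.X := rfl

theorem mul_toSeries (f g : F.Endo) : (f * g).toSeries = f.toSeries.subst g.toSeries := rfl

/-- The monoid of endomorphisms under composition. Its group of units `(F.Endo)ˣ` is the
automorphism group of `F`. -/
instance : Monoid F.Endo where
  mul_assoc f g h := Endo.ext <| by
    simp only [mul_toSeries]
    exact PowerSeries.subst_comp_subst_apply g.hasSubst h.hasSubst _
  one_mul f := Endo.ext (PowerSeries.subst_X f.hasSubst)
  mul_one f := Endo.ext (PowerSeries.X_subst f.toSeries)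

/-- The zero endomorphism. -/
instance : Zero F.Endo where
  zero :=
    { toSeries := 0
      constantCoeff_eq_zero := by simp
      map_law := by
        have h0 (u : MvPowerSeries (Fin 2) R) (hu : PowerSeries.HasSubst u) :
            (0 : PowerSeries R).subst u = 0 := by
          rw [← PowerSeries.coe_substAlgHom hu, map_zero]
        rw [h0 _ (PowerSeries.HasSubst.of_constantCoeff_zero F.zero_constantCoeff),
          h0 _ (PowerSeries.HasSubst.X 0), h0 _ (PowerSeries.HasSubst.X 1),
          F.add_zero PowerSeries.HasSubst.zero] }

theorem zero_toSeries : (0 : F.Endo).toSeries = 0 := rfl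

theorem subst_law (f g : F.Endo) {τ : Type*} {h : MvPowerSeries τ R}
    (hh : PowerSeries.HasSubst h) :
    PowerSeries.subst h (F.toPowerSeries.subst ![f.toSeries, g.toSeries] : PowerSeries R) =
      F.toPowerSeries.subst ![f.toSeries.subst h, g.toSeries.subst h] :=
  F.subst_law_subst f.hasSubst g.hasSubst hh.const

/-- For a commutative formal group law, addition is `(f + g)(x) = F(f(x), g(x))`. -/
instance [F.IsComm] : Add F.Endo where
  add f g :=
    { toSeries := F.toPowerSeries.subst ![f.toSeries, g.toSeries]
      constantCoeff_eq_zero :=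
        MvPowerSeries.constantCoeff_subst_eq_zero (hasSubst_pair f.hasSubst g.hasSubst)
          (fun s => by
            fin_cases s
            · exact f.constantCoeff_eq_zero
            · exact g.constantCoeff_eq_zero) F.zero_constantCoeff
      map_law := by
        have hF : PowerSeries.HasSubst F.toPowerSeries :=
          PowerSeries.HasSubst.of_constantCoeff_zero F.zero_constantCoeff
        have h0 : PowerSeries.HasSubst (MvPowerSeries.X 0 : MvPowerSeries (Fin 2) R) :=
          PowerSeries.HasSubst.X 0
        have h1 : PowerSeries.HasSubst (MvPowerSeries.X 1 : MvPowerSeries (Fin 2) R) :=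
          PowerSeries.HasSubst.X 1
        rw [subst_law f g hF, subst_law f g h0, subst_law f g h1, f.map_law, g.map_law]
        have key (a b c d : F.Point (Fin 2)) := congrArg Subtype.val (add_add_add_comm a b c d)
        exact key ⟨_, f.hasSubst_subst h0⟩ ⟨_, f.hasSubst_subst h1⟩
          ⟨_, g.hasSubst_subst h0⟩ ⟨_, g.hasSubst_subst h1⟩ }

theorem add_toSeries [F.IsComm] (f g : F.Endo) :
    (f + g).toSeries = F.toPowerSeries.subst ![f.toSeries, g.toSeries] := rfl

/-- The endomorphism ring of a commutative formal group law (only the semiring structure is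
recorded; a ring isomorphism onto it shows in particular that negatives exist). -/
instance [F.IsComm] : Semiring F.Endo where
  add_assoc f g h := Endo.ext (F.assoc' f.hasSubst g.hasSubst h.hasSubst)
  zero_add f := Endo.ext (F.zero_add f.hasSubst)
  add_zero f := Endo.ext (F.add_zero f.hasSubst)
  add_comm f g := Endo.ext (F.comm' f.hasSubst g.hasSubst)
  nsmul := nsmulRec
  left_distrib f g h := Endo.ext (f.map_law' g.hasSubst h.hasSubst)
  right_distrib f g h := Endo.ext (subst_law f g h.hasSubst)
  zero_mul f := Endo.ext <| by
    rw [mul_toSeries, zero_toSeries, ← PowerSeries.coe_substAlgHom f.hasSubst, map_zero]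
  mul_zero f := Endo.ext (PowerSeries.subst_zero_of_constantCoeff_zero f.constantCoeff_eq_zero)

end Endo

end FormalGroup

/-! ### The formal group law of a Weierstrass curve -/

namespace WeierstrassCurve

variable {R : Type*} [CommRing R] (E : WeierstrassCurve R)

/-- The right-hand side of the Weierstrass equation in the coordinates `z = -x/y`, `w = -1/y`. -/
def wStep (w : PowerSeries R) : PowerSeries R :=
  PowerSeries.X ^ 3 + PowerSeries.C E.a₁ * PowerSeries.X * w
    + PowerSeries.C E.a₂ * PowerSeries.X ^ 2 * w + PowerSeries.C E.a₃ * w ^ 2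
    + PowerSeries.C E.a₄ * PowerSeries.X * w ^ 2 + PowerSeries.C E.a₆ * w ^ 3

/-- The expansion `w(z)` of `w = -1/y` at the origin in terms of `z = -x/y`: the solution of
`w = z³ + a₁zw + a₂z²w + a₃w² + a₄zw² + a₆w³` with `w(0) = 0`, obtained by iteration
(see `wSeries_eq`). -/
def wSeries : PowerSeries R :=
  PowerSeries.mk fun n => PowerSeries.coeff n (E.wStep^[n + 1] 0)

theorem dvd_wStep_sub {u v : PowerSeries R} {n : ℕ} (hu : PowerSeries.X ∣ u)
    (hv : PowerSeries.X ∣ v) (h : PowerSeries.X ^ n ∣ u - v) :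
    PowerSeries.X ^ (n + 1) ∣ E.wStep u - E.wStep v := by
  obtain ⟨u, rfl⟩ := hu
  obtain ⟨v, rfl⟩ := hv
  obtain ⟨d, hd⟩ := h
  have h1 : E.wStep (PowerSeries.X * u) - E.wStep (PowerSeries.X * v) =
      (PowerSeries.X * u - PowerSeries.X * v) * (PowerSeries.X * (PowerSeries.C E.a₁
        + PowerSeries.C E.a₂ * PowerSeries.X + PowerSeries.C E.a₃ * (u + v)
        + PowerSeries.C E.a₄ * PowerSeries.X * (u + v)
        + PowerSeries.C E.a₆ * PowerSeries.X * (u ^ 2 + u * v + v ^ 2))) := by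
    simp only [wStep]; ring
  rw [h1, hd]
  exact ⟨d * (PowerSeries.C E.a₁ + PowerSeries.C E.a₂ * PowerSeries.X
    + PowerSeries.C E.a₃ * (u + v) + PowerSeries.C E.a₄ * PowerSeries.X * (u + v)
    + PowerSeries.C E.a₆ * PowerSeries.X * (u ^ 2 + u * v + v ^ 2)), by ring⟩

theorem X_dvd_wStep {u : PowerSeries R} (hu : PowerSeries.X ∣ u) : PowerSeries.X ∣ E.wStep u := by
  obtain ⟨u, rfl⟩ := hu
  refine ⟨PowerSeries.X ^ 2 + PowerSeries.C E.a₁ * PowerSeries.X * u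
    + PowerSeries.C E.a₂ * PowerSeries.X ^ 2 * u + PowerSeries.C E.a₃ * PowerSeries.X * u ^ 2
    + PowerSeries.C E.a₄ * PowerSeries.X ^ 2 * u ^ 2
    + PowerSeries.C E.a₆ * PowerSeries.X ^ 2 * u ^ 3, ?_⟩
  simp only [wStep]; ring

theorem X_dvd_iterate (n : ℕ) : PowerSeries.X ∣ E.wStep^[n] 0 := by
  induction n with
  | zero => simp
  | succ n ih => rw [Function.iterate_succ_apply']; exact E.X_dvd_wStep ih

theorem dvd_iterate_sub (n k : ℕ) :
    PowerSeries.X ^ n ∣ E.wStep^[n + k] 0 - E.wStep^[n] 0 := by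
  induction n with
  | zero => simp
  | succ n ih =>
    rw [show n + 1 + k = (n + k) + 1 by ring, Function.iterate_succ_apply',
      Function.iterate_succ_apply']
    exact E.dvd_wStep_sub (E.X_dvd_iterate _) (E.X_dvd_iterate _) ih

theorem dvd_wSeries_sub (n : ℕ) : PowerSeries.X ^ n ∣ E.wSeries - E.wStep^[n] 0 := by
  rw [PowerSeries.X_pow_dvd_iff]
  intro m hm
  obtain ⟨k, rfl⟩ : ∃ k, n = m + 1 + k := ⟨n - (m + 1), by omega⟩
  have := (PowerSeries.X_pow_dvd_iff.mp (E.dvd_iterate_sub (m + 1) k)) m (by omega)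
  rw [map_sub, sub_eq_zero] at this
  rw [map_sub, this, wSeries, PowerSeries.coeff_mk, sub_self]

theorem X_dvd_wSeries : PowerSeries.X ∣ E.wSeries := by
  have := dvd_add (E.dvd_wSeries_sub 1) (pow_one (PowerSeries.X (R := R)) ▸ E.X_dvd_iterate 1)
  simpa using this

/-- `w(z) = z³ + a₁zw(z) + a₂z²w(z) + a₃w(z)² + a₄zw(z)² + a₆w(z)³`. -/
theorem wSeries_eq : E.wSeries = PowerSeries.X ^ 3 + PowerSeries.C E.a₁ * PowerSeries.X * E.wSeries
    + PowerSeries.C E.a₂ * PowerSeries.X ^ 2 * E.wSeries + PowerSeries.C E.a₃ * E.wSeries ^ 2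
    + PowerSeries.C E.a₄ * PowerSeries.X * E.wSeries ^ 2
    + PowerSeries.C E.a₆ * E.wSeries ^ 3 := by
  change E.wSeries = E.wStep E.wSeries
  ext n
  have h1 := E.dvd_wSeries_sub (n + 1)
  have h2 := E.dvd_wStep_sub E.X_dvd_wSeries (E.X_dvd_iterate n) (E.dvd_wSeries_sub n)
  rw [← Function.iterate_succ_apply' E.wStep] at h2
  have h3 := dvd_sub h1 h2
  rw [sub_sub_sub_cancel_right] at h3
  have := PowerSeries.X_pow_dvd_iff.mp h3 n (by omega)
  rwa [map_sub, sub_eq_zero] at this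

/-- The slope `λ(z₁, z₂) = (w(z₂) - w(z₁)) / (z₂ - z₁)`. Since
`(z₂ᵐ - z₁ᵐ) / (z₂ - z₁) = ∑_{i + j + 1 = m} z₁ⁱ z₂ʲ`, its coefficient at `z₁ⁱ z₂ʲ` is the
coefficient of `w` in degree `i + j + 1`. -/
def slopeSeries : MvPowerSeries (Fin 2) R :=
  fun n => PowerSeries.coeff (n 0 + n 1 + 1) E.wSeries

/-- `ν(z₁, z₂) = w(z₁) - λ(z₁, z₂) z₁`, so that `w = λ z + ν` is the line through
`(z₁, w(z₁))` and `(z₂, w(z₂))`. -/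
def interceptSeries : MvPowerSeries (Fin 2) R :=
  E.wSeries.subst (MvPowerSeries.X 0 : MvPowerSeries (Fin 2) R)
    - E.slopeSeries * MvPowerSeries.X 0

/-- The `z`-coordinate of the third point of intersection of the curve with the line
`w = λ z + ν`: minus `z₁`, minus `z₂`, plus the sum of the three roots of the cubic obtained
by substituting the line into the equation of the curve. -/
def thirdPointSeries : MvPowerSeries (Fin 2) R :=
  - MvPowerSeries.X 0 - MvPowerSeries.X 1
    - (MvPowerSeries.C E.a₁ * E.slopeSeries + MvPowerSeries.C E.a₂ * E.interceptSeries
        + MvPowerSeries.C E.a₃ * E.slopeSeries ^ 2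
        + 2 * MvPowerSeries.C E.a₄ * E.slopeSeries * E.interceptSeries
        + 3 * MvPowerSeries.C E.a₆ * E.slopeSeries ^ 2 * E.interceptSeries)
      * MvPowerSeries.invOfUnit (1 + MvPowerSeries.C E.a₂ * E.slopeSeries
        + MvPowerSeries.C E.a₄ * E.slopeSeries ^ 2
        + MvPowerSeries.C E.a₆ * E.slopeSeries ^ 3) 1

/-- The `z`-coordinate of the inverse of the point with parameter `z`:
`-z / (1 - a₁ z - a₃ w(z))`. -/
def negSeries : PowerSeries R :=
  - PowerSeries.X * PowerSeries.invOfUnit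
    (1 - PowerSeries.C E.a₁ * PowerSeries.X - PowerSeries.C E.a₃ * E.wSeries) 1

/-- The formal group law `F_E(z₁, z₂)` of a Weierstrass curve in the parameter `z = -x/y`, as a
power series: the inverse of the third point on the line through the points with parameters
`z₁` and `z₂`. -/
def formalGroupSeries : MvPowerSeries (Fin 2) R :=
  E.negSeries.subst E.thirdPointSeries

end WeierstrassCurve

/-! ### The two formal group laws over the field with four elements -/

/-- The field with four elements. -/
abbrev F4 : Type := GaloisField 2 2

/-- The supersingular curve `y² - y = x³` over the field with four elements. -/
def curveC : WeierstrassCurve F4 where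
  a₁ := 0
  a₂ := 0
  a₃ := -1
  a₄ := 0
  a₆ := 0

/-- The Honda logarithm of height two at the prime two, `ℓ(x) = ∑_k x^(4^k) / 2^k`. -/
def hondaLog : PowerSeries ℚ :=
  PowerSeries.mk fun n => ∑ k ∈ Finset.range (n + 1), if n = 4 ^ k then (1 / 2 : ℚ) ^ k else 0

/-- `F` is the Honda formal group law of height two at the prime two over the field with four
elements: the reduction of the (unique) formal group law `G` over `ℤ` with logarithm `ℓ`, that is,
with `ℓ(G(x, y)) = ℓ(x) + ℓ(y)` over `ℚ`. -/
def IsHondaFormalGroup (F : FormalGroup F4) : Prop :=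
  ∃ G : FormalGroup ℤ,
    hondaLog.subst (G.map (Int.castRingHom ℚ)).toPowerSeries =
      hondaLog.subst (MvPowerSeries.X 0 : MvPowerSeries (Fin 2) ℚ)
        + hondaLog.subst (MvPowerSeries.X 1 : MvPowerSeries (Fin 2) ℚ) ∧
    F = G.map (Int.castRingHom F4)

/-! ### The twisted extensions of the Witt vectors -/

/-- The ring of Witt vectors of the field with four elements. -/
abbrev W4 : Type := WittVector 2 F4

/-- The Frobenius automorphism `σ` of the Witt vectors. -/
def frob : W4 →+* W4 := WittVector.frobenius

theorem frob_frob (a : W4) : frob (frob a) = a := by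
  ext n
  simp only [frob, WittVector.coeff_frobenius_charP]
  have h : Nat.card F4 = 4 := by
    have := GaloisField.card 2 2 (by norm_num)
    simpa using this
  have : Fintype F4 := Fintype.ofFinite _
  have h2 := FiniteField.pow_card (a.coeff n)
  rw [← Nat.card_eq_fintype_card, h] at h2
  rw [← pow_mul]
  exact h2

/-- The ring `W⟨T⟩ / (T² = t, aT = Ta^σ)` for an integer `t`, with the element `a + bT` written
as the pair `(a, b)`. That this ring has the stated presentation is
`TwistedWitt.existsUnique_lift`. -/
@[ext]
structure TwistedWitt (t : ℤ) where
  /-- The coefficient `a` of `a + bT`. -/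
  re : W4
  /-- The coefficient `b` of `a + bT`. -/
  im : W4

namespace TwistedWitt

variable {t : ℤ}

instance : Zero (TwistedWitt t) := ⟨⟨0, 0⟩⟩

instance : One (TwistedWitt t) := ⟨⟨1, 0⟩⟩

instance : Add (TwistedWitt t) := ⟨fun x y => ⟨x.re + y.re, x.im + y.im⟩⟩

instance : Neg (TwistedWitt t) := ⟨fun x => ⟨-x.re, -x.im⟩⟩

/-- `(a + bT)(c + dT) = (ac + t b d^σ) + (ad + b c^σ) T`. -/
instance : Mul (TwistedWitt t) :=
  ⟨fun x y => ⟨x.re * y.re + (t : W4) * (x.im * frob y.im), x.re * y.im + x.im * frob y.re⟩⟩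

@[simp] theorem zero_re : (0 : TwistedWitt t).re = 0 := rfl

@[simp] theorem zero_im : (0 : TwistedWitt t).im = 0 := rfl

@[simp] theorem one_re : (1 : TwistedWitt t).re = 1 := rfl

@[simp] theorem one_im : (1 : TwistedWitt t).im = 0 := rfl

@[simp] theorem add_re (x y : TwistedWitt t) : (x + y).re = x.re + y.re := rfl

@[simp] theorem add_im (x y : TwistedWitt t) : (x + y).im = x.im + y.im := rfl

@[simp] theorem neg_re (x : TwistedWitt t) : (-x).re = -x.re := rfl

@[simp] theorem neg_im (x : TwistedWitt t) : (-x).im = -x.im := rfl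

@[simp] theorem mul_re (x y : TwistedWitt t) :
    (x * y).re = x.re * y.re + (t : W4) * (x.im * frob y.im) := rfl

@[simp] theorem mul_im (x y : TwistedWitt t) :
    (x * y).im = x.re * y.im + x.im * frob y.re := rfl

instance : Ring (TwistedWitt t) where
  add_assoc x y z := by ext1 <;> simp [add_assoc]
  zero_add x := by ext1 <;> simp
  add_zero x := by ext1 <;> simp
  add_comm x y := by ext1 <;> simp [add_comm]
  neg_add_cancel x := by ext1 <;> simp
  nsmul := nsmulRec
  zsmul := zsmulRec
  mul_assoc x y z := by
    ext1 <;> simp only [mul_re, mul_im, map_add, map_mul, map_intCast, frob_frob] <;> ring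
  one_mul x := by ext1 <;> simp
  mul_one x := by ext1 <;> simp
  left_distrib x y z := by ext1 <;> simp only [mul_re, mul_im, add_re, add_im, map_add] <;> ring
  right_distrib x y z := by ext1 <;> simp only [mul_re, mul_im, add_re, add_im] <;> ring
  zero_mul x := by ext1 <;> simp
  mul_zero x := by ext1 <;> simp

variable (t) in
/-- The inclusion of the Witt vectors. -/
def of : W4 →+* TwistedWitt t where
  toFun a := ⟨a, 0⟩
  map_zero' := rfl
  map_one' := rfl
  map_add' a b := by ext1 <;> simp
  map_mul' a b := by ext1 <;> simp

variable (t) in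
/-- The generator `T`. -/
def gen : TwistedWitt t := ⟨0, 1⟩

theorem eq_of_add_of_mul_gen (x : TwistedWitt t) : x = of t x.re + of t x.im * gen t := by
  ext1 <;> simp [of, gen]

theorem gen_mul_gen : gen t * gen t = (t : TwistedWitt t) := by
  rw [← map_intCast (of t)]
  have h : of t (t : W4) = ⟨(t : W4), 0⟩ := rfl
  rw [h]
  ext1 <;> simp [gen]

theorem of_mul_gen (a : W4) : of t a * gen t = gen t * of t (frob a) := by
  ext1 <;> simp [of, gen, frob_frob]

/-- The universal property of `W⟨T⟩ / (T² = t, aT = Ta^σ)`. -/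
theorem existsUnique_lift {A : Type*} [Ring A] (f : W4 →+* A) (s : A) (hs : s * s = (t : A))
    (hfs : ∀ a, f a * s = s * f (frob a)) :
    ∃! g : TwistedWitt t →+* A, g.comp (of t) = f ∧ g (gen t) = s := by
  have hsf (a : W4) : s * f a = f (frob a) * s := by rw [hfs, frob_frob]
  refine ⟨{ toFun := fun x => f x.re + f x.im * s
            map_zero' := by simp
            map_one' := by simp
            map_add' := fun x y => by simp only [add_re, add_im, map_add]; noncomm_ring
            map_mul' := fun x y => ?_ }, ⟨?_, ?_⟩, ?_⟩
  · simp only [mul_re, mul_im, map_add, map_mul, map_intCast]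
    have h1 : f x.im * s * (f y.im * s) = (t : A) * (f x.im * f (frob y.im)) := by
      calc f x.im * s * (f y.im * s) = f x.im * (s * f y.im) * s := by noncomm_ring
        _ = f x.im * f (frob y.im) * (s * s) := by rw [hsf]; noncomm_ring
        _ = _ := by rw [hs, Int.cast_comm]
    have h2 : f x.im * s * f y.re = f x.im * f (frob y.re) * s := by
      rw [mul_assoc, hsf, mul_assoc]
    rw [mul_add, add_mul, add_mul, add_mul, h1, h2]
    noncomm_ring
  · ext a; simp [of]
  · simp [gen]
  · rintro g ⟨hg1, hg2⟩
    ext x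
    conv_lhs => rw [eq_of_add_of_mul_gen x]
    rw [map_add, map_mul, hg2, ← RingHom.comp_apply, ← RingHom.comp_apply, hg1]
    rfl

end TwistedWitt

end

/-!
Let `A = ℤ⟨ω, τ⟩ / (ω² + ω + 1 = 0, τ² = t, ωτ = τω²)` with `t = 2` or `t = -2`, an order in a
quaternion algebra over `ℚ` in which `τ²` and `2` generate the same ideal. The twisted Witt ring is
the `2`-adic completion of `A`, with the Teichmüller lift of `ζ` for `ω`. The endomorphism ring of a
formal group law `F` over `𝔽₄` is complete for the filtration by the order of vanishing. If the
coefficients of `F` lie in `𝔽₂` and `F(ζx, ζy) = ζF(x, y)`, it contains `τ = x²` and `ω = ζx`, with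
`ωτ = τω²`; and if `τ² = t`, it is a completion of `A` too: the linear coefficients of the
endomorphisms in `ℤ[ω]` exhaust `𝔽₄`, and an endomorphism whose linear coefficient vanishes has
derivative `0`, hence is of the form `g(x²) = g ∘ τ`. Two completions of the same ring are
isomorphic.

For the Honda law, the logarithm `ℓ` satisfies `ℓ(x) = x + ℓ(x⁴)/2`. A congruence argument modulo
`2` shows that `ℓ⁻¹(ℓ(x) + ℓ(y))` is integral and that `[2](x) ≡ x⁴`, that is, `τ² = 2`.

For the curve, the chord construction gives the law `F(u, v) = i(u + v + λ²)`, where `λ` is the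
slope of the chord through the points with parameters `u`, `v` and `i` is the inversion.
Associativity holds since `X₀`, `X₁`, `X₂` are parameters of points of the curve over the field of
fractions of `𝔽₄⟦X₀, X₁, X₂⟧`. For `u = v` the slope is `u²`, so `[2](x) = i(x⁴)`, that is,
`τ² = -2`.

Finally, if `αα^σ = -1` then `(αS)² = αα^σ S² = -2`, so `a + bT ↦ a + bαS` is a ring isomorphism.
-/

/-! ### Completions of noncommutative rings -/

/-- `f : A → B` exhibits `B` as the completion of `A` at the powers of the integer `p`, for rings
that need not be commutative: `p`-power divisibility is reflected by `f`, the image of `f` is dense,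
and `B` is separated and complete. -/
structure IsCompletionAt (p : ℕ) {A B : Type*} [Ring A] [Ring B] (f : A →+* B) : Prop where
  pow_dvd_of_pow_dvd_map (n : ℕ) {a : A} : (p : B) ^ n ∣ f a → (p : A) ^ n ∣ a
  exists_pow_dvd_sub (n : ℕ) (b : B) : ∃ a, (p : B) ^ n ∣ b - f a
  eq_zero_of_forall_pow_dvd {b : B} : (∀ n, (p : B) ^ n ∣ b) → b = 0
  exists_limit (b : ℕ → B) : (∀ n, (p : B) ^ n ∣ b (n + 1) - b n) → ∃ l, ∀ n, (p : B) ^ n ∣ l - b n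

theorem natCast_pow_dvd_mul_left {R : Type*} [Semiring R] {p n : ℕ} {a : R} (h : (p : R) ^ n ∣ a)
    (c : R) : (p : R) ^ n ∣ c * a := by
  obtain ⟨d, rfl⟩ := h
  exact ⟨c * d, by rw [← mul_assoc, ← mul_assoc, ((Nat.cast_commute p c).pow_left n).eq]⟩

theorem natCast_pow_dvd_mul_sub_mul {R : Type*} [Ring R] {p n : ℕ} {a b x y : R}
    (hab : (p : R) ^ n ∣ a - b) (hxy : (p : R) ^ n ∣ x - y) : (p : R) ^ n ∣ a * x - b * y := by
  rw [show a * x - b * y = (a - b) * x + b * (x - y) by noncomm_ring]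
  exact dvd_add (hab.mul_right x) (natCast_pow_dvd_mul_left hxy b)

theorem map_natCast_pow_dvd {A B : Type*} [Semiring A] [Semiring B] (f : A →+* B) {p n : ℕ}
    {a : A} (h : (p : A) ^ n ∣ a) : (p : B) ^ n ∣ f a := by
  simpa using map_dvd f h

namespace IsCompletionAt

variable {p : ℕ} {A B C : Type*} [Ring A] [Ring B] [Ring C]

section Criterion

variable {f : A →+* B}

theorem pow_dvd_of_dvd_map (hreg : ∀ b : B, p * b = 0 → b = 0)
    (hdvd : ∀ a : A, (p : B) ∣ f a → (p : A) ∣ a) (n : ℕ) :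
    ∀ {a : A}, (p : B) ^ n ∣ f a → (p : A) ^ n ∣ a := by
  induction n with
  | zero => simp
  | succ n ih =>
    intro a ha
    obtain ⟨a, rfl⟩ := hdvd a ((dvd_pow_self _ n.succ_ne_zero).trans ha)
    obtain ⟨c, hc⟩ := ha
    have hac : f a = (p : B) ^ n * c :=
      sub_eq_zero.mp (hreg _ (by rw [mul_sub, ← mul_assoc, ← pow_succ', ← hc, map_mul,
        map_natCast, sub_self]))
    rw [pow_succ']
    exact mul_dvd_mul_left _ (ih ⟨c, hac⟩)

theorem exists_pow_dvd_sub_of_exists_dvd_sub (hdense : ∀ b : B, ∃ a, (p : B) ∣ b - f a) (n : ℕ)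
    (b : B) : ∃ a, (p : B) ^ n ∣ b - f a := by
  induction n with
  | zero => exact ⟨0, by simp⟩
  | succ n ih =>
    obtain ⟨a, c, hc⟩ := ih
    obtain ⟨a', d, hd⟩ := hdense c
    refine ⟨a + p ^ n * a', d, ?_⟩
    rw [map_add, map_mul, map_pow, map_natCast, ← sub_sub, hc, ← mul_sub, hd, pow_succ, mul_assoc]

end Criterion

/-- `b` and `c` are limits of the images of one sequence in `A`. -/
def Related (p : ℕ) (f : A →+* B) (g : A →+* C) (b : B) (c : C) : Prop :=
  ∀ n, ∃ a, (p : B) ^ n ∣ b - f a ∧ (p : C) ^ n ∣ c - g a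

namespace Related

variable {f : A →+* B} {g : A →+* C} {b b' : B} {c c' : C}

theorem symm (h : Related p f g b c) : Related p g f c b := fun n =>
  (h n).imp fun _ => And.symm

theorem map (a : A) : Related p f g (f a) (g a) := fun n => ⟨a, by simp⟩

theorem add (h : Related p f g b c) (h' : Related p f g b' c') :
    Related p f g (b + b') (c + c') := fun n => by
  obtain ⟨a, hb, hc⟩ := h n
  obtain ⟨a', hb', hc'⟩ := h' n
  refine ⟨a + a', ?_, ?_⟩
  · rw [map_add, add_sub_add_comm]
    exact dvd_add hb hb'
  · rw [map_add, add_sub_add_comm]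
    exact dvd_add hc hc'

theorem mul (h : Related p f g b c) (h' : Related p f g b' c') :
    Related p f g (b * b') (c * c') := fun n => by
  obtain ⟨a, hb, hc⟩ := h n
  obtain ⟨a', hb', hc'⟩ := h' n
  refine ⟨a * a', ?_, ?_⟩
  · rw [map_mul]
    exact natCast_pow_dvd_mul_sub_mul hb hb'
  · rw [map_mul]
    exact natCast_pow_dvd_mul_sub_mul hc hc'

theorem unique (hf : IsCompletionAt p f) (hg : IsCompletionAt p g) (h : Related p f g b c)
    (h' : Related p f g b c') : c = c' := by
  refine sub_eq_zero.mp (hg.eq_zero_of_forall_pow_dvd fun n => ?_)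
  obtain ⟨a, hb, hc⟩ := h n
  obtain ⟨a', hb', hc'⟩ := h' n
  have haa' : (p : A) ^ n ∣ a - a' := hf.pow_dvd_of_pow_dvd_map n <| by
    rw [map_sub, ← sub_sub_sub_cancel_left]
    exact dvd_sub hb' hb
  have := dvd_add (dvd_sub hc hc') (map_natCast_pow_dvd g haa')
  rwa [map_sub, sub_sub_sub_comm, sub_add_cancel] at this

theorem exists_right (hf : IsCompletionAt p f) (hg : IsCompletionAt p g) (b : B) :
    ∃ c, Related p f g b c := by
  choose a ha using fun n => hf.exists_pow_dvd_sub n b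
  obtain ⟨c, hc⟩ := hg.exists_limit (fun n => g (a n)) fun n => by
    rw [← map_sub]
    refine map_natCast_pow_dvd g (hf.pow_dvd_of_pow_dvd_map n ?_)
    rw [map_sub, ← sub_sub_sub_cancel_left]
    exact dvd_sub (ha n) ((pow_dvd_pow _ n.le_succ).trans (ha (n + 1)))
  exact ⟨c, fun n => ⟨a n, ha n, hc n⟩⟩

end Related

theorem exists_ringEquiv {f : A →+* B} {g : A →+* C} (hf : IsCompletionAt p f)
    (hg : IsCompletionAt p g) : ∃ e : B ≃+* C, ∀ a, e (f a) = g a := by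
  choose e he using Related.exists_right hf hg
  choose e' he' using Related.exists_right hg hf
  refine ⟨{ toFun := e
            invFun := e'
            left_inv := fun b => Related.unique hg hf (he' _) (he b).symm
            right_inv := fun c => Related.unique hf hg (he _) (he' c).symm
            map_add' := fun b b' => Related.unique hf hg (he _) ((he b).add (he b'))
            map_mul' := fun b b' => Related.unique hf hg (he _) ((he b).mul (he b')) }, ?_⟩
  exact fun a => Related.unique hf hg (he _) (.map a)

end IsCompletionAt

/-! ### The Witt vectors of the field with four elements -/

section AdicallyComplete

variable {R : Type*} [CommRing R]

theorem eq_zero_of_forall_pow_dvd (x : R) [IsHausdorff (Ideal.span {x}) R] {a : R}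
    (h : ∀ n, x ^ n ∣ a) : a = 0 := by
  refine IsHausdorff.haus' (I := Ideal.span {x}) a fun n => ?_
  rw [smul_eq_mul, Ideal.mul_top, SModEq.zero, Ideal.span_singleton_pow, Ideal.mem_span_singleton]
  exact h n

theorem exists_forall_pow_dvd_sub (x : R) [IsPrecomplete (Ideal.span {x}) R] (a : ℕ → R)
    (h : ∀ n, x ^ n ∣ a (n + 1) - a n) : ∃ l, ∀ n, x ^ n ∣ l - a n := by
  have smodEq_iff (n : ℕ) (b c : R) :
      b ≡ c [SMOD (Ideal.span {x} ^ n • ⊤ : Submodule R R)] ↔ x ^ n ∣ c - b := by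
    rw [smul_eq_mul, Ideal.mul_top, Ideal.span_singleton_pow, SModEq.sub_mem,
      Ideal.mem_span_singleton, dvd_sub_comm]
  obtain ⟨l, hl⟩ := IsPrecomplete.prec' (I := Ideal.span {x}) a fun {m n} hmn => by
    rw [smodEq_iff]
    induction n, hmn using Nat.le_induction with
    | base => simp
    | succ n hmn ih => simpa using dvd_add ((pow_dvd_pow x hmn).trans (h n)) ih
  exact ⟨l, fun n => (smodEq_iff n _ _).mp (hl n)⟩

-- With `r = 1 + 4s` the equation becomes `2s² + s + 1 = 0`; in terms of `q = 2s` it is the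
-- monic equation `q² + q + 2 = 0`, which has the simple root `0` modulo `2`.
theorem exists_sq_eq_neg_seven [IsAdicComplete (Ideal.span {(2 : R)}) R] :
    ∃ r : R, r ^ 2 = -7 ∧ 4 ∣ r - 1 := by
  obtain ⟨q, hq, hq0⟩ := HenselianRing.is_henselian (I := Ideal.span {(2 : R)})
    (Polynomial.X ^ 2 + Polynomial.X + 2) (by monicity!) 0
    (by simp) (by simp)
  rw [sub_zero, Ideal.mem_span_singleton] at hq0
  obtain ⟨s, rfl⟩ := hq0
  simp only [Polynomial.IsRoot, Polynomial.eval_add, Polynomial.eval_pow, Polynomial.eval_X,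
    Polynomial.eval_ofNat] at hq
  exact ⟨2 * (2 * s) + 1, by linear_combination 4 * hq, ⟨s, by ring⟩⟩

end AdicallyComplete

namespace F4

theorem pow_four (c : F4) : c ^ 4 = c := by
  have : Fintype F4 := Fintype.ofFinite _
  have hcard : Fintype.card F4 = 4 := by
    simpa using (Nat.card_eq_fintype_card (α := F4)).symm.trans (GaloisField.card 2 2 two_ne_zero)
  simpa only [hcard] using FiniteField.pow_card c

variable {ζ : F4} (hζ : IsPrimitiveRoot ζ 3)

include hζ

theorem sq_eq_neg_one_sub : ζ ^ 2 = -1 - ζ := by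
  have h : ∑ i ∈ Finset.range 3, ζ ^ i = 0 := hζ.geom_sum_eq_zero (by norm_num)
  simp only [Finset.sum_range_succ, Finset.sum_range_zero] at h
  linear_combination h

theorem eq_cases (c : F4) : c = 0 ∨ c = 1 ∨ c = ζ ∨ c = ζ ^ 2 := by
  by_cases h : c = 0
  · exact Or.inl h
  have h3 : c ^ 3 = 1 := mul_left_cancel₀ h (by rw [← pow_succ', pow_four, mul_one])
  obtain ⟨i, hi, rfl⟩ := hζ.eq_pow_of_pow_eq_one h3
  interval_cases i <;> simp

theorem exists_intCast_add_mul_eq (c : F4) : ∃ i j : ℤ, (i : F4) + j * ζ = c := by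
  rcases eq_cases hζ c with rfl | rfl | rfl | rfl
  · exact ⟨0, 0, by simp⟩
  · exact ⟨1, 0, by simp⟩
  · exact ⟨0, 1, by simp⟩
  · exact ⟨-1, -1, by rw [sq_eq_neg_one_sub hζ]; push_cast; ring⟩

theorem two_dvd_of_intCast_add_mul_eq_zero {i j : ℤ} (h : (i : F4) + j * ζ = 0) :
    2 ∣ i ∧ 2 ∣ j := by
  have cast_eq_zero {n : ℤ} : (n : F4) = 0 ↔ 2 ∣ n := CharP.intCast_eq_zero_iff F4 2 n
  have cast_eq_one {n : ℤ} (hn : ¬ 2 ∣ n) : (n : F4) = 1 := by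
    rw [← Int.cast_one, ← sub_eq_zero, ← Int.cast_sub, cast_eq_zero]
    omega
  by_cases hj : 2 ∣ j
  · rw [cast_eq_zero.mpr hj, zero_mul, add_zero, cast_eq_zero] at h
    exact ⟨h, hj⟩
  · rw [cast_eq_one hj, one_mul] at h
    by_cases hi : 2 ∣ i
    · rw [cast_eq_zero.mpr hi, zero_add] at h
      exact absurd h (hζ.ne_zero (by norm_num))
    · rw [cast_eq_one hi] at h
      exact absurd (CharTwo.add_eq_zero.mp h).symm (hζ.ne_one (by norm_num))

end F4

namespace W4

instance : IsAdicComplete (Ideal.span {(2 : W4)}) W4 :=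
  WittVector.isAdicCompleteIdealSpanP (p := 2) (k := F4)

instance : CharZero W4 := by
  obtain h | ⟨q, _, _⟩ := CharP.exists' W4
  · exact h
  · have hq : (q : F4) = 0 := by
      rw [← map_natCast (WittVector.constantCoeff (p := 2)), CharP.cast_eq_zero, map_zero]
    obtain rfl : 2 = q :=
      (Nat.prime_dvd_prime_iff_eq Nat.prime_two Fact.out).mp ((CharP.cast_eq_zero_iff F4 2 q).mp hq)
    exact absurd (WittVector.eq_zero_of_p_mul_eq_zero (1 : W4)
      (by rw [one_mul, CharP.cast_eq_zero])) one_ne_zero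

theorem two_dvd_iff (a : W4) : 2 ∣ a ↔ WittVector.constantCoeff a = 0 := by
  rw [← Ideal.mem_span_singleton]
  exact WittVector.mem_span_p_iff_coeff_zero_eq_zero (p := 2) a

theorem not_two_dvd_one : ¬ (2 : W4) ∣ 1 := by
  rw [two_dvd_iff, map_one]
  exact one_ne_zero

theorem constantCoeff_teichmuller (c : F4) :
    WittVector.constantCoeff (WittVector.teichmuller 2 c) = c :=
  WittVector.teichmuller_coeff_zero 2 c

theorem frob_teichmuller (c : F4) :
    frob (WittVector.teichmuller 2 c) = WittVector.teichmuller 2 (c ^ 2) := by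
  ext n
  rw [frob, WittVector.coeff_frobenius_charP]
  cases n <;> simp [-map_pow]

section CubeRoot

variable {ζ : F4} (hζ : IsPrimitiveRoot ζ 3)

include hζ

theorem teichmuller_sq : WittVector.teichmuller 2 ζ ^ 2 = -1 - WittVector.teichmuller 2 ζ := by
  set w := WittVector.teichmuller 2 ζ with hw
  have hw_cube : w ^ 3 = 1 := by rw [hw, ← map_pow, hζ.pow_eq_one, map_one]
  have hw_one : w - 1 ≠ 0 := fun h => hζ.ne_one (by norm_num) <| by
    rw [← constantCoeff_teichmuller ζ, ← hw, sub_eq_zero.mp h, map_one]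
  refine mul_left_cancel₀ hw_one ?_
  linear_combination hw_cube

theorem frob_teichmuller_eq :
    frob (WittVector.teichmuller 2 ζ) = -1 - WittVector.teichmuller 2 ζ := by
  rw [frob_teichmuller, map_pow, teichmuller_sq hζ]

theorem two_dvd_of_two_dvd_intCast_add_mul {i j : ℤ}
    (h : 2 ∣ (i + j * WittVector.teichmuller 2 ζ : W4)) : 2 ∣ i ∧ 2 ∣ j := by
  rw [two_dvd_iff, map_add, map_mul, map_intCast, map_intCast, constantCoeff_teichmuller] at h
  exact F4.two_dvd_of_intCast_add_mul_eq_zero hζ h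

theorem exists_two_dvd_sub (a : W4) :
    ∃ i j : ℤ, 2 ∣ a - (i + j * WittVector.teichmuller 2 ζ) := by
  obtain ⟨i, j, h⟩ := F4.exists_intCast_add_mul_eq hζ (WittVector.constantCoeff a)
  refine ⟨i, j, ?_⟩
  rw [two_dvd_iff, map_sub, map_add, map_mul, map_intCast, map_intCast, constantCoeff_teichmuller,
    h, sub_self]

end CubeRoot

-- `σ r = ± r`, and the sign is `+` because `r` and `σ r` are both `1` modulo `4`.
theorem frob_eq_of_sq_eq_neg_seven {r : W4} (hr : r ^ 2 = -7) (h4 : 4 ∣ r - 1) : frob r = r := by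
  have hfr : frob r ^ 2 = r ^ 2 := by rw [← map_pow, hr, map_neg, map_ofNat]
  refine (sq_eq_sq_iff_eq_or_eq_neg.mp hfr).resolve_right fun h => not_two_dvd_one ?_
  obtain ⟨s, hs⟩ := h4
  have hfs : frob r - 1 = 4 * frob s := by rw [← map_one frob, ← map_sub, hs, map_mul, map_ofNat]
  refine ⟨-(s + frob s), mul_left_cancel₀ (two_ne_zero' W4) ?_⟩
  linear_combination h - hs - hfs

theorem isUnit_of_four_dvd_sub_one {r : W4} (h : 4 ∣ r - 1) : IsUnit r :=
  WittVector.isUnit_of_coeff_zero_ne_zero r fun h0 => not_two_dvd_one <| by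
    have h2 : (2 : W4) ∣ r - 1 := Dvd.dvd.trans ⟨2, by norm_num⟩ h
    exact (dvd_sub_right ((two_dvd_iff r).mpr h0)).mp h2

-- `(1 - 2ω)(1 - 2ω²) = 1 + 2 + 4 = 7`.
theorem mul_frob_eq_neg_one {ζ : F4} (hζ : IsPrimitiveRoot ζ 3) {r α : W4} (hr : r ^ 2 = -7)
    (h4 : 4 ∣ r - 1) (hα : α * r = 1 - 2 * WittVector.teichmuller 2 ζ) : α * frob α = -1 := by
  have hfα : frob α * r = 1 - 2 * (-1 - WittVector.teichmuller 2 ζ) := by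
    have := congrArg frob hα
    rwa [map_mul, frob_eq_of_sq_eq_neg_seven hr h4, map_sub, map_one, map_mul, map_ofNat,
      frob_teichmuller_eq hζ] at this
  refine mul_left_cancel₀ (by norm_num : (7 : W4) ≠ 0) ?_
  linear_combination α * frob α * hr - frob α * r * hα
    - (1 - 2 * WittVector.teichmuller 2 ζ) * hfα + 4 * teichmuller_sq hζ

theorem exists_sqrt_neg_seven_and_norm_neg_one {ζ : F4} (hζ : IsPrimitiveRoot ζ 3) :
    ∃ r α : W4, r ^ 2 = -7 ∧ 4 ∣ r - 1 ∧ α * r = 1 - 2 * WittVector.teichmuller 2 ζ ∧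
      α * frob α = -1 := by
  obtain ⟨r, hr, h4⟩ := exists_sq_eq_neg_seven (R := W4)
  obtain ⟨v, hv⟩ := (isUnit_of_four_dvd_sub_one h4).exists_left_inv
  have hα : (1 - 2 * WittVector.teichmuller 2 ζ) * v * r = 1 - 2 * WittVector.teichmuller 2 ζ := by
    rw [mul_assoc, hv, mul_one]
  exact ⟨r, _, hr, h4, hα, mul_frob_eq_neg_one hζ hr h4 hα⟩

end W4

/-! ### The twisted Witt ring as a completion -/

/-- The order `ℤ⟨w, τ⟩ / (w² + w + 1 = 0, τ² = t, τw = w²τ)`, a common dense subring of the twisted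
Witt ring and of the endomorphism rings of the two formal group laws. As a quaternion algebra it has
`i = w` and `j = τ`. -/
abbrev EisensteinOrder (t : ℤ) : Type := QuaternionAlgebra ℤ (-1) (-1) t

namespace EisensteinOrder

theorem two_dvd {t : ℤ} {x : EisensteinOrder t} (hre : 2 ∣ x.re) (hi : 2 ∣ x.imI) (hj : 2 ∣ x.imJ)
    (hk : 2 ∣ x.imK) : 2 ∣ x := by
  obtain ⟨a, ha⟩ := hre
  obtain ⟨b, hb⟩ := hi
  obtain ⟨c, hc⟩ := hj
  obtain ⟨d, hd⟩ := hk
  refine ⟨⟨a, b, c, d⟩, ?_⟩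
  rw [two_mul]
  ext <;> simp [*] <;> ring

section Lift

variable {t : ℤ} {D : Type*} [Ring D] {w τ : D}

/-- The homomorphism with the given values `w` and `τ` on the generators. -/
def lift (hw : w * w = -1 - w) (hτ : τ * τ = t) (hτw : τ * w = (-1 - w) * τ) :
    EisensteinOrder t →+* D :=
  (QuaternionAlgebra.Basis.liftHom (c₁ := (-1 : ℤ)) (c₂ := -1) (c₃ := t)
    { i := w
      j := τ
      k := w * τ
      i_mul_i := by rw [hw, neg_one_smul, neg_one_smul, sub_eq_add_neg]
      j_mul_j := by rw [hτ, zsmul_one]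
      i_mul_j := rfl
      j_mul_i := by rw [hτw, sub_mul, neg_one_mul, neg_one_smul] }).toRingHom

variable {hw : w * w = -1 - w} {hτ : τ * τ = t} {hτw : τ * w = (-1 - w) * τ}

theorem lift_apply (x : EisensteinOrder t) :
    lift hw hτ hτw x = x.re + x.imI * w + (x.imJ + x.imK * w) * τ := by
  change algebraMap ℤ D x.re + x.imI • w + x.imJ • τ + x.imK • (w * τ) = _
  simp only [eq_intCast, zsmul_eq_mul, add_mul, mul_assoc, add_assoc]

end Lift

end EisensteinOrder

namespace TwistedWitt

variable {t : ℤ}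

theorem sub_re (x y : TwistedWitt t) : (x - y).re = x.re - y.re := by
  rw [sub_eq_add_neg, add_re, neg_re, sub_eq_add_neg]

theorem sub_im (x y : TwistedWitt t) : (x - y).im = x.im - y.im := by
  rw [sub_eq_add_neg, add_im, neg_im, sub_eq_add_neg]

theorem of_dvd_iff {a : W4} {x : TwistedWitt t} : of t a ∣ x ↔ a ∣ x.re ∧ a ∣ x.im := by
  constructor
  · rintro ⟨y, rfl⟩
    simp [of]
  · rintro ⟨⟨b, hb⟩, ⟨c, hc⟩⟩
    exact ⟨⟨b, c⟩, by ext1 <;> simp [of, hb, hc]⟩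

theorem natCast_pow_dvd_iff {p n : ℕ} {x : TwistedWitt t} :
    (p : TwistedWitt t) ^ n ∣ x ↔ (p : W4) ^ n ∣ x.re ∧ (p : W4) ^ n ∣ x.im := by
  rw [← of_dvd_iff, map_pow, map_natCast]

section Completion

variable (t) {ζ : F4} (hζ : IsPrimitiveRoot ζ 3)

/-- The inclusion of the order generated by the Teichmüller lift of `ζ` and the generator. -/
noncomputable def ofOrder : EisensteinOrder t →+* TwistedWitt t :=
  EisensteinOrder.lift (w := of t (WittVector.teichmuller 2 ζ)) (τ := gen t)
    (by rw [← map_mul, ← pow_two, W4.teichmuller_sq hζ, map_sub, map_neg, map_one])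
    gen_mul_gen
    (by
      rw [← map_one (of t), ← map_neg, ← map_sub, ← W4.frob_teichmuller_eq hζ, of_mul_gen,
        frob_frob])

variable {t}

theorem ofOrder_apply (x : EisensteinOrder t) :
    ofOrder t hζ x = ⟨x.re + x.imI * WittVector.teichmuller 2 ζ,
      x.imJ + x.imK * WittVector.teichmuller 2 ζ⟩ := by
  rw [ofOrder, EisensteinOrder.lift_apply]
  simp only [← map_intCast (of t), ← map_mul, ← map_add]
  exact (eq_of_add_of_mul_gen ⟨_, _⟩).symm

theorem two_dvd_of_two_dvd_ofOrder {x : EisensteinOrder t}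
    (h : ((2 : ℕ) : TwistedWitt t) ∣ ofOrder t hζ x) : 2 ∣ x := by
  rw [← pow_one ((2 : ℕ) : TwistedWitt t), natCast_pow_dvd_iff, pow_one, ofOrder_apply] at h
  obtain ⟨hre, hi⟩ := W4.two_dvd_of_two_dvd_intCast_add_mul hζ h.1
  obtain ⟨hj, hk⟩ := W4.two_dvd_of_two_dvd_intCast_add_mul hζ h.2
  exact EisensteinOrder.two_dvd hre hi hj hk

theorem exists_two_dvd_sub_ofOrder (y : TwistedWitt t) :
    ∃ x, ((2 : ℕ) : TwistedWitt t) ∣ y - ofOrder t hζ x := by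
  obtain ⟨a, b, hre⟩ := W4.exists_two_dvd_sub hζ y.re
  obtain ⟨c, d, him⟩ := W4.exists_two_dvd_sub hζ y.im
  refine ⟨⟨a, b, c, d⟩, ?_⟩
  rw [← pow_one ((2 : ℕ) : TwistedWitt t), natCast_pow_dvd_iff, pow_one, sub_re,
    sub_im, ofOrder_apply]
  exact ⟨hre, him⟩

theorem eq_zero_of_two_mul_eq_zero {x : TwistedWitt t} (h : ((2 : ℕ) : TwistedWitt t) * x = 0) :
    x = 0 := by
  rw [Nat.cast_ofNat, two_mul] at h
  ext1
  · exact add_self_eq_zero.mp (congrArg re h)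
  · exact add_self_eq_zero.mp (congrArg im h)

theorem isCompletionAt_ofOrder : IsCompletionAt 2 (ofOrder t hζ) where
  pow_dvd_of_pow_dvd_map := IsCompletionAt.pow_dvd_of_dvd_map
    (fun _ => eq_zero_of_two_mul_eq_zero) (fun _ => two_dvd_of_two_dvd_ofOrder hζ)
  exists_pow_dvd_sub := IsCompletionAt.exists_pow_dvd_sub_of_exists_dvd_sub
    (exists_two_dvd_sub_ofOrder hζ)
  eq_zero_of_forall_pow_dvd h := by
    simp only [natCast_pow_dvd_iff] at h
    ext1
    · exact _root_.eq_zero_of_forall_pow_dvd (2 : W4) fun n => (h n).1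
    · exact _root_.eq_zero_of_forall_pow_dvd (2 : W4) fun n => (h n).2
  exists_limit b h := by
    simp only [natCast_pow_dvd_iff, sub_re, sub_im] at h ⊢
    obtain ⟨l, hl⟩ := exists_forall_pow_dvd_sub (2 : W4) (fun n => (b n).re) fun n => (h n).1
    obtain ⟨m, hm⟩ := exists_forall_pow_dvd_sub (2 : W4) (fun n => (b n).im) fun n => (h n).2
    exact ⟨⟨l, m⟩, fun n => ⟨hl n, hm n⟩⟩

end Completion

/-- The isomorphism `a + bT ↦ a + b(αS)` for an element `α` of norm `-1`. -/
noncomputable def scaleGen (α : W4) (hα : α * frob α = -1) :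
    TwistedWitt (-t) ≃+* TwistedWitt t where
  toFun x := ⟨x.re, x.im * α⟩
  invFun x := ⟨x.re, x.im * -frob α⟩
  left_inv x := by
    ext1
    · rfl
    · linear_combination -x.im * hα
  right_inv x := by
    ext1
    · rfl
    · linear_combination -x.im * hα
  map_add' x y := by ext1 <;> simp [add_mul]
  map_mul' x y := by
    ext1
    · simp only [mul_re, map_mul]
      push_cast
      linear_combination -(t : W4) * x.im * frob y.im * hα
    · simp only [mul_im]
      ring

theorem scaleGen_apply (α : W4) (hα : α * frob α = -1) (a b : W4) :
    scaleGen (t := t) α hα (of (-t) a + of (-t) b * gen (-t)) =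
      of t a + of t b * (of t α * gen t) := by
  ext1 <;> simp [scaleGen, of, gen]

end TwistedWitt

/-! ### Power series -/

/-- The ideal of power series without terms of total degree less than `n`; congruences modulo these
ideals are the congruences of power series up to a given degree. -/
def degIdeal (σ R : Type*) [CommRing R] (n : ℕ) : Ideal (MvPowerSeries σ R) where
  carrier := {f | (n : ℕ∞) ≤ f.order}
  zero_mem' := by simp
  add_mem' hf hg := le_trans (le_min hf hg) MvPowerSeries.min_order_le_add
  smul_mem' _ _ hf := (le_add_of_nonneg_of_le zero_le hf).trans MvPowerSeries.le_order_mul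

namespace degIdeal

variable {σ τ R : Type*} [CommRing R] {m n : ℕ} {f g : MvPowerSeries σ R}

theorem mem_iff : f ∈ degIdeal σ R n ↔ ∀ d, d.degree < n → MvPowerSeries.coeff d f = 0 :=
  ⟨fun h _ hd => MvPowerSeries.coeff_of_lt_order (lt_of_lt_of_le (mod_cast hd) h),
    fun h => MvPowerSeries.le_order fun d hd => h d (mod_cast hd)⟩

theorem mem_one_iff : f ∈ degIdeal σ R 1 ↔ MvPowerSeries.constantCoeff f = 0 := by
  rw [← MvPowerSeries.one_le_order_iff_constCoeff_eq_zero]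
  simp [degIdeal]

theorem X_pow_dvd_iff {f : PowerSeries R} : PowerSeries.X ^ n ∣ f ↔ f ∈ degIdeal Unit R n := by
  rw [PowerSeries.X_pow_dvd_iff, mem_iff]
  refine ⟨fun h d hd => ?_, fun h m hm => h (Finsupp.single () m) (by simpa using hm)⟩
  rw [show d = Finsupp.single () d.degree by ext; simp [Finsupp.degree_eq_sum]]
  exact h _ hd

theorem antitone (h : m ≤ n) : degIdeal σ R n ≤ degIdeal σ R m :=
  fun _ hf => le_trans (Nat.cast_le.mpr h : (m : ℕ∞) ≤ n) hf

theorem mul_mem (hf : f ∈ degIdeal σ R m) (hg : g ∈ degIdeal σ R n) :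
    f * g ∈ degIdeal σ R (m + n) := by
  refine le_trans ?_ MvPowerSeries.le_order_mul
  push_cast
  exact add_le_add hf hg

theorem coeff_single_mul_eq_zero (hf : MvPowerSeries.constantCoeff f = 0)
    (hg : MvPowerSeries.constantCoeff g = 0) (i : σ) :
    MvPowerSeries.coeff (Finsupp.single i 1) (f * g) = 0 :=
  mem_iff.mp (mul_mem (mem_one_iff.mpr hf) (mem_one_iff.mpr hg)) _ (by simp)

theorem eq_of_forall_sub_mem (h : ∀ n, f - g ∈ degIdeal σ R n) : f = g := by
  ext d
  simpa [sub_eq_zero] using mem_iff.mp (h (d.degree + 1)) d (by omega)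

theorem subst_sub_subst_mem {a b : σ → MvPowerSeries τ R} (ha : MvPowerSeries.HasSubst a)
    (hb : MvPowerSeries.HasSubst b) (h : ∀ s, a s - b s ∈ degIdeal τ R n)
    (f : MvPowerSeries σ R) : f.subst a - f.subst b ∈ degIdeal τ R n := by
  rw [mem_iff]
  intro d hd
  rw [map_sub, sub_eq_zero, MvPowerSeries.coeff_subst ha, MvPowerSeries.coeff_subst hb]
  refine finsum_congr fun e => ?_
  have hmonomial : (e.prod fun s k => a s ^ k) - (e.prod fun s k => b s ^ k) ∈ degIdeal τ R n := by
    simp only [← Ideal.Quotient.eq, Finsupp.prod, map_prod, map_pow, Ideal.Quotient.eq.mpr (h _)]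
  rw [sub_eq_zero.mp ((map_sub _ _ _).symm.trans (mem_iff.mp hmonomial d hd))]

theorem subst_mem {a : σ → MvPowerSeries τ R} (ha : MvPowerSeries.HasSubst a)
    (h : ∀ s, a s ∈ degIdeal τ R m) (hf : f ∈ degIdeal σ R n) :
    f.subst a ∈ degIdeal τ R (m * n) := by
  refine le_trans ?_ (MvPowerSeries.le_order_subst ha f)
  push_cast
  exact mul_le_mul' (le_iInf h) hf

end degIdeal

section DivisibilityOfSubst

variable {σ τ R : Type*} [CommRing R]

theorem vecCons_X_X : (![MvPowerSeries.X 0, MvPowerSeries.X 1] : Fin 2 → MvPowerSeries (Fin 2) R) =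
    MvPowerSeries.X :=
  funext (Fin.forall_fin_two.mpr ⟨rfl, rfl⟩)

theorem mvPowerSeries_expand_injective {p : ℕ} (hp : p ≠ 0) :
    Function.Injective (MvPowerSeries.expand p hp : MvPowerSeries σ R → MvPowerSeries σ R) :=
  fun f g h => MvPowerSeries.ext fun d => by
    rw [← MvPowerSeries.coeff_expand_smul p hp, h, MvPowerSeries.coeff_expand_smul]

theorem expand_eq_pow_of_map_frobenius_eq {p : ℕ} [ExpChar R p] (hp : p ≠ 0)
    {f : MvPowerSeries σ R} (hf : f.map (frobenius R p) = f) : f.expand p hp = f ^ p := by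
  rw [← MvPowerSeries.map_frobenius_expand p hp, MvPowerSeries.map_expand, hf]

theorem X_one_dvd_sub_subst_zero (f : MvPowerSeries (Fin 2) R) :
    MvPowerSeries.X 1 ∣ f - f.subst ![MvPowerSeries.X 0, (0 : MvPowerSeries (Fin 2) R)] := by
  classical
  let g : PowerSeries R := PowerSeries.mk fun n => MvPowerSeries.coeff (Finsupp.single 0 n) f
  have hg : MvPowerSeries.X 1 ∣ f - g.subst (MvPowerSeries.X 0 : MvPowerSeries (Fin 2) R) := by
    refine MvPowerSeries.X_dvd_iff.mpr fun d hd => ?_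
    have hd0 : d = Finsupp.single 0 (d 0) :=
      Finsupp.ext (Fin.forall_fin_two.mpr ⟨by simp, by simp [hd]⟩)
    rw [map_sub, PowerSeries.coeff_subst_single, if_pos hd0, PowerSeries.coeff_mk, ← hd0, sub_self]
  have hX0 : MvPowerSeries.HasSubst ![MvPowerSeries.X 0, (0 : MvPowerSeries (Fin 2) R)] :=
    FormalGroup.hasSubst_pair (PowerSeries.HasSubst.X 0) PowerSeries.HasSubst.zero
  obtain ⟨h, hh⟩ := hg
  have hsubst : f.subst ![MvPowerSeries.X 0, (0 : MvPowerSeries (Fin 2) R)] =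
      g.subst (MvPowerSeries.X 0 : MvPowerSeries (Fin 2) R) := by
    rw [sub_eq_iff_eq_add.mp hh, MvPowerSeries.subst_add hX0, MvPowerSeries.subst_mul hX0,
      MvPowerSeries.subst_X hX0, PowerSeries.subst,
      MvPowerSeries.subst_comp_subst_apply (PowerSeries.HasSubst.X 0).const hX0]
    simp [MvPowerSeries.subst_X hX0]
  exact hsubst ▸ ⟨h, hh⟩

instance {p : ℕ} [CharP R p] : CharP (MvPowerSeries σ R) p :=
  charP_of_injective_ringHom (f := MvPowerSeries.C) MvPowerSeries.C_injective p

end DivisibilityOfSubst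

section Subst

variable {τ R : Type*} [CommRing R]

theorem hasSubst_pair_of_constantCoeff_eq_zero {u v : MvPowerSeries τ R}
    (hu : MvPowerSeries.constantCoeff u = 0) (hv : MvPowerSeries.constantCoeff v = 0) :
    MvPowerSeries.HasSubst ![u, v] :=
  FormalGroup.hasSubst_pair (PowerSeries.HasSubst.of_constantCoeff_zero hu)
    (PowerSeries.HasSubst.of_constantCoeff_zero hv)

theorem subst_subst_X {ι : Type*} {u : ι → MvPowerSeries τ R} (hu : MvPowerSeries.HasSubst u)
    (f : PowerSeries R) (i : ι) :
    (f.subst (MvPowerSeries.X i : MvPowerSeries ι R)).subst u = f.subst (u i) := by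
  rw [PowerSeries.subst, MvPowerSeries.subst_comp_subst_apply (PowerSeries.HasSubst.X i).const hu]
  simp only [MvPowerSeries.subst_X hu]
  rfl

theorem C_mul_X_subst {u : MvPowerSeries τ R} (hu : PowerSeries.HasSubst u) (c : R) :
    (PowerSeries.C c * PowerSeries.X).subst u = MvPowerSeries.C c * u := by
  rw [PowerSeries.subst_mul hu, PowerSeries.subst_X hu, PowerSeries.subst_C c]

theorem expand_subst_eq {p : ℕ} (hp : p ≠ 0) {u : MvPowerSeries τ R} (hu : PowerSeries.HasSubst u)
    (f : PowerSeries R) : (f.expand p hp).subst u = f.subst (u ^ p) := by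
  rw [PowerSeries.expand_apply, PowerSeries.subst_comp_subst_apply (PowerSeries.HasSubst.X_pow hp)
    hu, PowerSeries.subst_pow hu, PowerSeries.subst_X hu]

theorem subst_injOn_of_isUnit_coeff_one {f : PowerSeries R} (hf : IsUnit (PowerSeries.coeff 1 f))
    (hf0 : PowerSeries.constantCoeff f = 0) :
    Set.InjOn (fun u : MvPowerSeries τ R => f.subst u)
      {u | MvPowerSeries.constantCoeff u = 0} := by
  intro u hu v hv (h : f.subst u = f.subst v)
  have key {u : MvPowerSeries τ R} (hu : MvPowerSeries.constantCoeff u = 0) :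
      (f.substInvOfIsUnit hf).subst (f.subst u) = u := by
    have hu' := PowerSeries.HasSubst.of_constantCoeff_zero hu
    rw [← PowerSeries.subst_comp_subst_apply (PowerSeries.HasSubst.of_constantCoeff_zero' hf0) hu',
      f.subst_substInvOfIsUnit_left hf0 hf, PowerSeries.subst_X hu']
  rw [← key hu, h, key hv]

/-- The divided difference `(f(y) - f(x)) / (y - x)`: since
`(yᵐ - xᵐ) / (y - x) = ∑_{i + j + 1 = m} xⁱ yʲ`, its coefficient at `xⁱ yʲ` is the coefficient of
`f` in degree `i + j + 1`. -/
noncomputable def dividedDifference (f : PowerSeries R) : MvPowerSeries (Fin 2) R :=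
  fun d => PowerSeries.coeff (d 0 + d 1 + 1) f

theorem coeff_dividedDifference (f : PowerSeries R) (d : Fin 2 →₀ ℕ) :
    MvPowerSeries.coeff d (dividedDifference f) = PowerSeries.coeff (d 0 + d 1 + 1) f := rfl

theorem dividedDifference_mul (f : PowerSeries R) :
    dividedDifference f * (MvPowerSeries.X 1 - MvPowerSeries.X 0) =
      f.subst (MvPowerSeries.X 1 : MvPowerSeries (Fin 2) R)
        - f.subst (MvPowerSeries.X 0 : MvPowerSeries (Fin 2) R) := by
  ext d
  have single_le (s : Fin 2) : Finsupp.single s 1 ≤ d ↔ d s ≠ 0 := by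
    rw [Finsupp.single_le_iff, Nat.one_le_iff_ne_zero]
  have eq_single_zero : d = Finsupp.single 0 (d 0) ↔ d 1 = 0 := by
    simp [Finsupp.ext_iff, Fin.forall_fin_two]
  have eq_single_one : d = Finsupp.single 1 (d 1) ↔ d 0 = 0 := by
    simp [Finsupp.ext_iff, Fin.forall_fin_two]
  rw [mul_sub, map_sub, map_sub, PowerSeries.coeff_subst_single, PowerSeries.coeff_subst_single]
  simp only [MvPowerSeries.X, MvPowerSeries.coeff_mul_monomial, coeff_dividedDifference, single_le,
    eq_single_zero, eq_single_one, Finsupp.tsub_apply, Finsupp.single_apply, mul_one]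
  by_cases h0 : d 0 = 0 <;> by_cases h1 : d 1 = 0
  · simp [h0, h1]
  · simp [h0, h1, Nat.sub_add_cancel (Nat.one_le_iff_ne_zero.mpr h1)]
  · simp [h0, h1, Nat.sub_add_cancel (Nat.one_le_iff_ne_zero.mpr h0)]
  · simp [h0, h1, show d 0 + (d 1 - 1) + 1 = d 0 + d 1 by omega,
      show d 0 - 1 + d 1 + 1 = d 0 + d 1 by omega]

theorem dividedDifference_subst_mul (f : PowerSeries R) {u v : MvPowerSeries τ R}
    (hu : PowerSeries.HasSubst u) (hv : PowerSeries.HasSubst v) :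
    (dividedDifference f).subst ![u, v] * (v - u) = f.subst v - f.subst u := by
  have huv := FormalGroup.hasSubst_pair hu hv
  have := congrArg (MvPowerSeries.subst ![u, v]) (dividedDifference_mul f)
  simpa [MvPowerSeries.subst_mul huv, MvPowerSeries.subst_sub huv, MvPowerSeries.subst_X huv,
    subst_subst_X huv] using this

theorem constantCoeff_dividedDifference_subst (f : PowerSeries R) {u v : MvPowerSeries τ R}
    (hu : MvPowerSeries.constantCoeff u = 0) (hv : MvPowerSeries.constantCoeff v = 0) :
    MvPowerSeries.constantCoeff ((dividedDifference f).subst ![u, v]) =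
      PowerSeries.coeff 1 f := by
  have huv := hasSubst_pair_of_constantCoeff_eq_zero hu hv
  have hconst : MvPowerSeries.constantCoeff
      (dividedDifference f - MvPowerSeries.C (PowerSeries.coeff 1 f)) = 0 := by
    rw [map_sub, MvPowerSeries.constantCoeff_C, ← MvPowerSeries.coeff_zero_eq_constantCoeff_apply,
      coeff_dividedDifference]
    simp
  have := MvPowerSeries.constantCoeff_subst_eq_zero huv (Fin.forall_fin_two.mpr ⟨hu, hv⟩) hconst
  rwa [MvPowerSeries.subst_sub huv, map_sub, sub_eq_zero, MvPowerSeries.subst_C,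
    MvPowerSeries.constantCoeff_C] at this

theorem sq_dvd_subst_add_sub (f : PowerSeries R) {u v : MvPowerSeries τ R}
    (hu : PowerSeries.HasSubst u) (hv : PowerSeries.HasSubst v) :
    v ^ 2 ∣ f.subst (u + v) - f.subst u - (PowerSeries.derivative R f).subst u * v := by
  classical
  have huv := FormalGroup.hasSubst_pair hu hv
  have hadd : PowerSeries.HasSubst (MvPowerSeries.X 0 + MvPowerSeries.X 1 :
      MvPowerSeries (Fin 2) R) := (PowerSeries.HasSubst.X 0).add (PowerSeries.HasSubst.X 1)
  have hX : MvPowerSeries.X 1 ^ 2 ∣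
      f.subst (MvPowerSeries.X 0 + MvPowerSeries.X 1 : MvPowerSeries (Fin 2) R)
        - f.subst (MvPowerSeries.X 0 : MvPowerSeries (Fin 2) R)
        - (PowerSeries.derivative R f).subst (MvPowerSeries.X 0 : MvPowerSeries (Fin 2) R)
          * MvPowerSeries.X 1 := by
    refine MvPowerSeries.X_pow_dvd_iff.mpr fun d hd => ?_
    have single_le : Finsupp.single 1 1 ≤ d ↔ 1 ≤ d 1 := Finsupp.single_le_iff
    rw [map_sub, map_sub, PowerSeries.coeff_subst_X_zero_add_X_one, PowerSeries.coeff_subst_single,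
      MvPowerSeries.X_def (1 : Fin 2), MvPowerSeries.coeff_mul_monomial,
      PowerSeries.coeff_subst_single]
    simp only [PowerSeries.coeff_derivative, single_le, Finsupp.ext_iff, Fin.forall_fin_two,
      Finsupp.tsub_apply, Finsupp.single_apply]
    interval_cases d 1 <;> simp [mul_comm]
  have hsum : f.subst (u + v) = (f.subst (MvPowerSeries.X 0 + MvPowerSeries.X 1 :
      MvPowerSeries (Fin 2) R)).subst ![u, v] := by
    rw [PowerSeries.subst, PowerSeries.subst,
      MvPowerSeries.subst_comp_subst_apply hadd.const huv]
    simp [MvPowerSeries.subst_add huv, MvPowerSeries.subst_X huv]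
  obtain ⟨g, hg⟩ := hX
  refine ⟨g.subst ![u, v], ?_⟩
  have := congrArg (MvPowerSeries.subst ![u, v]) hg
  simpa [MvPowerSeries.subst_mul huv, MvPowerSeries.subst_sub huv, MvPowerSeries.subst_pow huv,
    MvPowerSeries.subst_X huv, subst_subst_X huv, ← hsum] using this

theorem coeff_single_subst {f : PowerSeries R} (hf : PowerSeries.constantCoeff f = 0)
    {u : MvPowerSeries τ R} (hu : MvPowerSeries.constantCoeff u = 0) (i : τ) :
    MvPowerSeries.coeff (Finsupp.single i 1) (f.subst u) =
      PowerSeries.coeff 1 f * MvPowerSeries.coeff (Finsupp.single i 1) u := by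
  obtain ⟨g, hg⟩ := PowerSeries.X_dvd_iff.mpr hf
  have hu' := PowerSeries.HasSubst.of_constantCoeff_zero hu
  obtain ⟨h, hh⟩ : PowerSeries.X ∣ g - PowerSeries.C (PowerSeries.coeff 1 f) :=
    PowerSeries.X_dvd_iff.mpr (by
      rw [map_sub, PowerSeries.constantCoeff_C, hg, ← zero_add 1, PowerSeries.coeff_succ_X_mul,
        PowerSeries.coeff_zero_eq_constantCoeff_apply, sub_self])
  have : f.subst u - MvPowerSeries.C (PowerSeries.coeff 1 f) * u = u * (u * h.subst u) := by
    nth_rw 1 [hg]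
    rw [sub_eq_iff_eq_add.mp hh]
    simp only [PowerSeries.subst_mul hu', PowerSeries.subst_add hu', PowerSeries.subst_X hu',
      PowerSeries.subst_C]
    ring
  rw [← MvPowerSeries.coeff_C_mul, ← sub_eq_zero, ← map_sub, this]
  exact degIdeal.coeff_single_mul_eq_zero hu (by simp [hu]) i

theorem exists_eq_expand_of_derivative_eq_zero {p : ℕ} [CharP R p] (hp : p.Prime)
    {f : PowerSeries R} (hf : PowerSeries.derivative R f = 0) :
    ∃ g : PowerSeries R, f = g.expand p hp.ne_zero := by
  refine ⟨PowerSeries.mk fun n => PowerSeries.coeff (p * n) f, PowerSeries.ext fun n => ?_⟩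
  by_cases hn : p ∣ n
  · obtain ⟨m, rfl⟩ := hn
    rw [PowerSeries.coeff_expand_mul, PowerSeries.coeff_mk]
  · rw [PowerSeries.coeff_expand_of_not_dvd _ _ _ hn]
    obtain ⟨m, rfl⟩ : ∃ m, n = m + 1 := Nat.exists_eq_succ_of_ne_zero (by rintro rfl; simp at hn)
    have hm := PowerSeries.coeff_derivative f m
    rw [hf, map_zero, ← Nat.cast_succ] at hm
    exact ((CharP.isUnit_natCast_iff hp).mpr hn).mul_left_eq_zero.mp hm.symm

end Subst

/-! ### Formal group laws and their endomorphisms -/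

section FormalGroup

variable {R τ : Type*} [CommRing R] (F : FormalGroup R)

theorem formalGroup_hasSubst : PowerSeries.HasSubst F.toPowerSeries :=
  PowerSeries.HasSubst.of_constantCoeff_zero F.zero_constantCoeff

theorem formalGroup_sub_add_mem_degIdeal_two :
    F.toPowerSeries - (MvPowerSeries.X 0 + MvPowerSeries.X 1) ∈ degIdeal (Fin 2) R 2 := by
  refine degIdeal.mem_iff.mpr fun d hd => ?_
  have hd_eq : d = Finsupp.single 0 (d 0) + Finsupp.single 1 (d 1) :=
    Finsupp.ext (Fin.forall_fin_two.mpr ⟨by simp, by simp⟩)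
  have hd_lt : d 0 + d 1 < 2 := by simpa [Finsupp.degree_eq_sum] using hd
  obtain ⟨h0, h1⟩ | ⟨h0, h1⟩ | ⟨h0, h1⟩ :
      d 0 = 0 ∧ d 1 = 0 ∨ d 0 = 1 ∧ d 1 = 0 ∨ d 0 = 0 ∧ d 1 = 1 := by omega
  all_goals rw [hd_eq, h0, h1]
  · simp [F.zero_constantCoeff]
  · simp [F.lin_coeff_X, MvPowerSeries.coeff_index_single_X]
  · simp [F.lin_coeff_Y, MvPowerSeries.coeff_index_single_X]

theorem formalGroup_subst_sub_add_mem_degIdeal_two {u v : MvPowerSeries τ R}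
    (hu : MvPowerSeries.constantCoeff u = 0) (hv : MvPowerSeries.constantCoeff v = 0) :
    F.toPowerSeries.subst ![u, v] - (u + v) ∈ degIdeal τ R 2 := by
  have huv := hasSubst_pair_of_constantCoeff_eq_zero hu hv
  have := degIdeal.subst_mem huv (m := 1)
    (Fin.forall_fin_two.mpr ⟨degIdeal.mem_one_iff.mpr hu, degIdeal.mem_one_iff.mpr hv⟩)
    (formalGroup_sub_add_mem_degIdeal_two F)
  rwa [one_mul, MvPowerSeries.subst_sub huv, MvPowerSeries.subst_add huv, MvPowerSeries.subst_X huv,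
    MvPowerSeries.subst_X huv] at this

theorem formalGroup_subst_sub_subst_mem_degIdeal {u v u' v' : MvPowerSeries τ R} {n : ℕ}
    (hu : PowerSeries.HasSubst u) (hv : PowerSeries.HasSubst v) (hu' : PowerSeries.HasSubst u')
    (hv' : PowerSeries.HasSubst v') (huu' : u - u' ∈ degIdeal τ R n)
    (hvv' : v - v' ∈ degIdeal τ R n) :
    F.toPowerSeries.subst ![u, v] - F.toPowerSeries.subst ![u', v'] ∈ degIdeal τ R n :=
  degIdeal.subst_sub_subst_mem (FormalGroup.hasSubst_pair hu hv) (FormalGroup.hasSubst_pair hu' hv')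
    (Fin.forall_fin_two.mpr ⟨huu', hvv'⟩) _

theorem exists_isUnit_formalGroup_eq_add_mul : ∃ U : MvPowerSeries (Fin 2) R, IsUnit U ∧
    F.toPowerSeries = MvPowerSeries.X 0 + MvPowerSeries.X 1 * U := by
  obtain ⟨U, hU⟩ := X_one_dvd_sub_subst_zero F.toPowerSeries
  rw [F.add_zero (PowerSeries.HasSubst.X 0), sub_eq_iff_eq_add'] at hU
  refine ⟨U, ?_, hU⟩
  have hcoeff : MvPowerSeries.coeff (Finsupp.single (1 : Fin 2) 1) (MvPowerSeries.X 1 * U) =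
      MvPowerSeries.constantCoeff U := by
    simpa [MvPowerSeries.X] using
      MvPowerSeries.coeff_add_monomial_mul (Finsupp.single (1 : Fin 2) 1) 0 U (1 : R)
  have hlin := F.lin_coeff_Y
  rw [hU, map_add, hcoeff, MvPowerSeries.coeff_index_single_X, if_neg one_ne_zero, zero_add] at hlin
  exact MvPowerSeries.isUnit_iff_constantCoeff.mpr (hlin ▸ isUnit_one)

end FormalGroup

theorem exists_X_pow_dvd_sub {R : Type*} [CommRing R] (f : ℕ → PowerSeries R) {N : ℕ → ℕ}
    (hN : StrictMono N) (h : ∀ n, PowerSeries.X ^ N n ∣ f (n + 1) - f n) :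
    ∃ l : PowerSeries R, ∀ n, PowerSeries.X ^ N n ∣ l - f n := by
  have hle {n m : ℕ} (hnm : n ≤ m) : PowerSeries.X ^ N n ∣ f m - f n := by
    induction m, hnm using Nat.le_induction with
    | base => simp
    | succ m hm ih =>
      simpa using dvd_add ((pow_dvd_pow _ (hN.monotone hm)).trans (h m)) ih
  refine ⟨PowerSeries.mk fun m => PowerSeries.coeff m (f (m + 1)), fun n => ?_⟩
  refine PowerSeries.X_pow_dvd_iff.mpr fun m hm => ?_
  rw [map_sub, PowerSeries.coeff_mk, ← map_sub]
  rcases le_total n (m + 1) with hnm | hnm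
  · exact PowerSeries.X_pow_dvd_iff.mp (hle hnm) m hm
  · rw [← neg_sub, map_neg, PowerSeries.X_pow_dvd_iff.mp (hle hnm) m (hN.le_apply), neg_zero]

namespace FormalGroup.Endo

section CommRing

variable {R : Type*} [CommRing R] {F : FormalGroup R}

theorem map_law_of_forall_X_pow_dvd_sub {l : PowerSeries R} (hl : PowerSeries.constantCoeff l = 0)
    (h : ∀ n, ∃ f : F.Endo, PowerSeries.X ^ n ∣ l - f.toSeries) :
    l.subst F.toPowerSeries = F.toPowerSeries.subst
      ![l.subst (MvPowerSeries.X 0 : MvPowerSeries (Fin 2) R),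
        l.subst (MvPowerSeries.X 1 : MvPowerSeries (Fin 2) R)] := by
  refine degIdeal.eq_of_forall_sub_mem fun n => ?_
  obtain ⟨f, hf⟩ := h n
  have hsubst {u : MvPowerSeries (Fin 2) R} (hu : MvPowerSeries.constantCoeff u = 0) :
      l.subst u - f.toSeries.subst u ∈ degIdeal (Fin 2) R n := by
    have hu' := PowerSeries.HasSubst.of_constantCoeff_zero hu
    have := degIdeal.subst_mem hu'.const (fun _ => degIdeal.mem_one_iff.mpr hu)
      (degIdeal.X_pow_dvd_iff.mp hf)
    rwa [one_mul, ← PowerSeries.subst_def, PowerSeries.subst_sub hu'] at this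
  have hlX (i : Fin 2) : PowerSeries.HasSubst
      (l.subst (MvPowerSeries.X i : MvPowerSeries (Fin 2) R)) :=
    PowerSeries.HasSubst.of_constantCoeff_zero
      (PowerSeries.constantCoeff_subst_eq_zero (by simp) _ hl)
  have hleft := hsubst F.zero_constantCoeff
  have hright := formalGroup_subst_sub_subst_mem_degIdeal F (hlX 0) (hlX 1)
    (f.hasSubst_subst (PowerSeries.HasSubst.X 0)) (f.hasSubst_subst (PowerSeries.HasSubst.X 1))
    (hsubst (MvPowerSeries.constantCoeff_X 0)) (hsubst (MvPowerSeries.constantCoeff_X 1))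
  rw [f.map_law] at hleft
  simpa using Ideal.sub_mem _ hleft hright

theorem exists_limit (f : ℕ → F.Endo) {N : ℕ → ℕ} (hN : StrictMono N)
    (h : ∀ n, PowerSeries.X ^ N n ∣ (f (n + 1)).toSeries - (f n).toSeries) :
    ∃ l : F.Endo, ∀ n, PowerSeries.X ^ N n ∣ l.toSeries - (f n).toSeries := by
  obtain ⟨l, hl⟩ := exists_X_pow_dvd_sub (fun n => (f n).toSeries) hN h
  have hl0 : PowerSeries.constantCoeff l = 0 := by
    have := PowerSeries.X_dvd_iff.mp
      ((dvd_pow_self _ (Nat.one_le_iff_ne_zero.mp hN.le_apply)).trans (hl 1))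
    rwa [map_sub, (f 1).constantCoeff_eq_zero, sub_zero] at this
  exact ⟨⟨l, hl0, map_law_of_forall_X_pow_dvd_sub hl0 fun n =>
    ⟨f n, (pow_dvd_pow _ hN.le_apply).trans (hl n)⟩⟩, hl⟩

theorem X_pow_dvd_mul_toSeries {m n : ℕ} {f g : F.Endo} (hf : PowerSeries.X ^ m ∣ f.toSeries)
    (hg : PowerSeries.X ^ n ∣ g.toSeries) : PowerSeries.X ^ (m * n) ∣ (f * g).toSeries := by
  rw [degIdeal.X_pow_dvd_iff] at hf hg ⊢
  rw [mul_comm]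
  exact degIdeal.subst_mem g.hasSubst.const (fun _ => hg) hf

theorem X_pow_dvd_pow_toSeries {m : ℕ} {f : F.Endo} (hf : PowerSeries.X ^ m ∣ f.toSeries) (n : ℕ) :
    PowerSeries.X ^ m ^ n ∣ (f ^ n).toSeries := by
  induction n with
  | zero => simp [one_toSeries]
  | succ n ih => simpa only [pow_succ] using X_pow_dvd_mul_toSeries ih hf

theorem X_pow_dvd_mul_toSeries_right {n : ℕ} {g : F.Endo} (f : F.Endo)
    (hg : PowerSeries.X ^ n ∣ g.toSeries) : PowerSeries.X ^ n ∣ (f * g).toSeries := by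
  have hf : PowerSeries.X ^ 1 ∣ f.toSeries := by
    rw [pow_one, PowerSeries.X_dvd_iff, f.constantCoeff_eq_zero]
  simpa only [one_mul] using X_pow_dvd_mul_toSeries hf hg

theorem eq_zero_of_forall_X_pow_dvd {f : F.Endo} {N : ℕ → ℕ} (hN : StrictMono N)
    (h : ∀ n, PowerSeries.X ^ N n ∣ f.toSeries) : f = 0 :=
  Endo.ext <| PowerSeries.ext fun n => by
    rw [zero_toSeries, map_zero]
    exact PowerSeries.X_pow_dvd_iff.mp (h (n + 1)) n hN.le_apply

theorem X_sq_dvd_toSeries {f : F.Endo} (hf : PowerSeries.coeff 1 f.toSeries = 0) :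
    PowerSeries.X ^ 2 ∣ f.toSeries :=
  PowerSeries.X_pow_dvd_iff.mpr fun m hm => by
    interval_cases m
    · simpa using f.constantCoeff_eq_zero
    · exact hf

theorem X_one_sq_dvd_subst_law_sub {f : F.Endo} (hf : PowerSeries.coeff 1 f.toSeries = 0) :
    MvPowerSeries.X 1 ^ 2 ∣ f.toSeries.subst F.toPowerSeries
      - f.toSeries.subst (MvPowerSeries.X 0 : MvPowerSeries (Fin 2) R) := by
  obtain ⟨U, -, hFU⟩ := exists_isUnit_formalGroup_eq_add_mul F
  obtain ⟨g, hg⟩ := X_sq_dvd_toSeries hf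
  have hX (i : Fin 2) : PowerSeries.HasSubst (MvPowerSeries.X i : MvPowerSeries (Fin 2) R) :=
    PowerSeries.HasSubst.X i
  have hff := hasSubst_pair (f.hasSubst_subst (hX 0)) (f.hasSubst_subst (hX 1))
  have hf1 : MvPowerSeries.X 1 ^ 2 ∣
      f.toSeries.subst (MvPowerSeries.X 1 : MvPowerSeries (Fin 2) R) := by
    rw [hg, PowerSeries.subst_mul (hX 1), PowerSeries.subst_pow (hX 1), PowerSeries.subst_X (hX 1)]
    exact dvd_mul_right _ _
  rw [f.map_law, hFU, MvPowerSeries.subst_add hff, MvPowerSeries.subst_mul hff,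
    MvPowerSeries.subst_X hff, MvPowerSeries.subst_X hff]
  simpa only [Matrix.cons_val_zero, Matrix.cons_val_one, add_sub_cancel_left] using
    hf1.mul_right _

theorem derivative_toSeries_eq_zero {f : F.Endo} (hf : PowerSeries.coeff 1 f.toSeries = 0) :
    PowerSeries.derivative R f.toSeries = 0 := by
  classical
  obtain ⟨U, hU, hFU⟩ := exists_isUnit_formalGroup_eq_add_mul F
  have htaylor := sq_dvd_subst_add_sub f.toSeries (PowerSeries.HasSubst.X (S := R) (0 : Fin 2))
    (v := MvPowerSeries.X 1 * U) (PowerSeries.HasSubst.of_constantCoeff_zero (by simp))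
  rw [← hFU, mul_pow] at htaylor
  have hsq := (dvd_sub_right (X_one_sq_dvd_subst_law_sub hf)).mp (dvd_of_mul_right_dvd htaylor)
  rw [mul_left_comm, pow_two] at hsq
  have hX : (MvPowerSeries.X 1 : MvPowerSeries (Fin 2) R) ∈ nonZeroDivisors _ :=
    MvPowerSeries.X_mem_nonzeroDivisors
  have hdvd := hU.dvd_mul_right.mp ((dvd_cancel_left_mem_nonZeroDivisors hX).mp hsq)
  ext n
  have := MvPowerSeries.X_dvd_iff.mp hdvd (Finsupp.single 0 n) (by simp)
  rwa [PowerSeries.coeff_subst_single, if_pos (by simp), Finsupp.single_eq_same] at this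

end CommRing

section IsComm

variable {R : Type*} [CommRing R] {F : FormalGroup R} [F.IsComm]

theorem X_pow_dvd_add_toSeries_sub {n : ℕ} (f : F.Endo) {g : F.Endo}
    (hg : PowerSeries.X ^ n ∣ g.toSeries) :
    PowerSeries.X ^ n ∣ (f + g).toSeries - f.toSeries := by
  rw [degIdeal.X_pow_dvd_iff] at hg ⊢
  have := formalGroup_subst_sub_subst_mem_degIdeal F f.hasSubst g.hasSubst f.hasSubst
    PowerSeries.HasSubst.zero (n := n) (by simp) (by rwa [sub_zero])
  rwa [F.add_zero f.hasSubst] at this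

theorem X_pow_dvd_sub_toSeries_of_add {n : ℕ} {f g : F.Endo} (h : F.Endo)
    (hfg : PowerSeries.X ^ n ∣ f.toSeries - g.toSeries) :
    PowerSeries.X ^ n ∣ (f + h).toSeries - (g + h).toSeries := by
  rw [degIdeal.X_pow_dvd_iff] at hfg ⊢
  exact formalGroup_subst_sub_subst_mem_degIdeal F f.hasSubst h.hasSubst g.hasSubst h.hasSubst hfg
    (by simp)

/-- The linear coefficient of an endomorphism, the action on the tangent space. -/
noncomputable def linearCoeff : F.Endo →+* R where
  toFun f := PowerSeries.coeff 1 f.toSeries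
  map_zero' := by simp [zero_toSeries]
  map_one' := by simp [one_toSeries]
  map_add' f g := by
    have := formalGroup_subst_sub_add_mem_degIdeal_two F f.constantCoeff_eq_zero
      g.constantCoeff_eq_zero
    rw [← add_toSeries, ← degIdeal.X_pow_dvd_iff] at this
    rw [← map_add, ← sub_eq_zero, ← map_sub]
    exact PowerSeries.X_pow_dvd_iff.mp this 1 one_lt_two
  map_mul' f g := coeff_single_subst f.constantCoeff_eq_zero g.constantCoeff_eq_zero ()

theorem linearCoeff_apply (f : F.Endo) : linearCoeff f = PowerSeries.coeff 1 f.toSeries := rfl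

theorem eq_zero_of_mul_eq_zero {f g : F.Endo} (hf : IsUnit (linearCoeff f)) (h : f * g = 0) :
    g = 0 := by
  refine Endo.ext (subst_injOn_of_isUnit_coeff_one hf f.constantCoeff_eq_zero
    g.constantCoeff_eq_zero MvPowerSeries.constantCoeff_zero ?_)
  have := congrArg toSeries (h.trans (mul_zero f).symm)
  exact this

end IsComm

end FormalGroup.Endo

namespace FormalGroup.Endo

section Ring

theorem X_pow_dvd_natCast_pow_toSeries {R : Type*} [CommRing R] {F : FormalGroup R} [F.IsComm]
    (p : ℕ) [CharP R p] (n : ℕ) : PowerSeries.X ^ 2 ^ n ∣ ((p : F.Endo) ^ n).toSeries :=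
  X_pow_dvd_pow_toSeries (X_sq_dvd_toSeries (by
    rw [← linearCoeff_apply, map_natCast, CharP.cast_eq_zero])) n

theorem exists_add_one_eq_zero {R : Type*} [CommRing R] (F : FormalGroup R) [F.IsComm] (p : ℕ)
    [NeZero p] [CharP R p] : ∃ m : F.Endo, m + 1 = 0 := by
  have hN : StrictMono fun n : ℕ => 2 ^ n := pow_right_strictMono₀ one_lt_two
  obtain ⟨q, rfl⟩ := Nat.exists_eq_succ_of_ne_zero (NeZero.ne p)
  -- `-1` is the sum of the geometric series `∑ (p - 1) pⁿ`.
  obtain ⟨m, hm⟩ := exists_limit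
    (fun n => (q : F.Endo) * ∑ i ∈ Finset.range n, (q.succ : F.Endo) ^ i)
    hN fun n => by
      rw [Finset.sum_range_succ, mul_add]
      exact X_pow_dvd_add_toSeries_sub _
        (X_pow_dvd_mul_toSeries_right _ (X_pow_dvd_natCast_pow_toSeries _ n))
  refine ⟨m, eq_zero_of_forall_X_pow_dvd hN fun n => ?_⟩
  have := X_pow_dvd_sub_toSeries_of_add 1 (hm n)
  rwa [Nat.cast_commute, Nat.cast_succ, geom_sum_mul_add, ← Nat.cast_succ,
    dvd_sub_left (X_pow_dvd_natCast_pow_toSeries _ n)] at this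

variable {R : Type*} [CommRing R] {F : FormalGroup R} [F.IsComm] (p : ℕ) [NeZero p] [CharP R p]

/-- The ring of endomorphisms of a commutative formal group law in positive characteristic `p`. -/
noncomputable abbrev ring : Ring F.Endo :=
  letI : Neg F.Endo := ⟨fun f => (exists_add_one_eq_zero F p).choose * f⟩
  { (inferInstance : Semiring F.Endo) with
    zsmul := zsmulRec
    neg_add_cancel := fun f => by
      have := congrArg (· * f) (exists_add_one_eq_zero F p).choose_spec
      rwa [add_mul, one_mul, zero_mul] at this }

theorem X_pow_dvd_sub_toSeries {n : ℕ} {f g : F.Endo}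
    (h : PowerSeries.X ^ n ∣ f.toSeries - g.toSeries) :
    letI := ring (F := F) p
    PowerSeries.X ^ n ∣ (f - g).toSeries := by
  let := ring (F := F) p
  have := X_pow_dvd_sub_toSeries_of_add (-g) h
  rwa [add_neg_cancel, zero_toSeries, sub_zero, ← sub_eq_add_neg] at this

end Ring

section Frobenius

variable {R : Type*} [CommRing R] {F : FormalGroup R} {p : ℕ} [hp : Fact p.Prime] [CharP R p]
  (hF : F.toPowerSeries.map (_root_.frobenius R p) = F.toPowerSeries)

/-- The Frobenius endomorphism `x ^ p` of a formal group law whose coefficients it fixes. -/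
noncomputable def frobenius : F.Endo where
  toSeries := PowerSeries.X ^ p
  constantCoeff_eq_zero := by simp [hp.out.ne_zero]
  map_law := by
    have hX (i : Fin 2) : PowerSeries.HasSubst (MvPowerSeries.X i : MvPowerSeries (Fin 2) R) :=
      PowerSeries.HasSubst.X i
    have hFs := formalGroup_hasSubst F
    rw [PowerSeries.subst_pow hFs, PowerSeries.subst_X hFs, PowerSeries.subst_pow (hX 0),
      PowerSeries.subst_X (hX 0), PowerSeries.subst_pow (hX 1), PowerSeries.subst_X (hX 1),
      ← expand_eq_pow_of_map_frobenius_eq hp.out.ne_zero hF, MvPowerSeries.expand,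
      MvPowerSeries.coe_substAlgHom]
    congr 1
    exact funext (Fin.forall_fin_two.mpr ⟨rfl, rfl⟩)

theorem frobenius_toSeries : (frobenius hF).toSeries = PowerSeries.X ^ p := rfl

theorem mul_frobenius_toSeries (f : F.Endo) :
    (f * frobenius hF).toSeries = f.toSeries.expand p hp.out.ne_zero :=
  (PowerSeries.expand_apply ..).symm

theorem mul_frobenius_injective : Function.Injective fun f : F.Endo => f * frobenius hF :=
  fun f g h => Endo.ext <| PowerSeries.ext fun n => by
    have := congrArg (fun f => PowerSeries.coeff (p * n) f.toSeries) h
    simpa only [mul_frobenius_toSeries, PowerSeries.coeff_expand_mul] using this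

include hF in
theorem map_law_of_expand {f : F.Endo} {a : PowerSeries R} (ha0 : PowerSeries.constantCoeff a = 0)
    (ha : f.toSeries = a.expand p hp.out.ne_zero) :
    a.subst F.toPowerSeries = F.toPowerSeries.subst
      ![a.subst (MvPowerSeries.X 0 : MvPowerSeries (Fin 2) R),
        a.subst (MvPowerSeries.X 1 : MvPowerSeries (Fin 2) R)] := by
  have hp0 := hp.out.ne_zero
  have hX (i : Fin 2) : PowerSeries.HasSubst (MvPowerSeries.X i : MvPowerSeries (Fin 2) R) :=
    PowerSeries.HasSubst.X i
  have hFs := formalGroup_hasSubst F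
  have haX (i : Fin 2) : PowerSeries.HasSubst
      (a.subst (MvPowerSeries.X i : MvPowerSeries (Fin 2) R)) :=
    PowerSeries.HasSubst.of_constantCoeff_zero
      (PowerSeries.constantCoeff_subst_eq_zero (by simp) _ ha0)
  have hexpand (i : Fin 2) : (a.subst (MvPowerSeries.X i : MvPowerSeries (Fin 2) R)).expand p hp0 =
      f.toSeries.subst (MvPowerSeries.X i : MvPowerSeries (Fin 2) R) := by
    rw [PowerSeries.expand_subst p hp0 (hX i), MvPowerSeries.expand_X, ha,
      expand_subst_eq hp0 (hX i)]
  refine mvPowerSeries_expand_injective hp0 ?_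
  rw [PowerSeries.expand_subst p hp0 hFs, expand_eq_pow_of_map_frobenius_eq hp0 hF,
    ← expand_subst_eq hp0 hFs, ← ha, f.map_law,
    MvPowerSeries.expand_subst p hp0 (hasSubst_pair (haX 0) (haX 1))]
  congr 1
  exact funext (Fin.forall_fin_two.mpr ⟨(hexpand 0).symm, (hexpand 1).symm⟩)

theorem exists_eq_mul_frobenius_iff {f : F.Endo} :
    (∃ g, f = g * frobenius hF) ↔ PowerSeries.coeff 1 f.toSeries = 0 := by
  refine ⟨?_, fun hf => ?_⟩
  · rintro ⟨g, rfl⟩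
    rw [mul_frobenius_toSeries, PowerSeries.coeff_expand_of_not_dvd]
    exact fun h => hp.out.ne_one (Nat.dvd_one.mp h)
  · obtain ⟨a, ha⟩ := exists_eq_expand_of_derivative_eq_zero hp.out (derivative_toSeries_eq_zero hf)
    have ha0 : PowerSeries.constantCoeff a = 0 := by
      rw [← PowerSeries.constantCoeff_expand p hp.out.ne_zero, ← ha, f.constantCoeff_eq_zero]
    exact ⟨⟨a, ha0, map_law_of_expand hF ha0 ha⟩, Endo.ext (by rw [ha, mul_frobenius_toSeries])⟩

theorem exists_eq_mul_frobenius_pow_iff {n : ℕ} {f : F.Endo} :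
    (∃ g, f = g * frobenius hF ^ n) ↔ PowerSeries.X ^ p ^ n ∣ f.toSeries := by
  refine ⟨?_, fun hf => ?_⟩
  · rintro ⟨g, rfl⟩
    exact X_pow_dvd_mul_toSeries_right g (X_pow_dvd_pow_toSeries (m := p) dvd_rfl n)
  · induction n generalizing f with
    | zero => exact ⟨f, by rw [pow_zero, mul_one]⟩
    | succ n ih =>
      obtain ⟨g, rfl⟩ := (exists_eq_mul_frobenius_iff hF).mpr <|
        PowerSeries.X_pow_dvd_iff.mp hf 1 <|
        Nat.one_lt_pow n.succ_ne_zero hp.out.one_lt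
      obtain ⟨h, rfl⟩ := ih (f := g) <| PowerSeries.X_pow_dvd_iff.mpr fun m hm => by
        rw [← PowerSeries.coeff_expand_mul p hp.out.ne_zero, ← mul_frobenius_toSeries hF]
        exact PowerSeries.X_pow_dvd_iff.mp hf _
          (by rw [pow_succ']; exact Nat.mul_lt_mul_of_pos_left hm hp.out.pos)
      exact ⟨h, by rw [pow_succ, mul_assoc]⟩

end Frobenius

section Scale

variable {R : Type*} [CommRing R] {F : FormalGroup R} {c : R}

/-- Multiplication by a constant `c` with `F(cx, cy) = c F(x, y)`. -/
noncomputable def scale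
    (h : F.toPowerSeries.rescale (fun _ => c) = MvPowerSeries.C c * F.toPowerSeries) :
    F.Endo where
  toSeries := PowerSeries.C c * PowerSeries.X
  constantCoeff_eq_zero := by simp
  map_law := by
    rw [C_mul_X_subst (formalGroup_hasSubst F), C_mul_X_subst (PowerSeries.HasSubst.X 0),
      C_mul_X_subst (PowerSeries.HasSubst.X 1), ← h, MvPowerSeries.rescale_eq_subst]
    congr 1
    funext s
    fin_cases s <;> simp [MvPowerSeries.smul_eq_C_mul]

variable {h : F.toPowerSeries.rescale (fun _ => c) = MvPowerSeries.C c * F.toPowerSeries}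

theorem scale_toSeries : (scale h).toSeries = PowerSeries.C c * PowerSeries.X := rfl

theorem linearCoeff_scale [F.IsComm] : linearCoeff (scale h) = c := by
  rw [linearCoeff_apply, scale_toSeries, PowerSeries.coeff_C_mul, PowerSeries.coeff_one_X, mul_one]

theorem scale_mul_toSeries (f : F.Endo) :
    (scale h * f).toSeries = PowerSeries.C c * f.toSeries :=
  C_mul_X_subst f.hasSubst c

theorem scale_pow_toSeries (n : ℕ) :
    (scale h ^ n).toSeries = PowerSeries.C (c ^ n) * PowerSeries.X := by
  induction n with
  | zero => rw [pow_zero, pow_zero, map_one, one_mul, one_toSeries]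
  | succ n ih => rw [pow_succ', scale_mul_toSeries, ih, ← mul_assoc, ← map_mul, ← pow_succ']

theorem frobenius_mul_scale {p : ℕ} [Fact p.Prime] [CharP R p]
    (hF : F.toPowerSeries.map (_root_.frobenius R p) = F.toPowerSeries) :
    frobenius hF * scale h = scale h ^ p * frobenius hF := Endo.ext <| by
  have hs := (scale h).hasSubst
  rw [mul_toSeries, mul_toSeries, scale_pow_toSeries, C_mul_X_subst (frobenius hF).hasSubst,
    frobenius_toSeries, PowerSeries.subst_pow hs, PowerSeries.subst_X hs, scale_toSeries, mul_pow,
    map_pow]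
  rfl

theorem scale_mul_scale {p : ℕ} [NeZero p] [CharP R p] [F.IsComm] (hc : IsUnit (c - 1))
    (hc3 : c ^ 3 = 1) :
    letI := ring (F := F) p
    scale h * scale h = -1 - scale h := by
  let := ring (F := F) p
  have hcube : scale h ^ 3 = 1 := Endo.ext <| by
    rw [scale_pow_toSeries, hc3, map_one, one_mul, one_toSeries]
  have hfactor : (scale h - 1) * (scale h * scale h + scale h + 1) = scale h ^ 3 - 1 := by
    noncomm_ring
  have hzero := eq_zero_of_mul_eq_zero (f := scale h - 1)
    (by rwa [map_sub, map_one, linearCoeff_scale]) (by rw [hfactor, hcube, sub_self])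
  rw [← sub_eq_zero, ← hzero]
  abel

end Scale

end FormalGroup.Endo

/-! ### Completions of the order `EisensteinOrder t` -/

theorem natCast_natAbs_pow_dvd_iff {D : Type*} [Ring D] {t : ℤ} {τ d : D} {n : ℕ}
    (hτ : τ * τ = t) : ((t.natAbs : ℕ) : D) ^ n ∣ d ↔ ∃ c, d = c * τ ^ (2 * n) := by
  have hpow (c : D) : c * τ ^ (2 * n) = (t : D) ^ n * c := by
    rw [pow_mul, pow_two, hτ, (((Int.cast_commute t c).pow_left n)).eq]
  simp only [hpow]
  obtain ht | ht := Int.natAbs_eq t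
  · rw [ht, Int.natAbs_natCast, Int.cast_natCast]
    rfl
  · rw [ht, Int.natAbs_neg, Int.natAbs_natCast, Int.cast_neg, Int.cast_natCast]
    obtain h | h := neg_one_pow_eq_or D n
    · rw [neg_pow, h, one_mul]
      rfl
    · simp only [neg_pow (t.natAbs : D), h, neg_one_mul]
      exact dvd_neg.symm.trans <| exists_congr fun c => by rw [neg_mul, neg_eq_iff_eq_neg]

namespace EisensteinOrder

section Residue

variable {t : ℤ} {D : Type*} [Ring D] {w τ : D} {hw : w * w = -1 - w} {hτ : τ * τ = t}
  {hτw : τ * w = (-1 - w) * τ} {ζ : F4} (hζ : IsPrimitiveRoot ζ 3) {χ : D →+* F4} (hχw : χ w = ζ)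
  (hχ : ∀ d, (∃ c, d = c * τ) ↔ χ d = 0) (ht : t.natAbs = 2)

include hζ hχw in
theorem two_dvd_of_residue_eq_zero {a b : ℤ} (h : χ (a + b * w) = 0) : 2 ∣ a ∧ 2 ∣ b :=
  F4.two_dvd_of_intCast_add_mul_eq_zero hζ (by simpa [hχw] using h)

include hζ hχw hχ ht in
theorem two_dvd_of_two_dvd_lift (hreg : Function.Injective (· * τ)) {x : EisensteinOrder t}
    (h : ((2 : ℕ) : D) ∣ lift hw hτ hτw x) : ((2 : ℕ) : EisensteinOrder t) ∣ x := by
  rw [lift_apply] at h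
  have hχτ : χ τ = 0 := (hχ τ).mp ⟨1, (one_mul τ).symm⟩
  have hτ_dvd {d : D} (hd : ((2 : ℕ) : D) ∣ d) : ∃ c, d = c * τ * τ := by
    rw [← ht, ← pow_one ((t.natAbs : ℕ) : D), natCast_natAbs_pow_dvd_iff hτ] at hd
    simpa only [mul_one, pow_two, mul_assoc] using hd
  obtain ⟨hre, hi⟩ : 2 ∣ x.re ∧ 2 ∣ x.imI := two_dvd_of_residue_eq_zero hζ hχw <| by
    obtain ⟨c, hc⟩ := hτ_dvd h
    simpa [hχτ] using congrArg χ hc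
  obtain ⟨hj, hk⟩ : 2 ∣ x.imJ ∧ 2 ∣ x.imK := two_dvd_of_residue_eq_zero hζ hχw <| by
    have hlow : ((2 : ℕ) : D) ∣ x.re + x.imI * w := by
      have h2 : ((2 : ℕ) : D) = ((2 : ℤ) : D) := by norm_num
      rw [h2]
      exact dvd_add (map_dvd (Int.castRingHom D) hre) ((map_dvd (Int.castRingHom D) hi).mul_right w)
    obtain ⟨c, hc⟩ := hτ_dvd ((dvd_add_right hlow).mp h)
    rw [hreg hc, map_mul, hχτ, mul_zero]
  exact_mod_cast two_dvd hre hi hj hk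

include hζ hχw hχ ht in
theorem exists_two_dvd_sub_lift (d : D) : ∃ x, ((2 : ℕ) : D) ∣ d - lift hw hτ hτw x := by
  have hdigit (d : D) : ∃ (a b : ℤ) (c : D), d = a + b * w + c * τ := by
    obtain ⟨a, b, hab⟩ := F4.exists_intCast_add_mul_eq hζ (χ d)
    obtain ⟨c, hc⟩ := (hχ (d - (a + b * w))).mpr (by simp [hχw, hab])
    exact ⟨a, b, c, sub_eq_iff_eq_add'.mp hc⟩
  obtain ⟨a, b, d₁, rfl⟩ := hdigit d
  obtain ⟨a₁, b₁, d₂, rfl⟩ := hdigit d₁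
  refine ⟨⟨a, b, a₁, b₁⟩, ?_⟩
  rw [← ht, ← pow_one ((t.natAbs : ℕ) : D), natCast_natAbs_pow_dvd_iff hτ, lift_apply]
  exact ⟨d₂, by rw [mul_one, pow_two]; noncomm_ring⟩

end Residue

end EisensteinOrder

namespace FormalGroup.Endo

open EisensteinOrder

section TwistedWitt

variable {F : FormalGroup F4} [F.IsComm]
  (hF : F.toPowerSeries.map (_root_.frobenius F4 2) = F.toPowerSeries)
  {ζ : F4} (hζ : IsPrimitiveRoot ζ 3)
  (h : F.toPowerSeries.rescale (fun _ => ζ) = MvPowerSeries.C ζ * F.toPowerSeries)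
  {t : ℤ} (ht : t.natAbs = 2)

include ht in
theorem two_pow_dvd_iff_X_pow_dvd {n : ℕ} {f : F.Endo}
    (hφ : letI := ring (F := F) 2; frobenius hF * frobenius hF = (t : F.Endo)) :
    ((2 : ℕ) : F.Endo) ^ n ∣ f ↔ PowerSeries.X ^ 2 ^ (2 * n) ∣ f.toSeries := by
  let := ring (F := F) 2
  rw [← exists_eq_mul_frobenius_pow_iff hF]
  simpa only [ht] using natCast_natAbs_pow_dvd_iff (d := f) (n := n) hφ

include hζ ht in
theorem exists_isCompletionAt
    (hφ : letI := ring (F := F) 2; frobenius hF * frobenius hF = (t : F.Endo)) :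
    letI := ring (F := F) 2
    ∃ f : EisensteinOrder t →+* F.Endo, IsCompletionAt 2 f ∧ f ⟨0, 1, 0, 0⟩ = scale h ∧
      f ⟨0, 0, 1, 0⟩ = frobenius hF := by
  let := ring (F := F) 2
  have hw : scale h * scale h = -1 - scale h := scale_mul_scale
    (sub_ne_zero.mpr (hζ.ne_one (by norm_num))).isUnit hζ.pow_eq_one
  have hτw : frobenius hF * scale h = (-1 - scale h) * frobenius hF := by
    rw [frobenius_mul_scale, pow_two, hw]
  have hdvd {n : ℕ} {f : F.Endo} := two_pow_dvd_iff_X_pow_dvd (n := n) (f := f) hF ht hφ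
  have hN : StrictMono fun n : ℕ => 2 ^ (2 * n) :=
    (pow_right_strictMono₀ one_lt_two).comp fun _ _ h => by omega
  have hreg (f : F.Endo) (hf : (2 : ℕ) * f = 0) : f = 0 := by
    obtain ⟨s, hs⟩ : 2 ∣ t := Int.natAbs_dvd_natAbs.mp (by simp [ht])
    have hfφ : f * frobenius hF * frobenius hF = 0 := by
      rw [mul_assoc, hφ, ← Int.cast_comm, hs, mul_comm, Int.cast_mul, mul_assoc,
        show ((2 : ℤ) : F.Endo) * f = 0 from hf, mul_zero]
    have hinj := mul_frobenius_injective hF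
    exact hinj (hinj (by simpa using hfφ))
  refine ⟨lift hw hφ hτw, ⟨?_, ?_, ?_, ?_⟩, by simp [lift_apply], by simp [lift_apply]⟩
  · exact IsCompletionAt.pow_dvd_of_dvd_map hreg fun x => two_dvd_of_two_dvd_lift hζ
      linearCoeff_scale (fun _ => exists_eq_mul_frobenius_iff hF) ht (mul_frobenius_injective hF)
  · exact IsCompletionAt.exists_pow_dvd_sub_of_exists_dvd_sub <| exists_two_dvd_sub_lift hζ
      linearCoeff_scale (fun _ => exists_eq_mul_frobenius_iff hF) ht
  · exact fun hf => eq_zero_of_forall_X_pow_dvd hN fun n => hdvd.mp (hf n)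
  · intro f hf
    obtain ⟨l, hl⟩ := exists_limit f hN fun n => by
      rw [← sub_add_cancel (f (n + 1)) (f n), add_comm]
      exact X_pow_dvd_add_toSeries_sub _ (hdvd.mp (hf n))
    exact ⟨l, fun n => hdvd.mpr (X_pow_dvd_sub_toSeries 2 (hl n))⟩

include hζ h ht in
theorem exists_twistedWitt_ringEquiv
    (hφ : letI := ring (F := F) 2; frobenius hF * frobenius hF = (t : F.Endo)) :
    ∃ Φ : TwistedWitt t ≃+* F.Endo, (Φ (TwistedWitt.gen t)).toSeries = PowerSeries.X ^ 2 ∧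
      ∀ c : F4, (Φ (TwistedWitt.of t (WittVector.teichmuller 2 c))).toSeries =
        PowerSeries.C c * PowerSeries.X := by
  let := ring (F := F) 2
  obtain ⟨f, hf, hfω, hfτ⟩ := exists_isCompletionAt hF hζ h ht hφ
  obtain ⟨Φ, hΦ⟩ := (TwistedWitt.isCompletionAt_ofOrder hζ).exists_ringEquiv hf
  have hω : Φ (TwistedWitt.of t (WittVector.teichmuller 2 ζ)) = scale h := by
    rw [← hfω, ← hΦ]
    simp [TwistedWitt.ofOrder_apply, TwistedWitt.of]
  have hτ : Φ (TwistedWitt.gen t) = frobenius hF := by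
    rw [← hfτ, ← hΦ]
    simp [TwistedWitt.ofOrder_apply, TwistedWitt.gen]
  refine ⟨Φ, by rw [hτ, frobenius_toSeries], fun c => ?_⟩
  obtain rfl | rfl | rfl | rfl := F4.eq_cases hζ c
  · simp [zero_toSeries]
  · simp [one_toSeries]
  · rw [hω, scale_toSeries]
  · rw [map_pow, map_pow, map_pow, hω, scale_pow_toSeries]

end TwistedWitt

end FormalGroup.Endo

/-! ### Congruences between integral power series and the Honda logarithm -/

/-- The power series over the rationals with the same coefficients as an integral one. -/
noncomputable abbrev toRat {σ : Type*} : MvPowerSeries σ ℤ →+* MvPowerSeries σ ℚ :=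
  MvPowerSeries.map (Int.castRingHom ℚ)

section Integral

variable {σ : Type*}

theorem toRat_injective :
    Function.Injective (toRat : MvPowerSeries σ ℤ → MvPowerSeries σ ℚ) := fun u v h =>
  MvPowerSeries.ext fun d => Int.cast_injective (α := ℚ) <| by
    simpa using congrArg (MvPowerSeries.coeff d) h

theorem constantCoeff_toRat {u : MvPowerSeries σ ℤ} (hu : MvPowerSeries.constantCoeff u = 0) :
    MvPowerSeries.constantCoeff (toRat u) = 0 := by
  simp [hu]

theorem hasSubst_toRat {u : MvPowerSeries σ ℤ} (hu : MvPowerSeries.constantCoeff u = 0) :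
    PowerSeries.HasSubst (toRat u) :=
  PowerSeries.HasSubst.of_constantCoeff_zero (constantCoeff_toRat hu)

theorem C_dvd_iff_forall_dvd_coeff {R : Type*} [CommRing R] {c : R} {u : MvPowerSeries σ R} :
    MvPowerSeries.C c ∣ u ↔ ∀ d, c ∣ MvPowerSeries.coeff d u := by
  refine ⟨?_, fun h => ?_⟩
  · rintro ⟨v, rfl⟩ d
    exact ⟨_, MvPowerSeries.coeff_C_mul ..⟩
  · choose v hv using h
    exact ⟨v, MvPowerSeries.ext fun d => (hv d).trans (MvPowerSeries.coeff_C_mul ..).symm⟩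

theorem exists_C_dvd_toRat_eq {k : ℤ} {f : MvPowerSeries σ ℚ}
    (h : ∀ d, ∃ z : ℤ, k ∣ z ∧ MvPowerSeries.coeff d f = z) :
    ∃ D, MvPowerSeries.C k ∣ D ∧ toRat D = f := by
  choose D hkD hD using h
  exact ⟨D, C_dvd_iff_forall_dvd_coeff.mpr hkD, MvPowerSeries.ext fun d => (hD d).symm⟩

theorem exists_C_dvd_toRat_eq_of_forall_sub_mem {k : ℤ} {f : MvPowerSeries σ ℚ}
    (h : ∀ n, ∃ D, MvPowerSeries.C k ∣ D ∧ f - toRat D ∈ degIdeal σ ℚ n) :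
    ∃ D, MvPowerSeries.C k ∣ D ∧ toRat D = f :=
  exists_C_dvd_toRat_eq fun d => by
    obtain ⟨D, hkD, hD⟩ := h (d.degree + 1)
    refine ⟨MvPowerSeries.coeff d D, C_dvd_iff_forall_dvd_coeff.mp hkD d, ?_⟩
    simpa [sub_eq_zero] using degIdeal.mem_iff.mp hD d (Nat.lt_succ_self _)

theorem two_dvd_expand_sub (u : MvPowerSeries σ ℤ) :
    MvPowerSeries.C 2 ∣ u.expand 4 four_ne_zero - u ^ 4 := by
  have h : (u.expand 4 four_ne_zero).map (Int.castRingHom (ZMod 2))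
      = u.map (Int.castRingHom (ZMod 2)) ^ 4 := by
    rw [MvPowerSeries.map_expand]
    have := MvPowerSeries.map_iterateFrobenius_expand 2 two_ne_zero
      (u.map (Int.castRingHom (ZMod 2))) 2
    rwa [show iterateFrobenius (ZMod 2) 2 2 = RingHom.id _ from Subsingleton.elim _ _,
      MvPowerSeries.map_id] at this
  refine C_dvd_iff_forall_dvd_coeff.mpr fun d => ?_
  have hd := congrArg (MvPowerSeries.coeff d) h
  rw [← map_pow, MvPowerSeries.coeff_map, MvPowerSeries.coeff_map, ← sub_eq_zero, ← map_sub] at hd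
  rw [map_sub]
  exact (ZMod.intCast_zmod_eq_zero_iff_dvd _ 2).mp hd

theorem expand_mem_degIdeal {R : Type*} [CommRing R] {p n : ℕ} (hp : p ≠ 0)
    {f : MvPowerSeries σ R} (hf : f ∈ degIdeal σ R n) : f.expand p hp ∈ degIdeal σ R (p * n) := by
  change _ ≤ MvPowerSeries.order _
  rw [MvPowerSeries.order_expand, Nat.cast_mul, nsmul_eq_mul]
  exact mul_le_mul_right hf _

end Integral

section Subst

variable {τ R : Type*} [CommRing R] {f : PowerSeries R}

theorem exists_subst_eq_of_isUnit_coeff_one (hf : IsUnit (PowerSeries.coeff 1 f))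
    (hf0 : PowerSeries.constantCoeff f = 0) {s : MvPowerSeries τ R}
    (hs : MvPowerSeries.constantCoeff s = 0) :
    ∃ u : MvPowerSeries τ R, MvPowerSeries.constantCoeff u = 0 ∧ f.subst u = s := by
  have hs' := PowerSeries.HasSubst.of_constantCoeff_zero hs
  have hinv := PowerSeries.constantCoeff_substInvOfIsUnit f hf
  refine ⟨(f.substInvOfIsUnit hf).subst s,
    PowerSeries.constantCoeff_subst_eq_zero hs _ hinv, ?_⟩
  rw [← PowerSeries.subst_comp_subst_apply (PowerSeries.HasSubst.of_constantCoeff_zero' hinv) hs',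
    f.subst_substInvOfIsUnit_right hf0 hf, PowerSeries.subst_X hs']

theorem subst_sub_subst_sub_mem_degIdeal (hf : PowerSeries.coeff 1 f = 1) {u v : MvPowerSeries τ R}
    (hu : MvPowerSeries.constantCoeff u = 0) (hv : MvPowerSeries.constantCoeff v = 0) {n : ℕ}
    (h : u - v ∈ degIdeal τ R n) :
    f.subst u - f.subst v - (u - v) ∈ degIdeal τ R (n + 1) := by
  rw [← dividedDifference_subst_mul f (PowerSeries.HasSubst.of_constantCoeff_zero hv)
    (PowerSeries.HasSubst.of_constantCoeff_zero hu), ← sub_one_mul, add_comm]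
  refine degIdeal.mul_mem (degIdeal.mem_one_iff.mpr ?_) h
  rw [map_sub, constantCoeff_dividedDifference_subst f hv hu, hf, map_one, sub_self]

end Subst

namespace hondaLog

variable {σ : Type*}

theorem coeff_four_pow (k : ℕ) : PowerSeries.coeff (4 ^ k) hondaLog = (1 / 2) ^ k := by
  rw [hondaLog, PowerSeries.coeff_mk, Finset.sum_eq_single k]
  · simp
  · exact fun j _ hj => if_neg fun h => hj (Nat.pow_right_injective (by norm_num) h).symm
  · exact fun h => absurd (Finset.mem_range.mpr ((Nat.lt_pow_self (by norm_num)).trans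
      (Nat.lt_succ_self _))) h

theorem coeff_eq_zero {n : ℕ} (h : ∀ k, n ≠ 4 ^ k) : PowerSeries.coeff n hondaLog = 0 := by
  rw [hondaLog, PowerSeries.coeff_mk]
  exact Finset.sum_eq_zero fun k _ => if_neg (h k)

theorem coeff_one : PowerSeries.coeff 1 hondaLog = 1 := by
  simpa using coeff_four_pow 0

theorem isUnit_coeff_one : IsUnit (PowerSeries.coeff 1 hondaLog) :=
  coeff_one ▸ isUnit_one

theorem constantCoeff_eq_zero : PowerSeries.constantCoeff hondaLog = 0 := by
  rw [← PowerSeries.coeff_zero_eq_constantCoeff_apply]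
  exact coeff_eq_zero fun k => (pow_pos four_pos k).ne

theorem eq_X_add_expand :
    hondaLog = PowerSeries.X + PowerSeries.C (1 / 2) * hondaLog.expand 4 four_ne_zero := by
  ext n
  rw [map_add, PowerSeries.coeff_C_mul, PowerSeries.coeff_expand, PowerSeries.coeff_X]
  by_cases! h : ∃ k, n = 4 ^ k
  · obtain ⟨_ | k, rfl⟩ := h
    · simp [coeff_one]
    · rw [coeff_four_pow, if_neg (Nat.one_lt_pow (by omega) (by norm_num)).ne',
        if_pos (dvd_pow_self _ (by omega)), pow_succ 4, Nat.mul_div_cancel _ four_pos,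
        coeff_four_pow, pow_succ', zero_add]
  · rw [coeff_eq_zero h, if_neg (by simpa using h 0), zero_add, eq_comm, mul_eq_zero]
    refine Or.inr (ite_eq_right_iff.mpr fun h4 => coeff_eq_zero fun k hk => h (k + 1) ?_)
    rw [pow_succ, ← hk, Nat.div_mul_cancel h4]

theorem subst_eq {u : MvPowerSeries σ ℚ} (hu : MvPowerSeries.constantCoeff u = 0) :
    hondaLog.subst u = u + MvPowerSeries.C (1 / 2) * hondaLog.subst (u ^ 4) := by
  have hu' := PowerSeries.HasSubst.of_constantCoeff_zero hu
  nth_rw 1 [eq_X_add_expand]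
  rw [PowerSeries.subst_add hu', PowerSeries.subst_mul hu', PowerSeries.subst_X hu',
    PowerSeries.subst_C, expand_subst_eq four_ne_zero hu']

theorem sub_expand_subst {u : MvPowerSeries σ ℚ} (hu : MvPowerSeries.constantCoeff u = 0) :
    hondaLog.subst u - MvPowerSeries.C (1 / 2) * (hondaLog.subst u).expand 4 four_ne_zero =
      u + MvPowerSeries.C (1 / 2) *
        (hondaLog.subst (u ^ 4) - hondaLog.subst (u.expand 4 four_ne_zero)) := by
  rw [PowerSeries.expand_subst 4 four_ne_zero (PowerSeries.HasSubst.of_constantCoeff_zero hu)]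
  linear_combination subst_eq hu

theorem exists_coeff_mul_coeff_pow_sub_pow_eq {u v : MvPowerSeries σ ℤ}
    (h : MvPowerSeries.C 2 ∣ u - v) (n : ℕ) (d : σ →₀ ℕ) :
    ∃ z : ℤ, 2 ∣ z ∧
      PowerSeries.coeff n hondaLog * (MvPowerSeries.coeff d (u ^ n - v ^ n) : ℤ) = z := by
  by_cases! hn : ∃ k, n = 4 ^ k
  · obtain ⟨k, rfl⟩ := hn
    have hpow := dvd_sub_pow_of_dvd_sub (p := 2) (by simpa using h) (2 * k)
    rw [pow_mul 2 2 k, ← Nat.cast_pow, ← map_natCast MvPowerSeries.C] at hpow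
    obtain ⟨c, hc⟩ := C_dvd_iff_forall_dvd_coeff.mp hpow d
    refine ⟨2 * (2 ^ k * c), dvd_mul_right _ _, ?_⟩
    rw [coeff_four_pow, show (4 : ℕ) = 2 ^ 2 by norm_num, hc]
    push_cast
    rw [one_div, inv_pow, pow_succ, two_mul k, pow_add]
    field_simp
  · exact ⟨0, dvd_zero _, by rw [coeff_eq_zero hn, zero_mul, Int.cast_zero]⟩

theorem exists_toRat_eq_subst_sub_subst {u v : MvPowerSeries σ ℤ}
    (hu : MvPowerSeries.constantCoeff u = 0) (hv : MvPowerSeries.constantCoeff v = 0)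
    (h : MvPowerSeries.C 2 ∣ u - v) :
    ∃ D, MvPowerSeries.C 2 ∣ D ∧ toRat D = hondaLog.subst (toRat u) - hondaLog.subst (toRat v) := by
  refine exists_C_dvd_toRat_eq fun d => ?_
  have hu' := hasSubst_toRat hu
  have hv' := hasSubst_toRat hv
  rw [map_sub, PowerSeries.coeff_subst hu', PowerSeries.coeff_subst hv',
    ← finsum_sub_distrib (PowerSeries.coeff_subst_finite hu' _ _)
      (PowerSeries.coeff_subst_finite hv' _ _)]
  refine finsum_induction (fun q : ℚ => ∃ z : ℤ, 2 ∣ z ∧ q = z) ⟨0, dvd_zero _, by simp⟩ ?_ ?_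
  · rintro _ _ ⟨a, ha, rfl⟩ ⟨b, hb, rfl⟩
    exact ⟨a + b, dvd_add ha hb, (Int.cast_add a b).symm⟩
  · intro n
    simpa [mul_sub, ← map_pow] using exists_coeff_mul_coeff_pow_sub_pow_eq h n d

/-- Successive approximation: an approximation of `u` is improved by the leading terms of
`ℓ(u) - ℓ(P)`, since `ℓ(x) = x + ⋯`. -/
theorem exists_toRat_eq_of_subst_sub_subst {k : ℤ} {u : MvPowerSeries σ ℚ}
    (hu : MvPowerSeries.constantCoeff u = 0) {v : MvPowerSeries σ ℤ}
    (hv : MvPowerSeries.constantCoeff v = 0)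
    (h : ∀ P : MvPowerSeries σ ℤ, MvPowerSeries.constantCoeff P = 0 → MvPowerSeries.C k ∣ P - v →
      ∀ n, u - toRat P ∈ degIdeal σ ℚ n → ∃ D, MvPowerSeries.C k ∣ D ∧
        hondaLog.subst u - hondaLog.subst (toRat P) - toRat D ∈ degIdeal σ ℚ (n + 1)) :
    ∃ D, MvPowerSeries.C k ∣ D ∧ toRat D = u - toRat v := by
  have happrox (n : ℕ) : ∃ P : MvPowerSeries σ ℤ, MvPowerSeries.constantCoeff P = 0 ∧
      MvPowerSeries.C k ∣ P - v ∧ u - toRat P ∈ degIdeal σ ℚ n := by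
    induction n with
    | zero => exact ⟨v, hv, by simp, degIdeal.mem_iff.mpr fun d hd => absurd hd (by simp)⟩
    | succ n ih =>
      obtain ⟨P, hP0, hkP, hP⟩ := ih
      obtain ⟨D, hkD, hD⟩ := h P hP0 hkP n hP
      have hPD : u - toRat (P + D) ∈ degIdeal σ ℚ (n + 1) := by
        have := sub_mem hD (subst_sub_subst_sub_mem_degIdeal coeff_one hu
          (constantCoeff_toRat hP0) hP)
        rw [map_add]
        convert this using 1
        ring
      have hPD0 := degIdeal.mem_one_iff.mp (degIdeal.antitone (Nat.le_add_left 1 n) hPD)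
      refine ⟨P + D, by simpa only [map_sub, hu, zero_sub, neg_eq_zero,
        MvPowerSeries.constantCoeff_map, eq_intCast, Int.cast_eq_zero] using hPD0, ?_, hPD⟩
      rw [add_sub_right_comm]
      exact dvd_add hkP hkD
  refine exists_C_dvd_toRat_eq_of_forall_sub_mem fun n => ?_
  obtain ⟨P, -, hkP, hP⟩ := happrox n
  exact ⟨P - v, hkP, by rwa [map_sub, sub_sub_sub_cancel_right]⟩

theorem two_dvd_sub_of_two_dvd_subst_sub_subst {u v : MvPowerSeries σ ℤ}
    (hu : MvPowerSeries.constantCoeff u = 0) (hv : MvPowerSeries.constantCoeff v = 0)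
    {D : MvPowerSeries σ ℤ} (hD : MvPowerSeries.C 2 ∣ D)
    (h : toRat D = hondaLog.subst (toRat u) - hondaLog.subst (toRat v)) :
    MvPowerSeries.C 2 ∣ u - v := by
  obtain ⟨D', hD', hD'uv⟩ := exists_toRat_eq_of_subst_sub_subst (k := 2) (constantCoeff_toRat hu)
    hv fun P hP0 hkP n _ => by
      obtain ⟨E, hE, hPE⟩ := exists_toRat_eq_subst_sub_subst hP0 hv hkP
      refine ⟨D - E, dvd_sub hD hE, ?_⟩
      rw [map_sub, h, hPE, sub_sub_sub_cancel_right, sub_self]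
      exact zero_mem _
  rw [← map_sub] at hD'uv
  rwa [← toRat_injective hD'uv]

theorem exists_toRat_eq_sub_expand_subst {P : MvPowerSeries σ ℤ}
    (hP : MvPowerSeries.constantCoeff P = 0) :
    ∃ g, toRat g = hondaLog.subst (toRat P) -
      MvPowerSeries.C (1 / 2) * (hondaLog.subst (toRat P)).expand 4 four_ne_zero := by
  obtain ⟨_, ⟨D, rfl⟩, hD⟩ := exists_toRat_eq_subst_sub_subst (u := P ^ 4)
    (v := P.expand 4 four_ne_zero) (by simp [hP]) (by simp [hP])
    (dvd_sub_comm.mp (two_dvd_expand_sub P))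
  refine ⟨P + D, ?_⟩
  rw [sub_expand_subst (constantCoeff_toRat hP), ← map_pow, ← MvPowerSeries.map_expand, ← hD,
    map_add, map_mul, MvPowerSeries.map_C, ← mul_assoc, ← map_mul]
  norm_num

theorem exists_toRat_eq_of_sub_expand_subst {u : MvPowerSeries σ ℚ}
    (hu : MvPowerSeries.constantCoeff u = 0) {g : MvPowerSeries σ ℤ}
    (hg : toRat g =
      hondaLog.subst u - MvPowerSeries.C (1 / 2) * (hondaLog.subst u).expand 4 four_ne_zero) :
    ∃ P, toRat P = u := by
  obtain ⟨P, -, hP⟩ := exists_toRat_eq_of_subst_sub_subst (k := 1) hu (map_zero _)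
    fun P hP0 _ n hP => by
      obtain ⟨gP, hgP⟩ := exists_toRat_eq_sub_expand_subst hP0
      refine ⟨g - gP, by simp, ?_⟩
      have hδ {m : ℕ} (hm : u - toRat P ∈ degIdeal σ ℚ m) :
          hondaLog.subst u - hondaLog.subst (toRat P) ∈ degIdeal σ ℚ m :=
        degIdeal.subst_sub_subst_mem (PowerSeries.HasSubst.of_constantCoeff_zero hu).const
          (hasSubst_toRat hP0).const (fun _ => hm) _
      have hδ_max : hondaLog.subst u - hondaLog.subst (toRat P) ∈ degIdeal σ ℚ (max n 1) := by
        obtain h | h := max_choice n 1 <;> rw [h]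
        · exact hδ hP
        · exact hδ (degIdeal.mem_one_iff.mpr (by simp [hu, hP0]))
      have hδ_expand := degIdeal.antitone (by omega : n + 1 ≤ 4 * max n 1)
        (expand_mem_degIdeal four_ne_zero hδ_max)
      convert Ideal.mul_mem_left _ (MvPowerSeries.C (1 / 2)) hδ_expand using 1
      rw [map_sub, hg, hgP, map_sub]
      ring
  exact ⟨P, by simpa using hP⟩

/-- An integral power series `G` in two variables satisfying `ℓ(G(x, y)) = ℓ(x) + ℓ(y)` for the
Honda logarithm `ℓ`. -/
structure IsLaw (G : MvPowerSeries (Fin 2) ℤ) : Prop where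
  constantCoeff_eq_zero : MvPowerSeries.constantCoeff G = 0
  subst_toRat_eq : hondaLog.subst (toRat G) =
    hondaLog.subst (MvPowerSeries.X 0 : MvPowerSeries (Fin 2) ℚ)
      + hondaLog.subst (MvPowerSeries.X 1 : MvPowerSeries (Fin 2) ℚ)

theorem exists_isLaw : ∃ G, IsLaw G := by
  obtain ⟨u, hu0, hu⟩ := exists_subst_eq_of_isUnit_coeff_one isUnit_coeff_one constantCoeff_eq_zero
    (s := hondaLog.subst (MvPowerSeries.X 0 : MvPowerSeries (Fin 2) ℚ)
      + hondaLog.subst (MvPowerSeries.X 1 : MvPowerSeries (Fin 2) ℚ)) <| by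
    rw [map_add, PowerSeries.constantCoeff_subst_eq_zero (by simp) _ constantCoeff_eq_zero,
      PowerSeries.constantCoeff_subst_eq_zero (by simp) _ constantCoeff_eq_zero, add_zero]
  obtain ⟨G, rfl⟩ := exists_toRat_eq_of_sub_expand_subst hu0
      (g := MvPowerSeries.X 0 + MvPowerSeries.X 1) <| by
    have hX (i : Fin 2) := sub_expand_subst (MvPowerSeries.constantCoeff_X (R := ℚ) i)
    simp only [MvPowerSeries.expand_X, sub_self, mul_zero, add_zero] at hX
    rw [hu, map_add, map_add, MvPowerSeries.map_X, MvPowerSeries.map_X]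
    linear_combination -hX 0 - hX 1
  exact ⟨G, by simpa using hu0, hu⟩

end hondaLog

/-! ### The Honda formal group law -/

section Rescale

variable {σ R S : Type*} [CommRing R] [CommRing S]

theorem map_subst_pair (f : R →+* S) (G : MvPowerSeries (Fin 2) R) {u v : MvPowerSeries σ R}
    (hu : PowerSeries.HasSubst u) (hv : PowerSeries.HasSubst v) :
    (G.subst ![u, v]).map f = (G.map f).subst ![u.map f, v.map f] := by
  rw [MvPowerSeries.map_subst (FormalGroup.hasSubst_pair hu hv)]
  congr 1
  exact funext (Fin.forall_fin_two.mpr ⟨rfl, rfl⟩)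

instance formalGroup_map_isComm (F : FormalGroup R) [F.IsComm] (f : R →+* S) :
    (F.map f).IsComm where
  comm := by
    rw [FormalGroup.map_toPowerSeries]
    nth_rw 1 [FormalGroup.IsComm.comm (F := F)]
    rw [map_subst_pair f _ (PowerSeries.HasSubst.X 1) (PowerSeries.HasSubst.X 0),
      MvPowerSeries.map_X, MvPowerSeries.map_X]

theorem map_rescale_eq_C_mul {f : R →+* S} {a : R} {G : MvPowerSeries σ R}
    (h : G.rescale (fun _ => a) = MvPowerSeries.C a * G) :
    (G.map f).rescale (fun _ => f a) = MvPowerSeries.C (f a) * G.map f := by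
  ext d
  have := congrArg (f ∘ MvPowerSeries.coeff d) h
  simpa [MvPowerSeries.coeff_rescale, Finsupp.prod, map_prod] using this

theorem rescale_eq_C_mul_of_map {f : R →+* S} (hf : Function.Injective f) {a : R}
    {G : MvPowerSeries σ R}
    (h : (G.map f).rescale (fun _ => f a) = MvPowerSeries.C (f a) * G.map f) :
    G.rescale (fun _ => a) = MvPowerSeries.C a * G := by
  ext d
  apply hf
  have := congrArg (MvPowerSeries.coeff d) h
  simpa [MvPowerSeries.coeff_rescale, Finsupp.prod, map_prod] using this

theorem subst_C_mul_of_rescale_eq {f : PowerSeries R} {a : R}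
    (h : f.rescale a = PowerSeries.C a * f) {u : MvPowerSeries σ R} (hu : PowerSeries.HasSubst u) :
    f.subst (MvPowerSeries.C a * u) = MvPowerSeries.C a * f.subst u := by
  rw [PowerSeries.rescale_eq_subst] at h
  have := congrArg (PowerSeries.subst u) h
  rwa [PowerSeries.subst_comp_subst_apply (PowerSeries.HasSubst.smul_X' a) hu,
    PowerSeries.subst_smul hu, PowerSeries.subst_X hu, PowerSeries.subst_mul hu,
    MvPowerSeries.smul_eq_C_mul, PowerSeries.subst_C] at this

theorem rescale_eq_C_mul_of_subst_eq {ℓ : PowerSeries R} (h0 : PowerSeries.constantCoeff ℓ = 0)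
    (h1 : IsUnit (PowerSeries.coeff 1 ℓ)) {a : R} (ha : ℓ.rescale a = PowerSeries.C a * ℓ)
    {G : MvPowerSeries (Fin 2) R} (hG0 : MvPowerSeries.constantCoeff G = 0)
    (hG : ℓ.subst G = ℓ.subst (MvPowerSeries.X 0 : MvPowerSeries (Fin 2) R)
      + ℓ.subst (MvPowerSeries.X 1 : MvPowerSeries (Fin 2) R)) :
    G.rescale (fun _ => a) = MvPowerSeries.C a * G := by
  have hG' := PowerSeries.HasSubst.of_constantCoeff_zero hG0
  have hs : MvPowerSeries.HasSubst ((fun _ : Fin 2 => a) • MvPowerSeries.X :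
      Fin 2 → MvPowerSeries (Fin 2) R) := MvPowerSeries.HasSubst.smul_X _
  refine subst_injOn_of_isUnit_coeff_one h1 h0 ?_ (by simp [hG0]) ?_
  · change MvPowerSeries.constantCoeff _ = 0
    rw [← MvPowerSeries.coeff_zero_eq_constantCoeff_apply, MvPowerSeries.coeff_rescale]
    simp [hG0]
  · have hsubst := congrArg (MvPowerSeries.subst ((fun _ : Fin 2 => a) • MvPowerSeries.X :
      Fin 2 → MvPowerSeries (Fin 2) R)) hG
    rw [MvPowerSeries.subst_add hs, subst_subst_X hs, subst_subst_X hs, PowerSeries.subst,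
      MvPowerSeries.subst_comp_subst_apply hG'.const hs] at hsubst
    simp only [Pi.smul_apply', MvPowerSeries.smul_eq_C_mul,
      subst_C_mul_of_rescale_eq ha (PowerSeries.HasSubst.X _)] at hsubst
    simp only [MvPowerSeries.rescale_eq_subst, subst_C_mul_of_rescale_eq ha hG', hG, mul_add]
    exact hsubst

end Rescale

namespace hondaLog

variable {τ : Type*}

theorem subst_toRat_injOn :
    Set.InjOn (fun u : MvPowerSeries τ ℤ => hondaLog.subst (toRat u))
      {u | MvPowerSeries.constantCoeff u = 0} := fun _ hu _ hv h =>
  toRat_injective <| subst_injOn_of_isUnit_coeff_one isUnit_coeff_one constantCoeff_eq_zero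
    (constantCoeff_toRat hu) (constantCoeff_toRat hv) h

theorem rescale_map {K : Type*} [CommRing K] (f : ℚ →+* K) {a : K} (ha : a ^ 4 = a) :
    (hondaLog.map f).rescale a = PowerSeries.C a * hondaLog.map f := by
  ext n
  rw [PowerSeries.coeff_rescale, PowerSeries.coeff_C_mul, PowerSeries.coeff_map]
  by_cases! hn : ∃ k, n = 4 ^ k
  · obtain ⟨k, rfl⟩ := hn
    have hak : a ^ 4 ^ k = a := by
      induction k with
      | zero => simp
      | succ k ih => rw [pow_succ, pow_mul, ih, ha]
    rw [hak]
  · rw [coeff_eq_zero hn, map_zero, mul_zero, mul_zero]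

namespace IsLaw

variable {G : MvPowerSeries (Fin 2) ℤ} (hG : IsLaw G)

include hG

theorem constantCoeff_subst_pair {u v : MvPowerSeries τ ℤ}
    (hu : MvPowerSeries.constantCoeff u = 0) (hv : MvPowerSeries.constantCoeff v = 0) :
    MvPowerSeries.constantCoeff (G.subst ![u, v]) = 0 :=
  MvPowerSeries.constantCoeff_subst_eq_zero (hasSubst_pair_of_constantCoeff_eq_zero hu hv)
    (Fin.forall_fin_two.mpr ⟨hu, hv⟩) hG.constantCoeff_eq_zero

theorem subst_toRat_subst_pair {u v : MvPowerSeries τ ℤ}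
    (hu : MvPowerSeries.constantCoeff u = 0) (hv : MvPowerSeries.constantCoeff v = 0) :
    hondaLog.subst (toRat (G.subst ![u, v])) =
      hondaLog.subst (toRat u) + hondaLog.subst (toRat v) := by
  have huv := FormalGroup.hasSubst_pair (hasSubst_toRat hu) (hasSubst_toRat hv)
  have := congrArg (MvPowerSeries.subst ![toRat u, toRat v]) hG.subst_toRat_eq
  rw [MvPowerSeries.subst_add huv, subst_subst_X huv, subst_subst_X huv, PowerSeries.subst,
    MvPowerSeries.subst_comp_subst_apply (hasSubst_toRat hG.constantCoeff_eq_zero).const huv]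
    at this
  rw [map_subst_pair _ _ (PowerSeries.HasSubst.of_constantCoeff_zero hu)
    (PowerSeries.HasSubst.of_constantCoeff_zero hv)]
  exact this

theorem coeff_single (i : Fin 2) : MvPowerSeries.coeff (Finsupp.single i 1) G = 1 := by
  have h := congrArg (MvPowerSeries.coeff (Finsupp.single i 1)) hG.subst_toRat_eq
  rw [map_add, coeff_single_subst hondaLog.constantCoeff_eq_zero
      (constantCoeff_toRat hG.constantCoeff_eq_zero),
    coeff_single_subst hondaLog.constantCoeff_eq_zero (MvPowerSeries.constantCoeff_X 0),
    coeff_single_subst hondaLog.constantCoeff_eq_zero (MvPowerSeries.constantCoeff_X 1),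
    coeff_one] at h
  apply Int.cast_injective (α := ℚ)
  fin_cases i <;> simpa [MvPowerSeries.coeff_index_single_X] using h

/-- The formal group law over the integers whose logarithm is the Honda logarithm. -/
noncomputable def formalGroup : FormalGroup ℤ where
  toPowerSeries := G
  zero_constantCoeff := hG.constantCoeff_eq_zero
  lin_coeff_X := hG.coeff_single 0
  lin_coeff_Y := hG.coeff_single 1
  assoc := by
    have hX (i : Fin 3) : MvPowerSeries.constantCoeff
        (MvPowerSeries.X i : MvPowerSeries (Fin 3) ℤ) = 0 := MvPowerSeries.constantCoeff_X i
    have h01 := hG.constantCoeff_subst_pair (hX 0) (hX 1)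
    have h12 := hG.constantCoeff_subst_pair (hX 1) (hX 2)
    refine subst_toRat_injOn (hG.constantCoeff_subst_pair h01 (hX 2))
      (hG.constantCoeff_subst_pair (hX 0) h12) ?_
    simp only [hG.subst_toRat_subst_pair h01 (hX 2), hG.subst_toRat_subst_pair (hX 0) (hX 1),
      hG.subst_toRat_subst_pair (hX 0) h12, hG.subst_toRat_subst_pair (hX 1) (hX 2), add_assoc]

instance formalGroup_isComm : hG.formalGroup.IsComm where
  comm := by
    refine subst_toRat_injOn hG.constantCoeff_eq_zero (hG.constantCoeff_subst_pair
      (MvPowerSeries.constantCoeff_X 1) (MvPowerSeries.constantCoeff_X 0)) ?_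
    simp only [formalGroup]
    rw [hG.subst_toRat_subst_pair (MvPowerSeries.constantCoeff_X 1)
      (MvPowerSeries.constantCoeff_X 0), hG.subst_toRat_eq, add_comm, MvPowerSeries.map_X,
      MvPowerSeries.map_X]

theorem rescale_map_eq_C_mul {A : Type*} [CommRing A] [IsDomain A] [CharZero A] {a : A}
    (ha : a ^ 4 = a) :
    (G.map (Int.castRingHom A)).rescale (fun _ => a) =
      MvPowerSeries.C a * G.map (Int.castRingHom A) := by
  let K := FractionRing A
  let f : ℚ →+* K := algebraMap ℚ K
  refine rescale_eq_C_mul_of_map (IsFractionRing.injective A K) ?_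
  have hmap : (G.map (Int.castRingHom A)).map (algebraMap A K) = (toRat G).map f := by
    rw [toRat, MvPowerSeries.map_map, MvPowerSeries.map_map,
      RingHom.ext_int ((algebraMap A K).comp (Int.castRingHom A)) (f.comp (Int.castRingHom ℚ))]
  have hL1 : PowerSeries.coeff 1 (hondaLog.map f) = 1 := by
    rw [PowerSeries.coeff_map, coeff_one, map_one]
  have hG0 := constantCoeff_toRat hG.constantCoeff_eq_zero
  rw [hmap]
  refine rescale_eq_C_mul_of_subst_eq (ℓ := hondaLog.map f) ?_ (hL1 ▸ isUnit_one)
    (rescale_map f (by rw [← map_pow, ha])) (by simp [hG.constantCoeff_eq_zero]) ?_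
  · exact (congrArg f hondaLog.constantCoeff_eq_zero).trans (map_zero f)
  · have := congrArg (MvPowerSeries.map f) hG.subst_toRat_eq
    rwa [map_add, PowerSeries.map_subst (PowerSeries.HasSubst.of_constantCoeff_zero hG0),
      PowerSeries.map_subst (PowerSeries.HasSubst.X 0),
      PowerSeries.map_subst (PowerSeries.HasSubst.X 1), MvPowerSeries.map_X,
      MvPowerSeries.map_X] at this

theorem two_dvd_subst_X_X_sub :
    MvPowerSeries.C 2 ∣
      (G.subst ![PowerSeries.X, PowerSeries.X] : PowerSeries ℤ) - PowerSeries.X ^ 4 := by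
  have hX : MvPowerSeries.constantCoeff (PowerSeries.X : PowerSeries ℤ) = 0 :=
    MvPowerSeries.constantCoeff_X ()
  refine two_dvd_sub_of_two_dvd_subst_sub_subst (hG.constantCoeff_subst_pair hX hX)
    (by rw [map_pow, hX, zero_pow four_ne_zero]) (Dvd.intro PowerSeries.X rfl) ?_
  rw [hG.subst_toRat_subst_pair hX hX, subst_eq (constantCoeff_toRat hX), map_mul, map_pow]
  have htwo : (MvPowerSeries.C (1 / 2 : ℚ) : MvPowerSeries Unit ℚ) * 2 = 1 := by
    rw [← map_ofNat MvPowerSeries.C 2, ← map_mul]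
    norm_num
  rw [MvPowerSeries.map_C, map_ofNat, map_ofNat]
  linear_combination -htwo * hondaLog.subst (toRat (PowerSeries.X : PowerSeries ℤ) ^ 4)

end IsLaw

end hondaLog

theorem exists_isHondaFormalGroup_ringEquiv {ζ : F4} (hζ : IsPrimitiveRoot ζ 3) :
    ∃ (F : FormalGroup F4) (_ : F.IsComm), IsHondaFormalGroup F ∧
      ∃ Φ : TwistedWitt 2 ≃+* F.Endo,
        (Φ (TwistedWitt.gen 2)).toSeries = PowerSeries.X ^ 2 ∧
        ∀ c : F4, (Φ (TwistedWitt.of 2 (WittVector.teichmuller 2 c))).toSeries =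
          PowerSeries.C c * PowerSeries.X := by
  obtain ⟨G, hG⟩ := hondaLog.exists_isLaw
  let F := hG.formalGroup.map (Int.castRingHom F4)
  have hFG : F.toPowerSeries = G.map (Int.castRingHom F4) := rfl
  have hF : F.toPowerSeries.map (_root_.frobenius F4 2) = F.toPowerSeries := by
    rw [hFG, MvPowerSeries.map_map,
      RingHom.ext_int ((_root_.frobenius F4 2).comp (Int.castRingHom F4)) (Int.castRingHom F4)]
  have hscale : F.toPowerSeries.rescale (fun _ => ζ) = MvPowerSeries.C ζ * F.toPowerSeries := by
    have hζ4 : WittVector.teichmuller 2 ζ ^ 4 = WittVector.teichmuller 2 ζ := by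
      rw [← map_pow, F4.pow_four]
    have := map_rescale_eq_C_mul (f := WittVector.constantCoeff) (hG.rescale_map_eq_C_mul hζ4)
    rwa [W4.constantCoeff_teichmuller, MvPowerSeries.map_map,
      RingHom.ext_int (WittVector.constantCoeff.comp (Int.castRingHom W4)) (Int.castRingHom F4)]
      at this
  have hX : PowerSeries.HasSubst (PowerSeries.X : PowerSeries ℤ) := PowerSeries.HasSubst.X'
  have hφ : FormalGroup.Endo.frobenius hF * FormalGroup.Endo.frobenius hF = 1 + 1 := by
    refine FormalGroup.Endo.ext ?_
    obtain ⟨e, he⟩ := hG.two_dvd_subst_X_X_sub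
    have hmap := congrArg (MvPowerSeries.map (Int.castRingHom F4)) he
    rw [map_sub, map_mul, MvPowerSeries.map_C, map_ofNat, CharTwo.two_eq_zero (R := F4), map_zero,
      zero_mul, sub_eq_zero, map_subst_pair _ _ hX hX, map_pow,
      show MvPowerSeries.map (Int.castRingHom F4) (PowerSeries.X : PowerSeries ℤ) =
        (PowerSeries.X : PowerSeries F4) from MvPowerSeries.map_X _ _] at hmap
    rw [FormalGroup.Endo.mul_frobenius_toSeries, FormalGroup.Endo.add_toSeries,
      FormalGroup.Endo.frobenius_toSeries, map_pow, PowerSeries.expand_X, ← pow_mul]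
    exact hmap.symm
  refine ⟨F, inferInstance, ⟨hG.formalGroup, hG.subst_toRat_eq, rfl⟩, ?_⟩
  refine FormalGroup.Endo.exists_twistedWitt_ringEquiv hF hζ hscale rfl ?_
  simp only [hφ, one_add_one_eq_two, Int.cast_ofNat]

/-! ### The curve `y² + y = x³` in characteristic two -/

/-- The curve `y² + y = x³`. In characteristic two it is the curve `y² - y = x³`, and over a field
its chord-and-tangent law is available from the theory of affine Weierstrass curves. -/
def supersingularCurve (K : Type*) [Field K] : WeierstrassCurve.Affine K where
  a₁ := 0
  a₂ := 0
  a₃ := 1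
  a₄ := 0
  a₆ := 0

namespace supersingularCurve

section Chord

/- Vieta's formulas for the line `w = l * z + n`: in characteristic two its intersection with the
cubic `w = z ^ 3 + w ^ 2` is `z ^ 3 + l ^ 2 * z ^ 2 + l * z + (n + n ^ 2) = 0`, whose third root is
`z₁ + z₂ + l ^ 2`. -/

variable {R : Type*} [CommRing R] [NoZeroDivisors R] [CharP R 2] {z₁ z₂ l n : R} (hz : z₁ ≠ z₂)
  (h₁ : l * z₁ + n = z₁ ^ 3 + (l * z₁ + n) ^ 2) (h₂ : l * z₂ + n = z₂ ^ 3 + (l * z₂ + n) ^ 2)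

include hz h₁ h₂

theorem slope_eq_of_chord : l = z₁ * z₂ + (z₁ + z₂ + l ^ 2) * (z₁ + z₂) := by
  have htwo : (2 : R) = 0 := CharTwo.two_eq_zero
  refine mul_left_cancel₀ (sub_ne_zero.mpr hz) ?_
  linear_combination h₁ - h₂ + (l * n - z₁ * z₂) * (z₁ - z₂) * htwo

theorem intercept_add_sq_of_chord : n + n ^ 2 = z₁ * z₂ * (z₁ + z₂ + l ^ 2) := by
  have htwo : (2 : R) = 0 := CharTwo.two_eq_zero
  linear_combination h₁ + z₁ * slope_eq_of_chord hz h₁ h₂ +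
    (n ^ 2 + z₁ ^ 3 + l ^ 2 * z₁ ^ 2 + l * z₁ * n - l * z₁ + z₁ ^ 2 * z₂) * htwo

theorem equation_third_of_chord {t : R} (ht : t = z₁ + z₂ + l ^ 2) :
    l * t + n = t ^ 3 + (l * t + n) ^ 2 := by
  have htwo : (2 : R) = 0 := CharTwo.two_eq_zero
  have hl := slope_eq_of_chord hz h₁ h₂
  have hn := intercept_add_sq_of_chord hz h₁ h₂
  rw [← ht] at hl hn
  linear_combination t ^ 2 * ht + t * hl - hn +
    (n - t ^ 3 + (z₁ + z₂) * t ^ 2 - l * n * t) * htwo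

theorem mul_mul_of_chord {t : R} (ht : t = z₁ + z₂ + l ^ 2) :
    (l * z₁ + n) * (l * z₂ + n) * (l * t + n) = n ^ 3 := by
  have htwo : (2 : R) = 0 := CharTwo.two_eq_zero
  have hl := slope_eq_of_chord hz h₁ h₂
  have hn := intercept_add_sq_of_chord hz h₁ h₂
  rw [← ht] at hl hn
  linear_combination l * n ^ 2 * ht - l ^ 2 * n * hl - l ^ 3 * hn +
    (l * n ^ 2 * (z₁ + z₂) + l ^ 3 * n + l ^ 3 * n ^ 2) * htwo

theorem sum_mul_mul_of_chord {t : R} (ht : t = z₁ + z₂ + l ^ 2) :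
    z₁ * (l * z₂ + n) * (l * t + n) + z₂ * (l * z₁ + n) * (l * t + n)
      + t * (l * z₁ + n) * (l * z₂ + n) = l ^ 2 * n := by
  have htwo : (2 : R) = 0 := CharTwo.two_eq_zero
  have hl := slope_eq_of_chord hz h₁ h₂
  have hn := intercept_add_sq_of_chord hz h₁ h₂
  rw [← ht] at hl hn
  linear_combination n ^ 2 * ht - 3 * l ^ 2 * hn +
    (n ^ 2 * (z₁ + z₂) + l * n * (z₁ * z₂ + t * (z₁ + z₂)) + l ^ 2 * n + 2 * l ^ 2 * n ^ 2) * htwo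

end Chord

variable {K : Type*} [Field K] [CharP K 2]

theorem nonsingular {z w : K} (h : w = z ^ 3 + w ^ 2) (hw : w ≠ 0) :
    (supersingularCurve K).Nonsingular (z / w) (1 / w) := by
  have htwo : (2 : K) = 0 := CharTwo.two_eq_zero
  rw [WeierstrassCurve.Affine.nonsingular_iff', WeierstrassCurve.Affine.equation_iff]
  refine ⟨?_, Or.inr ?_⟩
  · simp only [supersingularCurve]
    field_simp
    linear_combination h + w ^ 2 * htwo
  · simp [supersingularCurve, htwo]

/-- The affine point with local coordinates `z = x / y` and `w = 1 / y` at the origin. -/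
def point (z w : K) (h : w = z ^ 3 + w ^ 2) (hw : w ≠ 0) : (supersingularCurve K).Point :=
  .some _ _ (nonsingular h hw)

theorem eq_of_point_eq {z w z' w' : K} {h : w = z ^ 3 + w ^ 2} {hw : w ≠ 0}
    {h' : w' = z' ^ 3 + w' ^ 2} {hw' : w' ≠ 0} (e : point z w h hw = point z' w' h' hw') :
    z = z' := by
  obtain ⟨hx, hy⟩ := WeierstrassCurve.Affine.Point.some.inj e
  obtain rfl : w = w' := by simpa using hy
  exact (div_left_inj' hw).mp hx

section Addition

variable {z₁ z₂ l n t : K}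

theorem slope_eq_div [DecidableEq K] (hn : n ≠ 0) (hw₁ : l * z₁ + n ≠ 0) (hw₂ : l * z₂ + n ≠ 0)
    (hx : z₁ / (l * z₁ + n) ≠ z₂ / (l * z₂ + n)) :
    (supersingularCurve K).slope (z₁ / (l * z₁ + n)) (z₂ / (l * z₂ + n))
      (1 / (l * z₁ + n)) (1 / (l * z₂ + n)) = l / n := by
  have htwo : (2 : K) = 0 := CharTwo.two_eq_zero
  rw [WeierstrassCurve.Affine.slope_of_X_ne hx, div_eq_div_iff (sub_ne_zero.mpr hx) hn]
  field_simp
  linear_combination n * l * (z₂ - z₁) * htwo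

variable (hz : z₁ ≠ z₂) (hn : n ≠ 0) (h₁ : l * z₁ + n = z₁ ^ 3 + (l * z₁ + n) ^ 2)
  (h₂ : l * z₂ + n = z₂ ^ 3 + (l * z₂ + n) ^ 2) (hw₁ : l * z₁ + n ≠ 0) (hw₂ : l * z₂ + n ≠ 0)
  (ht : t = z₁ + z₂ + l ^ 2) (hwt : l * t + n ≠ 0)

include hz hn h₁ h₂ hw₁ hw₂ ht hwt

theorem addX_eq_div :
    (supersingularCurve K).addX (z₁ / (l * z₁ + n)) (z₂ / (l * z₂ + n)) (l / n) =
      t / (l * t + n) := by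
  simp only [WeierstrassCurve.Affine.addX, supersingularCurve]
  field_simp
  linear_combination -n ^ 2 * sum_mul_mul_of_chord hz h₁ h₂ ht +
    l ^ 2 * mul_mul_of_chord hz h₁ h₂ ht

theorem negAddY_eq_div :
    (supersingularCurve K).negAddY (z₁ / (l * z₁ + n)) (z₂ / (l * z₂ + n)) (1 / (l * z₁ + n))
      (l / n) = 1 / (l * t + n) := by
  have htwo : (2 : K) = 0 := CharTwo.two_eq_zero
  rw [WeierstrassCurve.Affine.negAddY, addX_eq_div hz hn h₁ h₂ hw₁ hw₂ ht hwt]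
  field_simp
  linear_combination (l * t * n - l * z₁ * n) * htwo

end Addition

theorem point_add_point [DecidableEq K] {z₁ w₁ z₂ w₂ l n t u v : K}
    {h₁ : w₁ = z₁ ^ 3 + w₁ ^ 2} {hw₁ : w₁ ≠ 0} {h₂ : w₂ = z₂ ^ 3 + w₂ ^ 2} {hw₂ : w₂ ≠ 0}
    {h : v = u ^ 3 + v ^ 2} {hv : v ≠ 0} (hl₁ : w₁ = l * z₁ + n) (hl₂ : w₂ = l * z₂ + n)
    (hx : z₁ * w₂ ≠ z₂ * w₁) (ht : t = z₁ + z₂ + l ^ 2) (htu : u * (1 + (l * t + n)) = t)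
    (htv : v * (1 + (l * t + n)) = l * t + n) :
    point z₁ w₁ h₁ hw₁ + point z₂ w₂ h₂ hw₂ = point u v h hv := by
  have htwo : (2 : K) = 0 := CharTwo.two_eq_zero
  subst hl₁ hl₂
  have hz : z₁ ≠ z₂ := fun e => hx (by rw [e])
  have hn : n ≠ 0 := fun e => hx (by rw [e]; ring)
  have hwt : l * t + n ≠ 0 := fun e => hv (by rwa [e, add_zero, mul_one] at htv)
  have hX : z₁ / (l * z₁ + n) ≠ z₂ / (l * z₂ + n) := by rwa [Ne, div_eq_div_iff hw₁ hw₂]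
  have hux : u / v = t / (l * t + n) := by
    rw [div_eq_div_iff hv hwt]
    linear_combination v * htu - u * htv
  have hvy : 1 / v = 1 / (l * t + n) + 1 := by
    field_simp
    linear_combination -htv
  simp only [point]
  rw [WeierstrassCurve.Affine.Point.add_of_X_ne hX, WeierstrassCurve.Affine.Point.some.injEq,
    slope_eq_div hn hw₁ hw₂ hX, WeierstrassCurve.Affine.addY,
    negAddY_eq_div hz hn h₁ h₂ hw₁ hw₂ ht hwt, addX_eq_div hz hn h₁ h₂ hw₁ hw₂ ht hwt, hux, hvy]
  refine ⟨rfl, ?_⟩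
  simp only [WeierstrassCurve.Affine.negY, supersingularCurve]
  linear_combination (-1 / (l * t + n) - 1) * htwo

end supersingularCurve

/-! ### The formal group law of the curve `y² - y = x³` -/

namespace curveC

variable {τ : Type*} {u v : MvPowerSeries τ F4}

theorem wSeries_eq_add : curveC.wSeries = PowerSeries.X ^ 3 + curveC.wSeries ^ 2 := by
  simpa only [curveC, CharTwo.neg_eq, map_zero, map_one, zero_mul, one_mul, add_zero]
    using curveC.wSeries_eq

theorem constantCoeff_wSeries : PowerSeries.constantCoeff curveC.wSeries = 0 :=
  PowerSeries.X_dvd_iff.mp curveC.X_dvd_wSeries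

theorem coeff_one_wSeries : PowerSeries.coeff 1 curveC.wSeries = 0 := by
  have h : PowerSeries.X ^ 2 ∣ curveC.wSeries := by
    rw [wSeries_eq_add]
    exact dvd_add (pow_dvd_pow _ (Nat.le_succ 2)) (pow_dvd_pow_of_dvd curveC.X_dvd_wSeries 2)
  exact PowerSeries.X_pow_dvd_iff.mp h 1 one_lt_two

theorem constantCoeff_wSeries_subst (hu : MvPowerSeries.constantCoeff u = 0) :
    MvPowerSeries.constantCoeff (curveC.wSeries.subst u) = 0 :=
  PowerSeries.constantCoeff_subst_eq_zero hu _ constantCoeff_wSeries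

theorem wSeries_subst_eq_add (hu : MvPowerSeries.constantCoeff u = 0) :
    curveC.wSeries.subst u = u ^ 3 + curveC.wSeries.subst u ^ 2 := by
  have hu' := PowerSeries.HasSubst.of_constantCoeff_zero hu
  have h := congrArg (PowerSeries.subst u) wSeries_eq_add
  rwa [PowerSeries.subst_add hu', PowerSeries.subst_pow hu', PowerSeries.subst_pow hu',
    PowerSeries.subst_X hu'] at h

theorem isUnit_one_add_wSeries_subst (hu : MvPowerSeries.constantCoeff u = 0) :
    IsUnit (1 + curveC.wSeries.subst u) := by
  rw [MvPowerSeries.isUnit_iff_constantCoeff, map_add, map_one, constantCoeff_wSeries_subst hu,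
    add_zero]
  exact isUnit_one

theorem eq_wSeries_subst (hu : MvPowerSeries.constantCoeff u = 0)
    (hv : MvPowerSeries.constantCoeff v = 0) (h : v = u ^ 3 + v ^ 2) :
    v = curveC.wSeries.subst u := by
  have hw := wSeries_subst_eq_add hu
  have hw0 := constantCoeff_wSeries_subst hu
  generalize curveC.wSeries.subst u = w at *
  have hunit : IsUnit (1 - (v + w)) := by
    rw [MvPowerSeries.isUnit_iff_constantCoeff, map_sub, map_one, map_add, hv, hw0, add_zero,
      sub_zero]
    exact isUnit_one
  have hmul : (1 - (v + w)) * (v - w) = 0 := by linear_combination h - hw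
  exact sub_eq_zero.mp (hunit.mul_right_eq_zero.mp hmul)

theorem wSeries_subst_ne_zero (hu : MvPowerSeries.constantCoeff u = 0) (hu0 : u ≠ 0) :
    curveC.wSeries.subst u ≠ 0 := fun hw => by
  have h := wSeries_subst_eq_add hu
  rw [hw, zero_pow two_ne_zero, add_zero] at h
  exact pow_ne_zero 3 hu0 h.symm

section Neg

theorem negSeries_mul : curveC.negSeries * (1 + curveC.wSeries) = PowerSeries.X := by
  have h : 1 - PowerSeries.C curveC.a₁ * PowerSeries.X - PowerSeries.C curveC.a₃ * curveC.wSeries =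
      1 + curveC.wSeries := by
    rw [show curveC.a₁ = 0 from rfl, show curveC.a₃ = -1 from rfl]
    simp
  rw [WeierstrassCurve.negSeries, h, mul_assoc, mul_comm (PowerSeries.invOfUnit _ _),
    PowerSeries.mul_invOfUnit _ _ (by simp [constantCoeff_wSeries]), mul_one, CharTwo.neg_eq]

theorem constantCoeff_negSeries : PowerSeries.constantCoeff curveC.negSeries = 0 := by
  simpa [constantCoeff_wSeries] using congrArg PowerSeries.constantCoeff negSeries_mul

theorem coeff_one_negSeries : PowerSeries.coeff 1 curveC.negSeries = 1 := by
  have h := congrArg (PowerSeries.coeff 1) negSeries_mul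
  have hmul : PowerSeries.coeff 1 (curveC.negSeries * curveC.wSeries) = 0 :=
    degIdeal.coeff_single_mul_eq_zero constantCoeff_negSeries constantCoeff_wSeries ()
  rwa [mul_add, mul_one, map_add, hmul, add_zero, PowerSeries.coeff_one_X] at h

variable (hu : MvPowerSeries.constantCoeff u = 0)

include hu

theorem constantCoeff_negSeries_subst :
    MvPowerSeries.constantCoeff (curveC.negSeries.subst u) = 0 :=
  PowerSeries.constantCoeff_subst_eq_zero hu _ constantCoeff_negSeries

theorem negSeries_subst_mul : curveC.negSeries.subst u * (1 + curveC.wSeries.subst u) = u := by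
  have hu' := PowerSeries.HasSubst.of_constantCoeff_zero hu
  have h := congrArg (PowerSeries.subst u) negSeries_mul
  rw [PowerSeries.subst_mul hu', PowerSeries.subst_add hu', PowerSeries.subst_X hu'] at h
  rwa [← PowerSeries.coe_substAlgHom hu', map_one, PowerSeries.coe_substAlgHom hu'] at h

theorem wSeries_subst_negSeries_mul :
    curveC.wSeries.subst (curveC.negSeries.subst u) * (1 + curveC.wSeries.subst u) =
      curveC.wSeries.subst u := by
  have htwo : (2 : MvPowerSeries τ F4) = 0 := CharTwo.two_eq_zero
  have hn := negSeries_subst_mul hu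
  have hn0 := constantCoeff_negSeries_subst hu
  have hw := wSeries_subst_eq_add hu
  have hw0 := constantCoeff_wSeries_subst hu
  obtain ⟨i, hi⟩ := (isUnit_one_add_wSeries_subst hu).exists_right_inv
  generalize curveC.wSeries.subst u = w at *
  generalize curveC.negSeries.subst u = n at *
  have hni : n = u * i := by linear_combination i * hn - n * hi
  have hcube : u ^ 3 = w * (1 + w) := by linear_combination -hw - w ^ 2 * htwo
  have hwi : w * i = curveC.wSeries.subst n := by
    refine eq_wSeries_subst hn0 (by rw [map_mul, hw0, zero_mul]) ?_
    rw [hni, mul_pow, hcube]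
    linear_combination (-w * i ^ 2 - w * i) * hi
  rw [← hwi]
  linear_combination w * hi

end Neg

/-! ### Chords of the curve -/

/-- The slope of the line `w = l * z + n` through the points with parameters `u` and `v`. -/
noncomputable def slopeAt (u v : MvPowerSeries τ F4) : MvPowerSeries τ F4 :=
  curveC.slopeSeries.subst ![u, v]

/-- The intercept of the line `w = l * z + n` through the points with parameters `u` and `v`. -/
noncomputable def interceptAt (u v : MvPowerSeries τ F4) : MvPowerSeries τ F4 :=
  curveC.wSeries.subst u - slopeAt u v * u

/-- The parameter of the third point on the line through the points with parameters `u` and `v`. -/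
noncomputable def thirdAt (u v : MvPowerSeries τ F4) : MvPowerSeries τ F4 :=
  u + v + slopeAt u v ^ 2

theorem slopeSeries_eq_dividedDifference : curveC.slopeSeries = dividedDifference curveC.wSeries :=
  rfl

theorem thirdPointSeries_eq_add : curveC.thirdPointSeries =
    MvPowerSeries.X 0 + MvPowerSeries.X 1 + curveC.slopeSeries ^ 2 := by
  have hinv : MvPowerSeries.invOfUnit (1 : MvPowerSeries (Fin 2) F4) 1 = 1 := by
    simpa only [one_mul] using
      MvPowerSeries.mul_invOfUnit (1 : MvPowerSeries (Fin 2) F4) 1 (by simp)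
  rw [WeierstrassCurve.thirdPointSeries]
  generalize curveC.slopeSeries = l
  simp only [curveC, map_zero, zero_mul, mul_zero, add_zero, zero_add, hinv, mul_one,
    CharTwo.neg_eq, CharTwo.sub_eq_add, map_one, one_mul]

section Pair

variable (hu : MvPowerSeries.constantCoeff u = 0) (hv : MvPowerSeries.constantCoeff v = 0)

include hu hv

theorem constantCoeff_slopeAt : MvPowerSeries.constantCoeff (slopeAt u v) = 0 := by
  rw [slopeAt, slopeSeries_eq_dividedDifference,
    constantCoeff_dividedDifference_subst _ hu hv, coeff_one_wSeries]

theorem constantCoeff_thirdAt : MvPowerSeries.constantCoeff (thirdAt u v) = 0 := by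
  simp [thirdAt, hu, hv, constantCoeff_slopeAt hu hv]

theorem thirdPointSeries_subst : curveC.thirdPointSeries.subst ![u, v] = thirdAt u v := by
  have huv := hasSubst_pair_of_constantCoeff_eq_zero hu hv
  rw [thirdPointSeries_eq_add, MvPowerSeries.subst_add huv, MvPowerSeries.subst_add huv,
    MvPowerSeries.subst_pow huv, MvPowerSeries.subst_X huv, MvPowerSeries.subst_X huv]
  rfl

theorem slopeAt_mul_sub :
    slopeAt u v * (v - u) = curveC.wSeries.subst v - curveC.wSeries.subst u :=
  dividedDifference_subst_mul _ (PowerSeries.HasSubst.of_constantCoeff_zero hu)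
    (PowerSeries.HasSubst.of_constantCoeff_zero hv)

omit hu hv in
theorem slopeAt_mul_left_add_interceptAt :
    slopeAt u v * u + interceptAt u v = curveC.wSeries.subst u :=
  add_sub_cancel _ _

theorem slopeAt_mul_right_add_interceptAt :
    slopeAt u v * v + interceptAt u v = curveC.wSeries.subst v := by
  rw [interceptAt]
  linear_combination slopeAt_mul_sub hu hv

theorem slopeAt_eq_of_ne (huv : u ≠ v) : slopeAt u v = u * v + thirdAt u v * (u + v) := by
  refine supersingularCurve.slope_eq_of_chord (n := interceptAt u v) huv ?_ ?_
  · rw [slopeAt_mul_left_add_interceptAt]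
    exact wSeries_subst_eq_add hu
  · rw [slopeAt_mul_right_add_interceptAt hu hv]
    exact wSeries_subst_eq_add hv

theorem wSeries_subst_thirdAt (huv : u ≠ v) :
    curveC.wSeries.subst (thirdAt u v) = slopeAt u v * thirdAt u v + interceptAt u v := by
  refine (eq_wSeries_subst (constantCoeff_thirdAt hu hv) ?_ ?_).symm
  · simp [interceptAt, constantCoeff_wSeries_subst hu, constantCoeff_slopeAt hu hv]
  · refine supersingularCurve.equation_third_of_chord huv ?_ ?_ rfl
    · rw [slopeAt_mul_left_add_interceptAt]
      exact wSeries_subst_eq_add hu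
    · rw [slopeAt_mul_right_add_interceptAt hu hv]
      exact wSeries_subst_eq_add hv

theorem slopeAt_comm (huv : u ≠ v) : slopeAt v u = slopeAt u v := by
  refine mul_right_cancel₀ (sub_ne_zero.mpr huv.symm) ?_
  linear_combination -slopeAt_mul_sub hv hu - slopeAt_mul_sub hu hv

end Pair

theorem slopeAt_X_X : slopeAt (MvPowerSeries.X 0) (MvPowerSeries.X 1) = curveC.slopeSeries := by
  rw [slopeAt, vecCons_X_X, MvPowerSeries.subst_self, id]

theorem thirdAt_X_X : thirdAt (MvPowerSeries.X 0) (MvPowerSeries.X 1) =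
    curveC.thirdPointSeries := by
  rw [thirdAt, slopeAt_X_X, thirdPointSeries_eq_add]

theorem constantCoeff_thirdPointSeries :
    MvPowerSeries.constantCoeff curveC.thirdPointSeries = 0 := by
  rw [← thirdAt_X_X]
  exact constantCoeff_thirdAt (MvPowerSeries.constantCoeff_X 0) (MvPowerSeries.constantCoeff_X 1)

/- For `u = v` this describes the tangent at the point with parameter `u`; it is obtained from the
universal pair `X 0 ≠ X 1` by substitution. -/
theorem slopeAt_eq (hu : MvPowerSeries.constantCoeff u = 0)
    (hv : MvPowerSeries.constantCoeff v = 0) : slopeAt u v = u * v + thirdAt u v * (u + v) := by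
  have huv := hasSubst_pair_of_constantCoeff_eq_zero hu hv
  have h := slopeAt_eq_of_ne (MvPowerSeries.constantCoeff_X (R := F4) (0 : Fin 2))
    (MvPowerSeries.constantCoeff_X 1) (MvPowerSeries.X_inj.not.mpr zero_ne_one)
  rw [slopeAt_X_X, thirdAt_X_X] at h
  have h := congrArg (MvPowerSeries.subst ![u, v]) h
  rwa [MvPowerSeries.subst_add huv, MvPowerSeries.subst_mul huv, MvPowerSeries.subst_mul huv,
    MvPowerSeries.subst_add huv, MvPowerSeries.subst_X huv, MvPowerSeries.subst_X huv,
    thirdPointSeries_subst hu hv] at h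

theorem thirdAt_self (hu : MvPowerSeries.constantCoeff u = 0) : thirdAt u u = u ^ 4 := by
  rw [thirdAt, slopeAt_eq hu hu, CharTwo.add_self_eq_zero]
  ring

theorem thirdAt_negSeries_subst (hu : MvPowerSeries.constantCoeff u = 0) (hu0 : u ≠ 0) :
    thirdAt u (curveC.negSeries.subst u) = 0 := by
  have htwo : (2 : MvPowerSeries τ F4) = 0 := CharTwo.two_eq_zero
  have hl := slopeAt_mul_sub hu (constantCoeff_negSeries_subst hu)
  have hw := wSeries_subst_eq_add hu
  have hw0 := wSeries_subst_ne_zero hu hu0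
  have hn := negSeries_subst_mul hu
  have hwn := wSeries_subst_negSeries_mul hu
  have hs := (isUnit_one_add_wSeries_subst hu).ne_zero
  rw [thirdAt]
  generalize slopeAt u (curveC.negSeries.subst u) = l at *
  generalize curveC.wSeries.subst (curveC.negSeries.subst u) = w' at *
  generalize curveC.wSeries.subst u = w at *
  generalize curveC.negSeries.subst u = n at *
  have hlu : l * u = w := by
    refine mul_right_cancel₀ hw0 ?_
    linear_combination -(1 + w) * hl + l * hn - hwn
  refine mul_right_cancel₀ (mul_ne_zero (pow_ne_zero 2 hu0) hs) ?_
  linear_combination u ^ 2 * hn + (1 + w) * (l * u + w) * hlu - w * hw + (w ^ 2 + u ^ 3) * htwo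

section Law

variable {τ : Type*} {u v : MvPowerSeries τ F4} (hu : MvPowerSeries.constantCoeff u = 0)
  (hv : MvPowerSeries.constantCoeff v = 0)

include hu hv

theorem formalGroupSeries_subst :
    curveC.formalGroupSeries.subst ![u, v] = curveC.negSeries.subst (thirdAt u v) := by
  rw [WeierstrassCurve.formalGroupSeries, PowerSeries.subst, MvPowerSeries.subst_comp_subst_apply
    (PowerSeries.HasSubst.of_constantCoeff_zero constantCoeff_thirdPointSeries).const
    (hasSubst_pair_of_constantCoeff_eq_zero hu hv), thirdPointSeries_subst hu hv]
  rfl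

theorem constantCoeff_formalGroupSeries_subst :
    MvPowerSeries.constantCoeff (curveC.formalGroupSeries.subst ![u, v]) = 0 := by
  rw [formalGroupSeries_subst hu hv]
  exact constantCoeff_negSeries_subst (constantCoeff_thirdAt hu hv)

theorem coeff_single_formalGroupSeries_subst (i : τ) :
    MvPowerSeries.coeff (Finsupp.single i 1) (curveC.formalGroupSeries.subst ![u, v]) =
      MvPowerSeries.coeff (Finsupp.single i 1) u + MvPowerSeries.coeff (Finsupp.single i 1) v := by
  have hl := constantCoeff_slopeAt hu hv
  rw [formalGroupSeries_subst hu hv, coeff_single_subst constantCoeff_negSeries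
    (constantCoeff_thirdAt hu hv), coeff_one_negSeries, one_mul, thirdAt, map_add, map_add, sq,
    degIdeal.coeff_single_mul_eq_zero hl hl, add_zero]

omit hv in
theorem formalGroupSeries_subst_negSeries (hu0 : u ≠ 0) :
    curveC.formalGroupSeries.subst ![u, curveC.negSeries.subst u] = 0 := by
  rw [formalGroupSeries_subst hu (constantCoeff_negSeries_subst hu),
    thirdAt_negSeries_subst hu hu0,
    PowerSeries.subst_zero_of_constantCoeff_zero constantCoeff_negSeries]

end Law

/-! ### Associativity, from the group law on the points of the curve -/

section Assoc

instance isDomain_mvPowerSeries {τ : Type*} : IsDomain (MvPowerSeries τ F4) :=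
  NoZeroDivisors.to_isDomain _

variable {τ : Type*} {u v : MvPowerSeries τ F4}

/-- The linear part of a power series, as the family of its coefficients. -/
noncomputable def linearPart (u : MvPowerSeries τ F4) (i : τ) : F4 :=
  MvPowerSeries.coeff (Finsupp.single i 1) u

theorem linearPart_X [DecidableEq τ] (i : τ) :
    linearPart (MvPowerSeries.X i) = Pi.single i 1 := by
  funext j
  rw [linearPart, MvPowerSeries.coeff_index_single_X, Pi.single_apply]

theorem ne_zero_of_linearPart_ne_zero (h : linearPart u ≠ 0) : u ≠ 0 := by
  rintro rfl
  exact h (funext fun i => map_zero _)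

/-- The point with parameter `u` of the curve over the field of fractions of the ring of power
series. -/
noncomputable def pointAt (u : MvPowerSeries τ F4) (hu : MvPowerSeries.constantCoeff u = 0)
    (hu0 : u ≠ 0) : (supersingularCurve (FractionRing (MvPowerSeries τ F4))).Point :=
  supersingularCurve.point (algebraMap _ _ u) (algebraMap _ _ (curveC.wSeries.subst u))
    (by rw [← map_pow, ← map_pow, ← map_add, ← wSeries_subst_eq_add hu])
    (by
      rw [Ne, FaithfulSMul.algebraMap_eq_zero_iff]
      exact wSeries_subst_ne_zero hu hu0)

theorem eq_of_pointAt_eq {hu : MvPowerSeries.constantCoeff u = 0} {hu0 : u ≠ 0}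
    {hv : MvPowerSeries.constantCoeff v = 0} {hv0 : v ≠ 0}
    (h : pointAt u hu hu0 = pointAt v hv hv0) : u = v :=
  FaithfulSMul.algebraMap_injective _ (FractionRing (MvPowerSeries τ F4))
    (supersingularCurve.eq_of_point_eq h)

variable (hu : MvPowerSeries.constantCoeff u = 0) (hv : MvPowerSeries.constantCoeff v = 0)

include hu hv

theorem linearPart_formalGroupSeries_subst :
    linearPart (curveC.formalGroupSeries.subst ![u, v]) = linearPart u + linearPart v :=
  funext (coeff_single_formalGroupSeries_subst hu hv)

theorem formalGroupSeries_subst_ne_zero (huv : linearPart u ≠ linearPart v) :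
    curveC.formalGroupSeries.subst ![u, v] ≠ 0 := by
  refine ne_zero_of_linearPart_ne_zero ?_
  rw [linearPart_formalGroupSeries_subst hu hv]
  exact fun h => huv (funext fun i => CharTwo.add_eq_zero.mp (congrFun h i))

/- The abscissas `u / w(u)` and `v / w(v)` agree only if the points are equal or opposite, that is,
if `u = v` or `u = v * (1 + w(u))`. -/
theorem mul_wSeries_subst_ne (hu0 : u ≠ 0) (hv0 : v ≠ 0) (huv : linearPart u ≠ linearPart v) :
    u * curveC.wSeries.subst v ≠ v * curveC.wSeries.subst u := by
  have htwo : (2 : MvPowerSeries τ F4) = 0 := CharTwo.two_eq_zero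
  have hwu := wSeries_subst_eq_add hu
  have hwv := wSeries_subst_eq_add hv
  have hwu0 := wSeries_subst_ne_zero hu hu0
  have hwv0 := wSeries_subst_ne_zero hv hv0
  have hc := constantCoeff_wSeries_subst hu
  intro h
  generalize curveC.wSeries.subst u = w₁ at *
  generalize curveC.wSeries.subst v = w₂ at *
  have hprod : w₁ * w₂ * ((w₁ + w₂) * (w₁ + w₂ + w₁ * w₂)) = 0 := by
    have hcube : (u * w₂) ^ 3 = (v * w₁) ^ 3 := by rw [h]
    linear_combination hcube + w₂ ^ 3 * hwu - w₁ ^ 3 * hwv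
      + (w₁ ^ 3 * w₂ + w₁ ^ 2 * w₂ ^ 2 + w₁ ^ 2 * w₂ ^ 3) * htwo
  obtain heq | hopp :=
    mul_eq_zero.mp ((mul_eq_zero.mp hprod).resolve_left (mul_ne_zero hwu0 hwv0))
  · rw [CharTwo.add_eq_zero.mp heq] at h
    exact huv (by rw [mul_right_cancel₀ hwv0 h])
  · have huv' : u = v + v * w₁ := by
      refine mul_right_cancel₀ hwv0 ?_
      linear_combination h + v * hopp - v * (w₂ + w₁ * w₂) * htwo
    refine huv (funext fun i => ?_)
    rw [linearPart, linearPart, huv', map_add, degIdeal.coeff_single_mul_eq_zero hv hc, add_zero]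

theorem pointAt_add_pointAt [DecidableEq (FractionRing (MvPowerSeries τ F4))] (hu0 : u ≠ 0)
    (hv0 : v ≠ 0) (huv : linearPart u ≠ linearPart v) :
    pointAt u hu hu0 + pointAt v hv hv0 =
      pointAt (curveC.formalGroupSeries.subst ![u, v])
        (constantCoeff_formalGroupSeries_subst hu hv)
        (formalGroupSeries_subst_ne_zero hu hv huv) := by
  let f := algebraMap (MvPowerSeries τ F4) (FractionRing (MvPowerSeries τ F4))
  have hf : Function.Injective f := FaithfulSMul.algebraMap_injective _ _
  have ht0 := constantCoeff_thirdAt hu hv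
  have hwt := wSeries_subst_thirdAt hu hv fun h => huv (by rw [h])
  have htu := negSeries_subst_mul ht0
  have htv := wSeries_subst_negSeries_mul ht0
  rw [← formalGroupSeries_subst hu hv, hwt] at htu htv
  refine supersingularCurve.point_add_point (l := f (slopeAt u v)) (n := f (interceptAt u v))
    (t := f (thirdAt u v)) ?_ ?_ ?_ ?_ ?_ ?_
  · rw [← slopeAt_mul_left_add_interceptAt, map_add, map_mul]
  · rw [← slopeAt_mul_right_add_interceptAt hu hv, map_add, map_mul]
  · rw [← map_mul, ← map_mul]
    exact hf.ne (mul_wSeries_subst_ne hu hv hu0 hv0 huv)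
  · rw [thirdAt, map_add, map_add, map_pow]
  · rw [← map_mul, ← map_add, ← map_one f, ← map_add, ← map_mul, htu]
  · rw [← map_mul f (slopeAt u v), ← map_add f (_ * _), ← map_one f, ← map_add, ← map_mul, htv]

end Assoc

theorem formalGroupSeries_assoc : curveC.formalGroupSeries.subst
    ![curveC.formalGroupSeries.subst ![MvPowerSeries.X 0, MvPowerSeries.X 1],
      (MvPowerSeries.X 2 : MvPowerSeries (Fin 3) F4)] =
    curveC.formalGroupSeries.subst
      ![(MvPowerSeries.X 0 : MvPowerSeries (Fin 3) F4),
        curveC.formalGroupSeries.subst ![MvPowerSeries.X 1, MvPowerSeries.X 2]] := by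
  classical
  have hX (i : Fin 3) : MvPowerSeries.constantCoeff
      (MvPowerSeries.X i : MvPowerSeries (Fin 3) F4) = 0 := MvPowerSeries.constantCoeff_X i
  have hX0 (i : Fin 3) : (MvPowerSeries.X i : MvPowerSeries (Fin 3) F4) ≠ 0 :=
    ne_zero_of_linearPart_ne_zero <| by
      rw [linearPart_X]
      exact Pi.single_ne_zero_iff.mpr one_ne_zero
  have h01 : linearPart (MvPowerSeries.X (0 : Fin 3)) ≠ linearPart (MvPowerSeries.X 1) := by
    simp [linearPart_X, funext_iff, Fin.forall_fin_succ]
  have h12 : linearPart (MvPowerSeries.X (1 : Fin 3)) ≠ linearPart (MvPowerSeries.X 2) := by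
    simp [linearPart_X, funext_iff, Fin.forall_fin_succ]
  have h01_2 : linearPart (curveC.formalGroupSeries.subst
      ![MvPowerSeries.X (0 : Fin 3), MvPowerSeries.X 1]) ≠ linearPart (MvPowerSeries.X 2) := by
    rw [linearPart_formalGroupSeries_subst (hX 0) (hX 1)]
    simp [linearPart_X, funext_iff, Fin.forall_fin_succ]
  have h0_12 : linearPart (MvPowerSeries.X (0 : Fin 3)) ≠ linearPart
      (curveC.formalGroupSeries.subst ![MvPowerSeries.X 1, MvPowerSeries.X 2]) := by
    rw [linearPart_formalGroupSeries_subst (hX 1) (hX 2)]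
    simp [linearPart_X, funext_iff, Fin.forall_fin_succ]
  have h := add_assoc (pointAt _ (hX 0) (hX0 0)) (pointAt _ (hX 1) (hX0 1))
    (pointAt _ (hX 2) (hX0 2))
  rw [pointAt_add_pointAt _ _ _ _ h01, pointAt_add_pointAt _ _ _ _ h12,
    pointAt_add_pointAt _ _ _ _ h01_2, pointAt_add_pointAt _ _ _ _ h0_12] at h
  exact eq_of_pointAt_eq h

/-- The formal group law of the curve `y² - y = x³`. -/
noncomputable def formalGroup : FormalGroup F4 where
  toPowerSeries := curveC.formalGroupSeries
  zero_constantCoeff := by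
    simpa only [vecCons_X_X, MvPowerSeries.subst_self, id] using
      constantCoeff_formalGroupSeries_subst (MvPowerSeries.constantCoeff_X (R := F4) (0 : Fin 2))
        (MvPowerSeries.constantCoeff_X 1)
  lin_coeff_X := by
    simpa [vecCons_X_X, MvPowerSeries.subst_self, MvPowerSeries.coeff_index_single_X] using
      coeff_single_formalGroupSeries_subst (MvPowerSeries.constantCoeff_X (R := F4) (0 : Fin 2))
        (MvPowerSeries.constantCoeff_X 1) 0
  lin_coeff_Y := by
    simpa [vecCons_X_X, MvPowerSeries.subst_self, MvPowerSeries.coeff_index_single_X] using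
      coeff_single_formalGroupSeries_subst (MvPowerSeries.constantCoeff_X (R := F4) (0 : Fin 2))
        (MvPowerSeries.constantCoeff_X 1) 1
  assoc := formalGroupSeries_assoc

instance formalGroup_isComm : formalGroup.IsComm where
  comm := by
    have h0 := MvPowerSeries.constantCoeff_X (R := F4) (0 : Fin 2)
    have h1 := MvPowerSeries.constantCoeff_X (R := F4) (1 : Fin 2)
    change curveC.formalGroupSeries = curveC.formalGroupSeries.subst _
    rw [formalGroupSeries_subst h1 h0, thirdAt, add_comm (MvPowerSeries.X 1),
      slopeAt_comm h0 h1 (MvPowerSeries.X_inj.not.mpr zero_ne_one), ← thirdAt, thirdAt_X_X]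
    rfl

section FrobeniusInvariance

theorem map_frobenius_wSeries : curveC.wSeries.map (_root_.frobenius F4 2) = curveC.wSeries := by
  have h := eq_wSeries_subst (u := (PowerSeries.X : PowerSeries F4))
    (v := curveC.wSeries.map (_root_.frobenius F4 2)) (MvPowerSeries.constantCoeff_X ())
    (by
      change PowerSeries.constantCoeff _ = 0
      rw [← PowerSeries.coeff_zero_eq_constantCoeff_apply, PowerSeries.coeff_map,
        PowerSeries.coeff_zero_eq_constantCoeff_apply, constantCoeff_wSeries, map_zero])
    (by
      nth_rw 1 [wSeries_eq_add]
      rw [map_add, map_pow, map_pow, PowerSeries.map_X])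
  rw [h]
  exact PowerSeries.X_subst _

theorem map_frobenius_slopeSeries :
    curveC.slopeSeries.map (_root_.frobenius F4 2) = curveC.slopeSeries := by
  ext d
  rw [slopeSeries_eq_dividedDifference, MvPowerSeries.coeff_map, coeff_dividedDifference]
  nth_rw 2 [← map_frobenius_wSeries]
  rw [PowerSeries.coeff_map]

theorem map_frobenius_thirdPointSeries :
    curveC.thirdPointSeries.map (_root_.frobenius F4 2) = curveC.thirdPointSeries := by
  rw [thirdPointSeries_eq_add, map_add, map_add, map_pow, map_frobenius_slopeSeries,
    MvPowerSeries.map_X, MvPowerSeries.map_X]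

theorem isUnit_one_add_wSeries : IsUnit (1 + curveC.wSeries) := by
  rw [PowerSeries.isUnit_iff_constantCoeff, map_add, map_one, constantCoeff_wSeries, add_zero]
  exact isUnit_one

theorem map_frobenius_negSeries :
    curveC.negSeries.map (_root_.frobenius F4 2) = curveC.negSeries := by
  have h := congrArg (PowerSeries.map (_root_.frobenius F4 2)) negSeries_mul
  rw [map_mul, map_add, map_one, map_frobenius_wSeries, PowerSeries.map_X, ← negSeries_mul] at h
  exact isUnit_one_add_wSeries.mul_right_cancel h

theorem map_frobenius :
    formalGroup.toPowerSeries.map (_root_.frobenius F4 2) = formalGroup.toPowerSeries := by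
  change MvPowerSeries.map _ curveC.formalGroupSeries = curveC.formalGroupSeries
  rw [WeierstrassCurve.formalGroupSeries, PowerSeries.map_subst
    (PowerSeries.HasSubst.of_constantCoeff_zero constantCoeff_thirdPointSeries),
    map_frobenius_thirdPointSeries, map_frobenius_negSeries]

end FrobeniusInvariance

section Scale

variable {ζ : F4} (hζ : ζ ^ 3 = 1) {τ : Type*} {u v : MvPowerSeries τ F4}
  (hu : MvPowerSeries.constantCoeff u = 0) (hv : MvPowerSeries.constantCoeff v = 0)

include hζ

include hu in
theorem wSeries_subst_C_mul :
    curveC.wSeries.subst (MvPowerSeries.C ζ * u) = curveC.wSeries.subst u := by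
  refine (eq_wSeries_subst (by rw [map_mul, hu, mul_zero]) (constantCoeff_wSeries_subst hu) ?_).symm
  rw [mul_pow, ← map_pow, hζ, map_one, one_mul]
  exact wSeries_subst_eq_add hu

include hu hv in
theorem thirdAt_C_mul_C_mul (huv : u ≠ v) :
    thirdAt (MvPowerSeries.C ζ * u) (MvPowerSeries.C ζ * v) =
      MvPowerSeries.C ζ * thirdAt u v := by
  have hζ3 : (MvPowerSeries.C ζ : MvPowerSeries τ F4) ^ 3 = 1 := by rw [← map_pow, hζ, map_one]
  have hslope : slopeAt (MvPowerSeries.C ζ * u) (MvPowerSeries.C ζ * v) =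
      MvPowerSeries.C ζ ^ 2 * slopeAt u v := by
    have h := slopeAt_mul_sub (u := MvPowerSeries.C ζ * u) (v := MvPowerSeries.C ζ * v)
      (by rw [map_mul, hu, mul_zero]) (by rw [map_mul, hv, mul_zero])
    rw [wSeries_subst_C_mul hζ hu, wSeries_subst_C_mul hζ hv] at h
    refine mul_right_cancel₀ (sub_ne_zero.mpr huv.symm) ?_
    linear_combination MvPowerSeries.C ζ ^ 2 * (h - slopeAt_mul_sub hu hv) -
      slopeAt (MvPowerSeries.C ζ * u) (MvPowerSeries.C ζ * v) * (v - u) * hζ3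
  rw [thirdAt, thirdAt, hslope]
  linear_combination MvPowerSeries.C ζ * slopeAt u v ^ 2 * hζ3

include hu in
theorem negSeries_subst_C_mul : curveC.negSeries.subst (MvPowerSeries.C ζ * u) =
    MvPowerSeries.C ζ * curveC.negSeries.subst u := by
  have h := negSeries_subst_mul (u := MvPowerSeries.C ζ * u) (by rw [map_mul, hu, mul_zero])
  rw [wSeries_subst_C_mul hζ hu] at h
  refine (isUnit_one_add_wSeries_subst hu).mul_right_cancel ?_
  rw [h, mul_assoc, negSeries_subst_mul hu]

theorem rescale_formalGroup : formalGroup.toPowerSeries.rescale (fun _ => ζ) =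
    MvPowerSeries.C ζ * formalGroup.toPowerSeries := by
  have h0 := MvPowerSeries.constantCoeff_X (R := F4) (0 : Fin 2)
  have h1 := MvPowerSeries.constantCoeff_X (R := F4) (1 : Fin 2)
  have hX : ((fun _ => ζ : Fin 2 → F4) • MvPowerSeries.X : Fin 2 → MvPowerSeries (Fin 2) F4) =
      ![MvPowerSeries.C ζ * MvPowerSeries.X 0, MvPowerSeries.C ζ * MvPowerSeries.X 1] := by
    funext s
    fin_cases s <;> simp [MvPowerSeries.smul_eq_C_mul]
  change MvPowerSeries.rescale _ curveC.formalGroupSeries = _ * curveC.formalGroupSeries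
  rw [MvPowerSeries.rescale_eq_subst, hX, formalGroupSeries_subst (by rw [map_mul, h0, mul_zero])
    (by rw [map_mul, h1, mul_zero]), thirdAt_C_mul_C_mul hζ h0 h1
      (MvPowerSeries.X_inj.not.mpr zero_ne_one),
    negSeries_subst_C_mul hζ (constantCoeff_thirdAt h0 h1), thirdAt_X_X]
  rfl

end Scale

theorem frobenius_mul_self_add : FormalGroup.Endo.frobenius map_frobenius
    * FormalGroup.Endo.frobenius map_frobenius + (1 + 1) = 0 := by
  have hX : MvPowerSeries.constantCoeff (PowerSeries.X : PowerSeries F4) = 0 :=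
    MvPowerSeries.constantCoeff_X ()
  have hX4 : MvPowerSeries.constantCoeff ((PowerSeries.X : PowerSeries F4) ^ 4) = 0 := by
    rw [map_pow, hX, zero_pow four_ne_zero]
  refine FormalGroup.Endo.ext ?_
  have hdouble : (1 + 1 : formalGroup.Endo).toSeries =
      curveC.negSeries.subst ((PowerSeries.X : PowerSeries F4) ^ 4) := by
    rw [← thirdAt_self hX]
    exact formalGroupSeries_subst hX hX
  rw [FormalGroup.Endo.add_toSeries, FormalGroup.Endo.mul_frobenius_toSeries,
    FormalGroup.Endo.frobenius_toSeries, map_pow, PowerSeries.expand_X, ← pow_mul, hdouble]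
  exact formalGroupSeries_subst_negSeries hX4 (pow_ne_zero 4 PowerSeries.X_ne_zero)

theorem exists_ringEquiv {ζ : F4} (hζ : IsPrimitiveRoot ζ 3) :
    ∃ Φ : TwistedWitt (-2) ≃+* formalGroup.Endo,
      (Φ (TwistedWitt.gen (-2))).toSeries = PowerSeries.X ^ 2 ∧
      ∀ c : F4, (Φ (TwistedWitt.of (-2) (WittVector.teichmuller 2 c))).toSeries =
        PowerSeries.C c * PowerSeries.X := by
  refine FormalGroup.Endo.exists_twistedWitt_ringEquiv map_frobenius hζ
    (rescale_formalGroup hζ.pow_eq_one) rfl ?_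
  let := FormalGroup.Endo.ring (F := formalGroup) 2
  rw [Int.cast_neg, Int.cast_ofNat, ← one_add_one_eq_two (R := formalGroup.Endo)]
  exact eq_neg_of_add_eq_zero_left frobenius_mul_self_add

end curveC

theorem mainTheorem5 (ζ : F4) (hζ : IsPrimitiveRoot ζ 3) :
    ∃ (FC F2 : FormalGroup F4) (_ : FC.IsComm) (_ : F2.IsComm),
      -- `FC` is the formal group law of `y² - y = x³`, and `F2` is the Honda formal group law
      FC.toPowerSeries = curveC.formalGroupSeries ∧ IsHondaFormalGroup F2 ∧
      ∃ (ΦC : TwistedWitt (-2) ≃+* FC.Endo) (Φ2 : TwistedWitt 2 ≃+* F2.Endo),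
        -- `T` and `S` correspond to `x²`, and the Teichmüller lift of `c` corresponds to `cx`
        (ΦC (TwistedWitt.gen (-2))).toSeries = PowerSeries.X ^ 2 ∧
        (∀ c : F4, (ΦC (TwistedWitt.of (-2) (WittVector.teichmuller 2 c))).toSeries =
          PowerSeries.C c * PowerSeries.X) ∧
        (Φ2 (TwistedWitt.gen 2)).toSeries = PowerSeries.X ^ 2 ∧
        (∀ c : F4, (Φ2 (TwistedWitt.of 2 (WittVector.teichmuller 2 c))).toSeries =
          PowerSeries.C c * PowerSeries.X) ∧
        ∃ r α : W4,
          -- `r` is the square root of `-7` that is congruent to `1` modulo `4`,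
          -- and `α = (1 - 2ω) / r`
          r ^ 2 = -7 ∧ 4 ∣ r - 1 ∧ α * r = 1 - 2 * WittVector.teichmuller 2 ζ ∧
          α * frob α = -1 ∧
          ∃ e : (FC.Endo)ˣ ≃* (F2.Endo)ˣ,
            ∀ (γ : (FC.Endo)ˣ) (a b : W4),
              (γ : FC.Endo) =
                ΦC (TwistedWitt.of (-2) a + TwistedWitt.of (-2) b * TwistedWitt.gen (-2)) →
              (e γ : F2.Endo) =
                Φ2 (TwistedWitt.of 2 a
                  + TwistedWitt.of 2 b * (TwistedWitt.of 2 α * TwistedWitt.gen 2)) := by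
  obtain ⟨F2, hF2, hHonda, Φ2, hS, hc2⟩ := exists_isHondaFormalGroup_ringEquiv hζ
  obtain ⟨ΦC, hT, hcC⟩ := curveC.exists_ringEquiv hζ
  obtain ⟨r, α, hr, hr4, hαr, hα⟩ := W4.exists_sqrt_neg_seven_and_norm_neg_one hζ
  refine ⟨curveC.formalGroup, F2, inferInstance, hF2, rfl, hHonda, ΦC, Φ2, hT, hcC, hS, hc2,
    r, α, hr, hr4, hαr, hα,
    Units.mapEquiv ((ΦC.symm.trans (TwistedWitt.scaleGen α hα)).trans Φ2).toMulEquiv, ?_⟩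
  intro γ a b hγ
  change Φ2 (TwistedWitt.scaleGen α hα (ΦC.symm (γ : curveC.formalGroup.Endo))) = _
  rw [hγ, ΦC.symm_apply_apply, TwistedWitt.scaleGen_apply]
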